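/- Let $M$ be a smooth manifold without boundary (Hausdorff, second countable, of finite dimension $n$, not necessarily compact). A Morse function is a smooth function $f:M\to\mathbb R$ all of whose critical points are non-degenerate. A pseudo-gradient of $f$ is a smooth vector field $X$ on $M$ such that $X\cdot f<0$ outside the critical locus of $f$ and such that, at each critical point of $f$, the Hessian of the function $X\cdot f$ is negative definite. The unstable manifold $W^u(p,X)$ of a critical point $p$ is the set of points whose $X$-orbit is defined for all times $t\le 0$ and tends to $p$ as $t\to-\infty$. Let $f:M\to\mathbb R$ be a Morse function, let $X$ be a pseudo-gradient of $f$, and let $p$ be a critical point of $f$ of index $k$. Let $a<f(p)$, and assume that $W^u(p,X)$ contains a closed smooth $k$-disc $D$ (the image of the closed unit ball of $\mathbb R^k$ under a smooth injective immersion into $M$) whose boundary (the image of the unit sphere) lies in the level set $f^{-1}(a)$. Then, for every $\varepsilon$ with $0<\varepsilon\le f(p)-a$ and every open neighborhood $U$ of $D$ in $M$, there exists a family $(f_t)_{t\in[0,1]}$ of Morse functions on $M$, smooth in $(t,x)\in[0,1]\times M$, such that $f_0=f$, $f_1(p)=a+\varepsilon$, $X$ is a pseudo-gradient of $f_t$ for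 every $t\in[0,1]$, and the support of the deformation, that is, the closure of $\{x\in M : f_t(x)\neq f(x)\text{ for some }t\in[0,1]\}$, is contained in $U$. -/

import Mathlib

open Set Filter Topology
open scoped Manifold ContDiff

-- makes instance search find the standard manifold structure of a model space in its basic form
attribute [local instance 5000] chartedSpaceSelf

noncomputable section

namespace MorseReorder

section Defs

variable {n : ℕ} {M : Type*} [TopologicalSpace M] [ChartedSpace (EuclideanSpace ℝ (Fin n)) M]

/-- `p` is a critical point of `f : M → ℝ`: the differential of `f` vanishes at `p`
(this is meant for smooth `f`). -/
def IsCritical (f : M → ℝ) (p : M) : Prop :=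
  mfderiv (𝓡 n) 𝓘(ℝ, ℝ) f p = 0

/-- The Hessian of `g` at `p`, computed in the preferred chart at `p`. At a critical point of a
smooth function `g` this is the intrinsic Hessian, a symmetric bilinear form on the tangent space
at `p` (which Mathlib identifies with the model space through the preferred chart). -/
def hessian (g : M → ℝ) (p : M) :
    EuclideanSpace ℝ (Fin n) →L[ℝ] EuclideanSpace ℝ (Fin n) →L[ℝ] ℝ :=
  fderiv ℝ (fderiv ℝ (g ∘ (extChartAt (𝓡 n) p).symm)) (extChartAt (𝓡 n) p p)

/-- A Morse function: smooth, and all critical points are non-degenerate. -/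
def IsMorse (n : ℕ) {M : Type*} [TopologicalSpace M]
    [ChartedSpace (EuclideanSpace ℝ (Fin n)) M] (f : M → ℝ) : Prop :=
  ContMDiff (𝓡 n) 𝓘(ℝ, ℝ) ∞ f ∧
    ∀ p : M, IsCritical (n := n) f p →
      ∀ v : EuclideanSpace ℝ (Fin n), (∀ w, hessian (n := n) f p v w = 0) → v = 0

/-- The (Morse) index of `f` at `p`: the largest dimension of a subspace on which the Hessian of
`f` at `p` is negative definite. -/
def morseIndex (n : ℕ) {M : Type*} [TopologicalSpace M]
    [ChartedSpace (EuclideanSpace ℝ (Fin n)) M] (f : M → ℝ) (p : M) : ℕ :=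
  sigNeg
    (LinearMap.BilinMap.toQuadraticMap (hessian (n := n) f p).toLinearMap₁₂)

/-- The derivative `X · f` of `f` along the vector field `X`. -/
def lieDeriv (X : (x : M) → TangentSpace (𝓡 n) x) (f : M → ℝ) (x : M) : ℝ :=
  mfderiv (𝓡 n) 𝓘(ℝ, ℝ) f x (X x)

/-- `X` is a pseudo-gradient of `f`: a smooth vector field such that `X · f < 0` outside the
critical locus of `f`, and such that the Hessian of `X · f` is negative definite at each critical
point of `f` (a maximum of `X · f`, hence a critical point of it). -/
structure IsPseudoGradient (X : (x : M) → TangentSpace (𝓡 n) x) (f : M → ℝ)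
    [IsManifold (𝓡 n) ∞ M] : Prop where
  smooth : ContMDiff (𝓡 n) (𝓡 n).tangent ∞ (fun x => (⟨x, X x⟩ : TangentBundle (𝓡 n) M))
  lyapunov : ∀ x : M, ¬ IsCritical (n := n) f x → lieDeriv X f x < 0
  nondegenerate : ∀ p : M, IsCritical (n := n) f p →
    ∀ v : EuclideanSpace ℝ (Fin n), v ≠ 0 → hessian (n := n) (lieDeriv X f) p v v < 0

/-- The unstable manifold `W^u(p, X)`: the points `x` such that the orbit of `X` through `x` is
defined for all non-positive times and tends to `p` as time tends to `-∞`. -/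
def unstableManifold (X : (x : M) → TangentSpace (𝓡 n) x) (p : M) : Set M :=
  {x | ∃ γ : ℝ → M, γ 0 = x ∧ IsMIntegralCurveOn γ X (Iic 0) ∧ Tendsto γ atBot (𝓝 p)}

/-- `φ` is a parametrization of a closed smooth `k`-disc in `M`: it is defined (at least) on the
closed unit ball of `ℝ^k`, on which it is smooth, injective and immersive. The disc is the image of
the closed unit ball, and its boundary is the image of the unit sphere. -/
structure IsDiscParam (n : ℕ) {M : Type*} [TopologicalSpace M]
    [ChartedSpace (EuclideanSpace ℝ (Fin n)) M] (k : ℕ)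
    (φ : EuclideanSpace ℝ (Fin k) → M) : Prop where
  smooth : ContMDiffOn (𝓡 k) (𝓡 n) ∞ φ (Metric.closedBall 0 1)
  injOn : InjOn φ (Metric.closedBall 0 1)
  immersive : ∀ y ∈ Metric.closedBall (0 : EuclideanSpace ℝ (Fin k)) 1,
    Function.Injective (mfderivWithin (𝓡 k) (𝓡 n) φ (Metric.closedBall 0 1) y)

end Defs

end MorseReorder

end

/-!
The deformation is `f - t ρ`, where `ρ` is supported near the disc `D`, is constant near every
critical point of `f`, takes the value `c = f p - a - ε` at `p`, and satisfies `X · ρ > X · f`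
away from the critical points (`exists_deformation_function`). Such a perturbation changes neither
the critical points nor their Hessians, and `X · f - t (X · ρ) < 0` elsewhere by convexity
(`isMorse_and_isPseudoGradient_sub`).

The function `ρ` is a product `P (f) κ (v)`, cut off outside a neighborhood of the part of `D`
above a level slightly larger than `a`. Here `P` is a step of slope less than `1` and height `c`,
which fits since `c` is less than the variation of `f` on this part, and `κ` is a nonincreasing
cutoff function. As `X · ρ = P' κ (X · f) + P κ' (X · v)`, it suffices that `v ≥ 0` be a smooth
function which vanishes exactly on `D` and satisfies `X · v ≤ 0`, near the part of `D` under
consideration.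

* Away from `p`, where `X · f < 0`, one may start from any function `g ≥ 0` which vanishes on `D`
  to second order, and nondegenerately in the normal directions: since `X` is tangent to `D`, the
  function `X · g` also vanishes to second order along `D`, so that `|X · g| ≤ C g`, and
  `v = exp (l f) g` is suitable for `l` large (`exists_nonincreasing_equation`).
* Near `p`, the Hessian `H` of `f` is negative definite on the tangent space of `D`, whose
  dimension is the index; its `H`-orthogonal is therefore positive definite, and `g = H (w, w)`,
  where `w` is the normal coordinate, satisfies `X · g ≤ 0`, because `H` decreases along the
  linear part of `X` (`exists_isDefiningOn_of_isCritical`).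
* These local equations are glued by a partition of unity (`exists_global_equation`).

The field `X` is tangent to `D` because `D` is contained in the unstable manifold and has the same
dimension (`exists_tangent_of_subset_unstableManifold`). This is proved without the unstable
manifold theorem, by comparing Hausdorff dimensions. If `X` were transverse to `D` at some point,
then sliding `D` along the integral curves would sweep out a set of dimension `k + 1` of points of
the unstable manifold. The backward orbits of these points end up near `p`, where the cone
estimate `exists_cone_estimate` shows that they lie on Lipschitz graphs over a space of dimension
`k`; as the integral curves separate at a bounded rate (`AntilipAt.transport`), the set has
dimension at most `k`.

Finally `p` lies in the interior of `D`: the restriction of `f` to `D`, constant on the boundary,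
has an extremum in the interior, which is a critical point of `f` as `X` is tangent to `D`, and
`p` is the only critical point in its unstable manifold (`exists_param_eq`).
-/

noncomputable section

namespace MorseReorder

/-! ### Functions and vector fields in charts -/

section Charts

variable {n : ℕ} {M : Type*} [TopologicalSpace M] [ChartedSpace (EuclideanSpace ℝ (Fin n)) M]

/-- The expression of the vector field `X` in the preferred chart at `x`. -/
def chartField (X : (x : M) → TangentSpace (𝓡 n) x) (x : M) (z : EuclideanSpace ℝ (Fin n)) :
    EuclideanSpace ℝ (Fin n) :=
  mfderiv (𝓡 n) 𝓘(ℝ, EuclideanSpace ℝ (Fin n)) (extChartAt (𝓡 n) x)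
    ((extChartAt (𝓡 n) x).symm z) (X ((extChartAt (𝓡 n) x).symm z))

/-- The expression of the function `u` in the preferred chart at `x`. -/
def chartFun (n : ℕ) {M F : Type*} [TopologicalSpace M]
    [ChartedSpace (EuclideanSpace ℝ (Fin n)) M] (u : M → F) (x : M)
    (z : EuclideanSpace ℝ (Fin n)) : F :=
  u ((extChartAt (𝓡 n) x).symm z)

variable [IsManifold (𝓡 n) ∞ M] {X : (x : M) → TangentSpace (𝓡 n) x}

theorem mdifferentiableAt_extChartAt_of_mem {x y : M} (hy : y ∈ (extChartAt (𝓡 n) x).source) :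
    MDifferentiableAt (𝓡 n) 𝓘(ℝ, EuclideanSpace ℝ (Fin n)) (extChartAt (𝓡 n) x) y :=
  (contMDiffAt_extChartAt' (n := ∞) (by simpa using hy)).mdifferentiableAt (by simp)

theorem mdifferentiableAt_extChartAt_symm_of_mem {x : M} {z : EuclideanSpace ℝ (Fin n)}
    (hz : z ∈ (extChartAt (𝓡 n) x).target) :
    MDifferentiableAt 𝓘(ℝ, EuclideanSpace ℝ (Fin n)) (𝓡 n) (extChartAt (𝓡 n) x).symm z :=
  ((contMDiffOn_extChartAt_symm (n := ∞) x).contMDiffAt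
    ((isOpen_extChartAt_target x).mem_nhds hz)).mdifferentiableAt (by simp)

theorem contDiffOn_chartField
    (hX : ContMDiff (𝓡 n) (𝓡 n).tangent ∞ (fun x => (⟨x, X x⟩ : TangentBundle (𝓡 n) M))) (x : M) :
    ContDiffOn ℝ ∞ (chartField X x) (extChartAt (𝓡 n) x).target := by
  have h1 : ContMDiffOn (𝓡 n) 𝓘(ℝ, EuclideanSpace ℝ (Fin n)) ∞
      (fun y => (trivializationAt (EuclideanSpace ℝ (Fin n)) (TangentSpace (𝓡 n)) x
        (⟨y, X y⟩ : TangentBundle (𝓡 n) M)).2) (extChartAt (𝓡 n) x).source := by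
    have := ((trivializationAt (EuclideanSpace ℝ (Fin n))
      (TangentSpace (𝓡 n) : M → Type _) x).contMDiffOn_section_baseSet_iff (n := ∞) (IB := 𝓡 n)
        (s := X)).1 hX.contMDiffOn
    simpa using this
  have h2 := h1.comp (contMDiffOn_extChartAt_symm (n := ∞) x)
    (fun z hz => (extChartAt (𝓡 n) x).map_target hz)
  refine (contMDiffOn_iff_contDiffOn.1 h2).congr fun z hz => ?_
  have hs := (extChartAt (𝓡 n) x).map_target hz
  rw [extChartAt_source] at hs
  have h3 : (trivializationAt (EuclideanSpace ℝ (Fin n)) (TangentSpace (𝓡 n))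
      x).continuousLinearMapAt ℝ ((extChartAt (𝓡 n) x).symm z) (X ((extChartAt (𝓡 n) x).symm z)) =
      (trivializationAt (EuclideanSpace ℝ (Fin n)) (TangentSpace (𝓡 n)) x
        (⟨_, X ((extChartAt (𝓡 n) x).symm z)⟩ : TangentBundle (𝓡 n) M)).2 := by
    rw [Bundle.Trivialization.continuousLinearMapAt_apply,
      Bundle.Trivialization.linearMapAt_apply, if_pos (by simpa using hs)]
  exact (DFunLike.congr_fun (TangentBundle.continuousLinearMapAt_trivializationAt hs)
    (X ((extChartAt (𝓡 n) x).symm z))).symm.trans h3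

theorem contDiffAt_chartField
    (hX : ContMDiff (𝓡 n) (𝓡 n).tangent ∞ (fun x => (⟨x, X x⟩ : TangentBundle (𝓡 n) M)))
    {x : M} {z : EuclideanSpace ℝ (Fin n)} (hz : z ∈ (extChartAt (𝓡 n) x).target) :
    ContDiffAt ℝ ∞ (chartField X x) z :=
  (contDiffOn_chartField hX x).contDiffAt ((isOpen_extChartAt_target x).mem_nhds hz)

theorem hasDerivWithinAt_extChartAt_comp {γ : ℝ → M} {s : Set ℝ} (hγ : IsMIntegralCurveOn γ X s)
    {t : ℝ} (ht : t ∈ s) {x : M} (hx : γ t ∈ (extChartAt (𝓡 n) x).source) :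
    HasDerivWithinAt (fun r => extChartAt (𝓡 n) x (γ r))
      (chartField X x (extChartAt (𝓡 n) x (γ t))) s t := by
  have h := HasMFDerivAt.comp_hasMFDerivWithinAt t
    (mdifferentiableAt_extChartAt_of_mem hx).hasMFDerivAt (hγ t ht)
  have h2 := h.congr_mfderiv (f₁' := (ContinuousLinearMap.toSpanSingleton ℝ
    (chartField X x (extChartAt (𝓡 n) x (γ t))) : ℝ →L[ℝ] EuclideanSpace ℝ (Fin n))) (by
      rw [chartField, (extChartAt (𝓡 n) x).left_inv hx]
      exact ContinuousLinearMap.ext fun a : ℝ => map_smul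
        (mfderiv (𝓡 n) 𝓘(ℝ, EuclideanSpace ℝ (Fin n)) (extChartAt (𝓡 n) x) (γ t)) a (X (γ t)))
  exact hasMFDerivWithinAt_iff_hasFDerivWithinAt.1 h2

theorem contDiffAt_chartFun {u : M → ℝ} {x : M} {z : EuclideanSpace ℝ (Fin n)}
    (hz : z ∈ (extChartAt (𝓡 n) x).target)
    (hu : ContMDiffAt (𝓡 n) 𝓘(ℝ, ℝ) ∞ u ((extChartAt (𝓡 n) x).symm z)) :
    ContDiffAt ℝ ∞ (chartFun n u x) z := by
  have h := hu.comp z ((contMDiffOn_extChartAt_symm (n := ∞) x).contMDiffAt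
    ((isOpen_extChartAt_target x).mem_nhds hz))
  exact contMDiffAt_iff_contDiffAt.1 h

theorem mfderiv_comp_extChartAt_symm {u : M → ℝ} {x y : M} (hy : y ∈ (extChartAt (𝓡 n) x).source)
    (hu : MDifferentiableAt (𝓡 n) 𝓘(ℝ, ℝ) u y) (v : TangentSpace (𝓡 n) y) :
    mfderiv (𝓡 n) 𝓘(ℝ, ℝ) u y v =
      fderiv ℝ (chartFun n u x) (extChartAt (𝓡 n) x y)
        (mfderiv (𝓡 n) 𝓘(ℝ, EuclideanSpace ℝ (Fin n)) (extChartAt (𝓡 n) x) y v) := by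
  have hz := (extChartAt (𝓡 n) x).map_source hy
  have hw : MDifferentiableAt 𝓘(ℝ, EuclideanSpace ℝ (Fin n)) 𝓘(ℝ, ℝ) (chartFun n u x)
      (extChartAt (𝓡 n) x y) := by
    refine MDifferentiableAt.comp (I' := 𝓡 n) _ ?_ (mdifferentiableAt_extChartAt_symm_of_mem hz)
    rwa [(extChartAt (𝓡 n) x).left_inv hy]
  have h1 := mfderiv_comp y hw (mdifferentiableAt_extChartAt_of_mem hy)
  have h2 : chartFun n u x ∘ extChartAt (𝓡 n) x =ᶠ[𝓝 y] u := by
    filter_upwards [extChartAt_source_mem_nhds' hy] with w hw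
    exact congrArg u ((extChartAt (𝓡 n) x).left_inv hw)
  rw [h2.mfderiv_eq, mfderiv_eq_fderiv] at h1
  have h3 := DFunLike.congr_fun h1 v
  exact h3

theorem lieDeriv_eq_chart {u : M → ℝ} {x y : M} (hy : y ∈ (extChartAt (𝓡 n) x).source)
    (hu : MDifferentiableAt (𝓡 n) 𝓘(ℝ, ℝ) u y) :
    lieDeriv X u y = fderiv ℝ (chartFun n u x) (extChartAt (𝓡 n) x y)
      (chartField X x (extChartAt (𝓡 n) x y)) := by
  rw [lieDeriv, mfderiv_comp_extChartAt_symm hy hu, chartField, (extChartAt (𝓡 n) x).left_inv hy]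

theorem isCritical_iff_fderiv_chartFun {u : M → ℝ} {x y : M} (hy : y ∈ (extChartAt (𝓡 n) x).source)
    (hu : MDifferentiableAt (𝓡 n) 𝓘(ℝ, ℝ) u y) :
    IsCritical (n := n) u y ↔ fderiv ℝ (chartFun n u x) (extChartAt (𝓡 n) x y) = 0 := by
  constructor
  · intro h
    have hz := (extChartAt (𝓡 n) x).map_source hy
    have hy' : (extChartAt (𝓡 n) x).symm (extChartAt (𝓡 n) x y) = y :=
      (extChartAt (𝓡 n) x).left_inv hy
    have h1 := mfderiv_comp (extChartAt (𝓡 n) x y) (g := u) (by rwa [hy'])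
      (mdifferentiableAt_extChartAt_symm_of_mem (n := n) hz)
    rw [hy', show mfderiv (𝓡 n) 𝓘(ℝ, ℝ) u y = 0 from h] at h1
    rw [← mfderiv_eq_fderiv]
    refine h1.trans ?_
    exact ContinuousLinearMap.zero_comp _
  · intro h
    ext v
    have := mfderiv_comp_extChartAt_symm hy hu v
    rw [h] at this
    exact this

end Charts

/-! ### Quadratic forms and their index -/

section Quadratic

variable {E : Type*} [NormedAddCommGroup E] [NormedSpace ℝ E] [FiniteDimensional ℝ E]

/-- A quadratic form is bounded below by a multiple of the square of a projection whose rank is the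
index: on a cone where the form is negative, this projection is therefore injective. -/
theorem exists_projection_index (H : E →L[ℝ] E →L[ℝ] ℝ) :
    ∃ (π : E →L[ℝ] (Fin (sigNeg (LinearMap.BilinMap.toQuadraticMap H.toLinearMap₁₂)) → ℝ)) (C : ℝ),
      0 ≤ C ∧ ∀ z, -(C * ‖π z‖ ^ 2) ≤ H z z := by
  set Q : QuadraticForm ℝ E := LinearMap.BilinMap.toQuadraticMap H.toLinearMap₁₂ with hQ
  obtain ⟨w, hw⟩ := QuadraticForm.equivalent_weightedSumSquares Q
  have hcard : sigNeg Q = {i | w i < 0}.ncard :=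
    QuadraticForm.sigNeg_of_equiv_weightedSumSquares hw
  obtain ⟨e⟩ := hw
  have hfin : Fintype.card {i // w i < 0} = sigNeg Q := by
    rw [hcard, ← Nat.card_coe_set_eq, Nat.card_eq_fintype_card]; rfl
  let σ : Fin (sigNeg Q) ≃ {i // w i < 0} := (Fintype.equivFinOfCardEq hfin).symm
  let π : E →ₗ[ℝ] (Fin (sigNeg Q) → ℝ) :=
    LinearMap.pi fun j => (LinearMap.proj (σ j : Fin _)) ∘ₗ e.toLinearEquiv.toLinearMap
  refine ⟨π.toContinuousLinearMap, ∑ i, |w i|, Finset.sum_nonneg fun _ _ => abs_nonneg _,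
    fun z => ?_⟩
  have h1 : H z z = ∑ i, w i * (e z i * e z i) := by
    have : Q z = QuadraticMap.weightedSumSquares ℝ w (e z) := (e.map_app z).symm
    rw [QuadraticMap.weightedSumSquares_apply] at this
    simpa [hQ] using this
  rw [h1, Finset.sum_mul, ← Finset.sum_neg_distrib]
  refine Finset.sum_le_sum fun i _ => ?_
  by_cases hi : w i < 0
  · have h2 : |e z i| ≤ ‖π z‖ := by
      have := norm_le_pi_norm (π z) (σ.symm ⟨i, hi⟩)
      simpa [π] using this
    have h3 : e z i * e z i ≤ ‖π z‖ ^ 2 := by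
      rw [← abs_mul_abs_self]; nlinarith [abs_nonneg (e z i)]
    rw [abs_of_neg hi]
    simp only [LinearMap.coe_toContinuousLinearMap']
    nlinarith
  · have := abs_nonneg (w i)
    have := mul_nonneg (not_lt.1 hi) (mul_self_nonneg (e z i))
    nlinarith [mul_nonneg (abs_nonneg (w i)) (sq_nonneg ‖π.toContinuousLinearMap z‖)]

/-- The orthogonal of a negative definite subspace of maximal dimension is a positive definite
complement. -/
theorem exists_isCompl_posDef {H : E →L[ℝ] E →L[ℝ] ℝ} (hsymm : ∀ v w, H v w = H w v)
    (hnd : ∀ v, (∀ w, H v w = 0) → v = 0) {V : Submodule ℝ E}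
    (hV : Module.finrank ℝ V = sigNeg (LinearMap.BilinMap.toQuadraticMap H.toLinearMap₁₂))
    (hneg : ∀ v ∈ V, v ≠ 0 → H v v < 0) :
    ∃ V' : Submodule ℝ E, IsCompl V V' ∧ (∀ v ∈ V, ∀ w ∈ V', H v w = 0) ∧
      ∀ w ∈ V', w ≠ 0 → 0 < H w w := by
  let B : LinearMap.BilinForm ℝ E := H.toLinearMap₁₂
  have hB : ∀ v w, B v w = H v w := fun v w => rfl
  have hBs : B.IsSymm := ⟨fun v w => by simpa [hB] using hsymm v w⟩
  have hdisj : ∀ z ∈ V, z ∈ B.orthogonal V → z = 0 := by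
    intro z hz hz'
    by_contra h0
    have := hneg z hz h0
    have h2 : B z z = 0 := hz' z hz
    rw [hB] at h2
    linarith
  have hcompl : IsCompl V (B.orthogonal V) := by
    apply LinearMap.BilinForm.isCompl_orthogonal_of_restrict_nondegenerate hBs.isRefl
    apply LinearMap.BilinForm.nondegenerate_restrict_of_disjoint_orthogonal B hBs.isRefl
    rw [Submodule.disjoint_def]
    exact hdisj
  refine ⟨B.orthogonal V, hcompl, fun v hv w hw => hw v hv, ?_⟩
  -- a nonpositive vector in the complement would enlarge the negative subspace
  have hpsd : ∀ w ∈ B.orthogonal V, 0 ≤ H w w := by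
    intro w hw
    by_contra hlt
    push Not at hlt
    have hw0 : w ∉ V := fun h => by
      have := hdisj w h hw
      simp [this] at hlt
    have hle : Module.finrank ℝ (V ⊔ Submodule.span ℝ {w} : Submodule ℝ E) ≤
        sigNeg (LinearMap.BilinMap.toQuadraticMap H.toLinearMap₁₂) := by
      apply le_sigNeg_of_negDef
      rintro ⟨x, hx⟩ hx0
      obtain ⟨v, hv, u, hu, rfl⟩ := Submodule.mem_sup.1 hx
      obtain ⟨c, rfl⟩ := Submodule.mem_span_singleton.1 hu
      have h1 : H v w = 0 := hw v hv
      have h2 : H w v = 0 := by rw [hsymm]; exact h1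
      have hval : H (v + c • w) (v + c • w) < 0 := by
        simp only [map_add, map_smul, add_apply,
          smul_apply, smul_eq_mul, h1, h2]
        by_cases hc : c = 0
        · subst hc
          have : v ≠ 0 := fun h => hx0 (by simp [h])
          simpa using hneg v hv this
        · have h3 : 0 < c * c := mul_self_pos.2 hc
          by_cases hv0 : v = 0
          · subst hv0; simp; nlinarith
          · have := hneg v hv hv0
            nlinarith
      have hval' : 0 < -(H (v + c • w) (v + c • w)) := neg_pos.2 hval
      exact hval'
    have hlt2 : Module.finrank ℝ V <
        Module.finrank ℝ (V ⊔ Submodule.span ℝ {w} : Submodule ℝ E) := by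
      apply Submodule.finrank_lt_finrank_of_lt
      refine lt_of_le_of_ne le_sup_left fun h => hw0 ?_
      rw [h]
      exact Submodule.mem_sup_right (Submodule.mem_span_singleton_self w)
    omega
  intro w hw hw0
  refine lt_of_le_of_ne (hpsd w hw) fun h0 => hw0 (hnd w fun x => ?_)
  have hx : x ∈ V ⊔ B.orthogonal V := by rw [hcompl.sup_eq_top]; trivial
  obtain ⟨v, hv, u, hu, rfl⟩ := Submodule.mem_sup.1 hx
  have h1 : H w v = 0 := by rw [hsymm]; exact hw v hv
  rw [map_add, h1, zero_add]
  -- a null vector of a semidefinite form lies in its radical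
  by_contra hne
  have hquad : ∀ t : ℝ, 0 ≤ H (u + t • w) (u + t • w) := fun t =>
    hpsd _ (Submodule.add_mem _ hu (Submodule.smul_mem _ _ hw))
  have hex : ∀ t : ℝ, H (u + t • w) (u + t • w) = H u u + 2 * t * H w u := by
    intro t
    simp only [map_add, map_smul, add_apply,
      smul_apply, smul_eq_mul, hsymm u w, ← h0]
    ring
  have := hquad (-(H u u + 1) / (2 * H w u))
  rw [hex] at this
  field_simp at this
  nlinarith [this]

end Quadratic

/-! ### Second order behaviour of derivatives along a field -/

section Calculus

variable {E F G : Type*} [NormedAddCommGroup E] [NormedSpace ℝ E]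
  [NormedAddCommGroup F] [NormedSpace ℝ F] [NormedAddCommGroup G] [NormedSpace ℝ G]

theorem hasFDerivAt_fderiv_apply {u : E → ℝ} {Y : E → E} {z : E} (hu : ContDiffAt ℝ 2 u z)
    (hY : DifferentiableAt ℝ Y z) :
    HasFDerivAt (fun x => fderiv ℝ u x (Y x))
      ((fderiv ℝ u z).comp (fderiv ℝ Y z) + (fderiv ℝ (fderiv ℝ u) z).flip (Y z)) z := by
  have h1 : DifferentiableAt ℝ (fderiv ℝ u) z :=
    (hu.fderiv_right (m := 1) (by norm_num)).differentiableAt (by simp)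
  exact h1.hasFDerivAt.clm_apply hY.hasFDerivAt

theorem contDiffAt_fderiv_apply {u : E → ℝ} {Y : E → E} {z : E} (hu : ContDiffAt ℝ ∞ u z)
    (hY : ContDiffAt ℝ ∞ Y z) : ContDiffAt ℝ ∞ (fun x => fderiv ℝ u x (Y x)) z :=
  (hu.fderiv_right (m := ∞) (by simp)).clm_apply hY

theorem symm_fderiv_fderiv {u : E → ℝ} {z : E} (hu : ContDiffAt ℝ 2 u z) (v w : E) :
    fderiv ℝ (fderiv ℝ u) z v w = fderiv ℝ (fderiv ℝ u) z w v :=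
  (hu.isSymmSndFDerivAt (by simp)) v w

/-- A nonnegative function vanishing along a parametrized submanifold has a derivative, in a
direction field tangent to it, which vanishes to second order along it. -/
theorem fderiv_tangential_eq_zero {u : E → ℝ} {Y : E → E} {σ : F → E} {y₀ ξ : F}
    (hu : ContDiffAt ℝ 2 u (σ y₀)) (hY : DifferentiableAt ℝ Y (σ y₀))
    (hσ : DifferentiableAt ℝ σ y₀) (hnonneg : ∀ᶠ z in 𝓝 (σ y₀), 0 ≤ u z)
    (hzero : ∀ᶠ y in 𝓝 y₀, u (σ y) = 0) (htan : Y (σ y₀) = fderiv ℝ σ y₀ ξ) :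
    fderiv ℝ u (σ y₀) (Y (σ y₀)) = 0 ∧ fderiv ℝ (fun x => fderiv ℝ u x (Y x)) (σ y₀) = 0 := by
  have hd : ∀ᶠ y in 𝓝 y₀, fderiv ℝ u (σ y) = 0 := by
    filter_upwards [hzero, hσ.continuousAt.eventually hnonneg.eventually_nhds] with y hy hy'
    apply IsLocalMin.fderiv_eq_zero
    filter_upwards [hy'] with z hz
    rwa [hy]
  have hd0 := hd.self_of_nhds
  have h2 : fderiv ℝ (fderiv ℝ u) (σ y₀) (Y (σ y₀)) = 0 := by
    have h1 : DifferentiableAt ℝ (fderiv ℝ u) (σ y₀) :=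
      (hu.fderiv_right (m := 1) (by norm_num)).differentiableAt (by simp)
    have h3 := (h1.hasFDerivAt.comp y₀ hσ.hasFDerivAt).fderiv
    have h4 : (fderiv ℝ u) ∘ σ =ᶠ[𝓝 y₀] fun _ => 0 := hd
    rw [h4.fderiv_eq] at h3
    have h5 := DFunLike.congr_fun h3 ξ
    simp only [fderiv_fun_const, Pi.zero_apply, ContinuousLinearMap.comp_apply] at h5
    rw [htan, ← h5]; rfl
  refine ⟨by rw [hd0]; rfl, ?_⟩
  rw [(hasFDerivAt_fderiv_apply hu hY).fderiv, hd0]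
  ext v
  simp only [ContinuousLinearMap.zero_comp, zero_add, ContinuousLinearMap.flip_apply]
  rw [symm_fderiv_fderiv hu, h2]

/-- At a nondegenerate critical point of `u` which is a local maximum of `Y · u`, the field `Y`
vanishes and the second derivative of `Y · u` is given by the linear part of `Y`. -/
theorem field_eq_zero_and_hessian {u : E → ℝ} {Y : E → E} {z : E} (hu : ContDiffAt ℝ ∞ u z)
    (hY : ContDiffAt ℝ ∞ Y z) (hcrit : fderiv ℝ u z = 0)
    (hnd : ∀ v, (∀ w, fderiv ℝ (fderiv ℝ u) z v w = 0) → v = 0)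
    (hmax : ∀ᶠ x in 𝓝 z, fderiv ℝ u x (Y x) ≤ 0) :
    Y z = 0 ∧ ∀ v, fderiv ℝ (fderiv ℝ fun x => fderiv ℝ u x (Y x)) z v v =
      2 * fderiv ℝ (fderiv ℝ u) z (fderiv ℝ Y z v) v := by
  have hu2 : ContDiffAt ℝ 2 u z := hu.of_le ENat.LEInfty.out
  have hYd : DifferentiableAt ℝ Y z := hY.differentiableAt (by simp)
  have h0 : Y z = 0 := by
    apply hnd
    intro w
    have h1 : fderiv ℝ (fun x => fderiv ℝ u x (Y x)) z = 0 := by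
      apply IsLocalMax.fderiv_eq_zero
      filter_upwards [hmax] with x hx
      simpa [hcrit] using hx
    rw [(hasFDerivAt_fderiv_apply hu2 hYd).fderiv, hcrit] at h1
    have h2 := DFunLike.congr_fun h1 w
    simp only [ContinuousLinearMap.zero_comp, zero_add, ContinuousLinearMap.flip_apply] at h2
    rw [symm_fderiv_fderiv hu2]; exact h2
  refine ⟨h0, fun v => ?_⟩
  have hev : fderiv ℝ (fun x => fderiv ℝ u x (Y x)) =ᶠ[𝓝 z] fun x =>
      (fderiv ℝ u x).comp (fderiv ℝ Y x) + (fderiv ℝ (fderiv ℝ u) x).flip (Y x) := by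
    filter_upwards [(hu2.eventually (by simp)),
      ((hY.of_le (m := 1) ENat.LEInfty.out).eventually (by simp))] with x hx hx'
    exact (hasFDerivAt_fderiv_apply hx (hx'.differentiableAt (by simp))).fderiv
  rw [hev.fderiv_eq]
  have d1 : HasFDerivAt (fderiv ℝ u) (fderiv ℝ (fderiv ℝ u) z) z :=
    ((hu.fderiv_right (m := ∞) (by simp)).differentiableAt (by simp)).hasFDerivAt
  have d2 : HasFDerivAt (fderiv ℝ (fderiv ℝ u)) (fderiv ℝ (fderiv ℝ (fderiv ℝ u)) z) z :=
    (((hu.fderiv_right (m := ∞) (by simp)).fderiv_right (m := ∞) (by simp)).differentiableAt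
      (by simp)).hasFDerivAt
  have d3 : HasFDerivAt (fderiv ℝ Y) (fderiv ℝ (fderiv ℝ Y) z) z :=
    ((hY.fderiv_right (m := ∞) (by simp)).differentiableAt (by simp)).hasFDerivAt
  have d4 := hYd.hasFDerivAt
  have e1 : HasFDerivAt (fun x => (fderiv ℝ u x) (fderiv ℝ Y x v)) _ z :=
    d1.clm_apply (d3.clm_apply (hasFDerivAt_const v z))
  have e2 : HasFDerivAt (fun x => (fderiv ℝ (fderiv ℝ u) x v) (Y x)) _ z :=
    (d2.clm_apply (hasFDerivAt_const v z)).clm_apply d4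
  have hd : DifferentiableAt ℝ (fun x => (fderiv ℝ u x).comp (fderiv ℝ Y x) +
      (fderiv ℝ (fderiv ℝ u) x).flip (Y x)) z := by
    refine DifferentiableAt.congr_of_eventuallyEq ?_ hev.symm
    exact ((contDiffAt_fderiv_apply hu hY).fderiv_right (m := ∞) (by simp)).differentiableAt
      (by simp)
  have e3 := (hd.hasFDerivAt.clm_apply (hasFDerivAt_const v z)).fderiv
  have e4 := (e1.add e2).fderiv
  have e5 : (fun x => (fderiv ℝ u x).comp (fderiv ℝ Y x) v +
      (fderiv ℝ (fderiv ℝ u) x).flip (Y x) v) = (fun x => (fderiv ℝ u x) (fderiv ℝ Y x v)) +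
      (fun x => (fderiv ℝ (fderiv ℝ u) x v) (Y x)) := by
    ext x; simp
  have e6 := DFunLike.congr_fun (e3.symm.trans ((congrArg (fun g => fderiv ℝ g z) e5).trans e4)) v
  simp [hcrit, h0] at e6
  rw [e6, symm_fderiv_fderiv hu2 v]
  ring

/-- A function vanishing together with its derivative along a factor is bounded by the square of
the distance to it. -/
theorem eventually_abs_le_sq_of_fderiv_eq_zero {w : F × G → ℝ} {ξ₀ : F}
    (hw : ContDiffAt ℝ 2 w (ξ₀, 0)) (h0 : ∀ᶠ ξ in 𝓝 ξ₀, w (ξ, 0) = 0)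
    (h1 : ∀ᶠ ξ in 𝓝 ξ₀, fderiv ℝ w (ξ, 0) = 0) :
    ∃ C : ℝ, ∀ᶠ z in 𝓝 ((ξ₀, 0) : F × G), |w z| ≤ C * ‖z.2‖ ^ 2 := by
  obtain ⟨K, t, ht, hK⟩ := (hw.fderiv_right (m := 1) (by norm_num)).exists_lipschitzOnWith
  have hdiff : ∀ᶠ z in 𝓝 ((ξ₀, 0) : F × G), DifferentiableAt ℝ w z :=
    (hw.eventually (by simp)).mono fun z hz => hz.differentiableAt (by simp)
  have hfst : Tendsto (Prod.fst : F × G → F) (𝓝 (ξ₀, 0)) (𝓝 ξ₀) := continuousAt_fst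
  obtain ⟨r, hr, hball⟩ := Metric.eventually_nhds_iff_ball.1
    ((eventually_mem_set.2 ht).and (hdiff.and ((hfst.eventually h0).and (hfst.eventually h1))))
  refine ⟨K, Metric.eventually_nhds_iff_ball.2 ⟨r, hr, fun z hz => ?_⟩⟩
  have hseg : ∀ s ∈ Icc (0 : ℝ) 1, ((z.1, s • z.2) : F × G) ∈ Metric.ball ((ξ₀, 0) : F × G) r := by
    intro s hs
    rw [← ball_prod_same] at hz ⊢
    refine ⟨hz.1, ?_⟩
    have := hz.2
    simp only [mem_ball_zero_iff] at this ⊢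
    rw [norm_smul, Real.norm_of_nonneg hs.1]
    nlinarith [norm_nonneg z.2, hs.2]
  have hderiv : ∀ s ∈ Icc (0 : ℝ) 1, HasDerivWithinAt (fun s : ℝ => w (z.1, s • z.2))
      (fderiv ℝ w (z.1, s • z.2) (0, z.2)) (Icc 0 1) s := by
    intro s hs
    have hg : HasDerivAt (fun s : ℝ => ((z.1, s • z.2) : F × G)) (0, z.2) s := by
      have := (hasDerivAt_const s z.1).prodMk ((hasDerivAt_id s).smul_const z.2)
      simpa using this
    exact ((hball _ (hseg s hs)).2.1.hasFDerivAt.comp_hasDerivAt s hg).hasDerivWithinAt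
  have hbound : ∀ s ∈ Ico (0 : ℝ) 1, ‖fderiv ℝ w (z.1, s • z.2) (0, z.2)‖ ≤ K * ‖z.2‖ ^ 2 := by
    intro s hs
    have hs' : s ∈ Icc (0 : ℝ) 1 := ⟨hs.1, hs.2.le⟩
    have hz0 := hseg 0 ⟨le_rfl, zero_le_one⟩
    rw [zero_smul] at hz0
    have h2 := hK.norm_sub_le (hball _ (hseg s hs')).1 (hball _ hz0).1
    rw [(hball _ hz0).2.2.2, sub_zero] at h2
    have h3 : ‖((z.1, s • z.2) : F × G) - (z.1, 0)‖ ≤ ‖z.2‖ := by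
      simp only [Prod.mk_sub_mk, sub_self, sub_zero]
      rw [Prod.norm_mk, norm_zero, norm_smul, Real.norm_of_nonneg hs.1]
      exact max_le (norm_nonneg _) (by nlinarith [norm_nonneg z.2, hs.2])
    have h4 : ‖((0, z.2) : F × G)‖ = ‖z.2‖ := by simp [Prod.norm_mk]
    calc _ ≤ ‖fderiv ℝ w (z.1, s • z.2)‖ * ‖((0, z.2) : F × G)‖ := ContinuousLinearMap.le_opNorm _ _
      _ ≤ (K * ‖z.2‖) * ‖z.2‖ := by
          rw [h4]
          gcongr
          exact h2.trans (by gcongr)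
      _ = K * ‖z.2‖ ^ 2 := by ring
  have hmv := norm_image_sub_le_of_norm_deriv_le_segment' hderiv hbound 1 ⟨zero_le_one, le_rfl⟩
  have hz0 := (hball _ (hseg 0 ⟨le_rfl, zero_le_one⟩)).2.2.1
  simp only [one_smul, zero_smul, sub_zero, mul_one] at hmv
  rw [hz0, sub_zero, Real.norm_eq_abs] at hmv
  exact hmv

end Calculus

/-! ### Integral curves -/

section IntegralCurve

variable {n : ℕ} {M : Type*} [TopologicalSpace M] [ChartedSpace (EuclideanSpace ℝ (Fin n)) M]
  {X : (x : M) → TangentSpace (𝓡 n) x}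

theorem hasDerivWithinAt_comp_integralCurve {u : M → ℝ} {γ : ℝ → M} {s : Set ℝ}
    (hγ : IsMIntegralCurveOn γ X s) {t : ℝ} (ht : t ∈ s)
    (hu : MDifferentiableAt (𝓡 n) 𝓘(ℝ, ℝ) u (γ t)) :
    HasDerivWithinAt (fun r => u (γ r)) (lieDeriv X u (γ t)) s t := by
  have h := HasMFDerivAt.comp_hasMFDerivWithinAt t hu.hasMFDerivAt (hγ t ht)
  have h2 := h.congr_mfderiv (f₁' := (ContinuousLinearMap.toSpanSingleton ℝ
    (lieDeriv X u (γ t)) : ℝ →L[ℝ] ℝ)) (by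
      exact ContinuousLinearMap.ext fun a : ℝ => map_smul
        (mfderiv (𝓡 n) 𝓘(ℝ, ℝ) u (γ t)) a (X (γ t)))
  exact hasMFDerivWithinAt_iff_hasFDerivWithinAt.1 h2

end IntegralCurve

section Flow

variable {n : ℕ} {M : Type*} [TopologicalSpace M] [ChartedSpace (EuclideanSpace ℝ (Fin n)) M]
  [IsManifold (𝓡 n) ∞ M] {X : (x : M) → TangentSpace (𝓡 n) x}

theorem eventually_lieDeriv_eq_chart {u : M → ℝ} {x y : M}
    (hy : y ∈ (extChartAt (𝓡 n) x).source) (hu : ContMDiffAt (𝓡 n) 𝓘(ℝ, ℝ) ∞ u y) :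
    ∀ᶠ y' in 𝓝 y, lieDeriv X u y' = fderiv ℝ (chartFun n u x) (extChartAt (𝓡 n) x y')
      (chartField X x (extChartAt (𝓡 n) x y')) := by
  filter_upwards [extChartAt_source_mem_nhds' hy,
    (contMDiffAt_iff_contMDiffAt_nhds (n := 1) (by simp)).1 (hu.of_le ENat.LEInfty.out)]
    with y' hy' hu'
  exact lieDeriv_eq_chart hy' (hu'.mdifferentiableAt (by simp))

theorem eventually_chartFun_lieDeriv {u : M → ℝ} {x y : M}
    (hy : y ∈ (extChartAt (𝓡 n) x).source) (hu : ContMDiffAt (𝓡 n) 𝓘(ℝ, ℝ) ∞ u y) :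
    chartFun n (lieDeriv X u) x =ᶠ[𝓝 (extChartAt (𝓡 n) x y)]
      fun z => fderiv ℝ (chartFun n u x) z (chartField X x z) := by
  have hz := (extChartAt (𝓡 n) x).map_source hy
  have ho := (isOpen_extChartAt_target (I := 𝓡 n) x).mem_nhds hz
  have hc : Tendsto (extChartAt (𝓡 n) x).symm (𝓝 (extChartAt (𝓡 n) x y)) (𝓝 y) := by
    have := (continuousOn_extChartAt_symm (I := 𝓡 n) x).continuousAt ho
    rwa [ContinuousAt, (extChartAt (𝓡 n) x).left_inv hy] at this
  filter_upwards [hc.eventually (eventually_lieDeriv_eq_chart (X := X) hy hu), ho] with z hz1 hz2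
  rw [(extChartAt (𝓡 n) x).right_inv hz2] at hz1
  exact hz1

theorem contMDiffAt_lieDeriv
    (hX : ContMDiff (𝓡 n) (𝓡 n).tangent ∞ (fun x => (⟨x, X x⟩ : TangentBundle (𝓡 n) M)))
    {u : M → ℝ} {y : M} (hu : ContMDiffAt (𝓡 n) 𝓘(ℝ, ℝ) ∞ u y) :
    ContMDiffAt (𝓡 n) 𝓘(ℝ, ℝ) ∞ (lieDeriv X u) y := by
  have hy := mem_extChartAt_source (I := 𝓡 n) y
  have hz := (extChartAt (𝓡 n) y).map_source hy
  have h1 : ContDiffAt ℝ ∞ (fun z => fderiv ℝ (chartFun n u y) z (chartField X y z))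
      (extChartAt (𝓡 n) y y) := by
    refine contDiffAt_fderiv_apply (contDiffAt_chartFun hz ?_) (contDiffAt_chartField hX hz)
    rwa [(extChartAt (𝓡 n) y).left_inv hy]
  refine ContMDiffAt.congr_of_eventuallyEq ?_ (eventually_lieDeriv_eq_chart (X := X) hy hu)
  exact (contMDiffAt_iff_contDiffAt.2 h1).comp y (contMDiffAt_extChartAt (n := ∞))

/-- Local control of the integral curves in a chart: on short time intervals, the curves which
meet a small neighborhood of `x` stay in the chart at `x`, and their distance in this chart is
distorted by a bounded factor. -/
theorem exists_integralCurve_control [T2Space M]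
    (hX : ContMDiff (𝓡 n) (𝓡 n).tangent ∞ (fun x => (⟨x, X x⟩ : TangentBundle (𝓡 n) M))) (x : M)
    {W : Set M} (hW : W ∈ 𝓝 x) :
    ∃ O ∈ 𝓝 x, ∃ τ > 0, ∃ C : ℝ, 0 ≤ C ∧ ∀ a b : ℝ, b - a ≤ τ → ∀ α β : ℝ → M,
      IsMIntegralCurveOn α X (Icc a b) → IsMIntegralCurveOn β X (Icc a b) →
      ∀ c ∈ Icc a b, α c ∈ O → β c ∈ O → ∀ r ∈ Icc a b, ∀ r' ∈ Icc a b,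
        (α r ∈ (extChartAt (𝓡 n) x).source ∧ α r ∈ W) ∧
        dist (extChartAt (𝓡 n) x (α r)) (extChartAt (𝓡 n) x (β r)) ≤
          C * dist (extChartAt (𝓡 n) x (α r')) (extChartAt (𝓡 n) x (β r')) := by
  have hz : extChartAt (𝓡 n) x x ∈ (extChartAt (𝓡 n) x).target := mem_extChartAt_target x
  obtain ⟨K, S, hS, hK⟩ := ((contDiffAt_chartField hX hz).of_le
    (m := 1) ENat.LEInfty.out).exists_lipschitzOnWith
  have hpre : extChartAt (𝓡 n) x ⁻¹' S ∩ W ∈ 𝓝 x :=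
    inter_mem ((continuousAt_extChartAt (I := 𝓡 n) x).preimage_mem_nhds hS) hW
  -- no flow is needed: a bump function, equal to `1` at `x`, confines the curves to the chart
  obtain ⟨χ, hχ, -⟩ := (SmoothBumpFunction.nhds_basis_support (I := 𝓡 n) hpre).mem_iff.1 hpre
  have hχs : ContMDiff (𝓡 n) 𝓘(ℝ, ℝ) ∞ χ := χ.contMDiff
  -- the bump function varies at bounded speed along the integral curves
  obtain ⟨L, hL⟩ : ∃ L, ∀ y, |lieDeriv X χ y| ≤ L := by
    have hcont : Continuous (lieDeriv X χ) := continuous_iff_continuousAt.2 fun y =>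
      (contMDiffAt_lieDeriv hX (hχs y)).continuousAt
    obtain ⟨L, hL⟩ := χ.hasCompactSupport.isCompact.exists_bound_of_continuousOn hcont.continuousOn
    refine ⟨max L 0, fun y => ?_⟩
    by_cases hy : y ∈ tsupport χ
    · exact (hL y hy).trans (le_max_left _ _)
    · have h0 : (χ : M → ℝ) =ᶠ[𝓝 y] fun _ => 0 := notMem_tsupport_iff_eventuallyEq.1 hy
      have : lieDeriv X χ y = 0 := by
        rw [lieDeriv, h0.mfderiv_eq, mfderiv_const]; rfl
      rw [this, abs_zero]; exact le_max_right _ _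
  have hL0 : 0 ≤ L := (abs_nonneg _).trans (hL x)
  -- during a time `τ` the bump function varies by at most `1 / 4`
  set τ : ℝ := 1 / (4 * (L + 1)) with hτ
  have hτ0 : 0 < τ := by positivity
  have hτL : L * τ ≤ 1 / 4 := by
    rw [hτ, mul_one_div, div_le_div_iff₀ (by positivity) (by norm_num)]; linarith
  refine ⟨{y | 3 / 4 < χ y}, ?_, τ, hτ0, Real.exp (K * τ), (Real.exp_pos _).le, ?_⟩
  · apply (isOpen_lt continuous_const hχs.continuous).mem_nhds
    simp; norm_num
  intro a b hab α β hα hβ c hc hαc hβc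
  have hstay : ∀ δ : ℝ → M, IsMIntegralCurveOn δ X (Icc a b) → 3 / 4 < χ (δ c) →
      ∀ r ∈ Icc a b, δ r ∈ (extChartAt (𝓡 n) x).source ∧
        extChartAt (𝓡 n) x (δ r) ∈ S ∧ δ r ∈ W := by
    intro δ hδ hδc r hr
    have h1 := (convex_Icc a b).norm_image_sub_le_of_norm_hasDerivWithin_le
      (fun t ht => hasDerivWithinAt_comp_integralCurve hδ ht
        ((hχs (δ t)).mdifferentiableAt (by simp))) (fun t _ => hL (δ t)) hc hr
    have h2 : ‖r - c‖ ≤ τ := by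
      rw [Real.norm_eq_abs, abs_le]; constructor <;> linarith [hc.1, hc.2, hr.1, hr.2]
    have h3 : χ (δ r) ≠ 0 := by
      intro h0
      rw [h0, Real.norm_eq_abs, zero_sub, abs_neg] at h1
      have := le_abs_self (χ (δ c))
      nlinarith [mul_le_mul_of_nonneg_left h2 hL0]
    have h4 : δ r ∈ tsupport χ := subset_tsupport _ h3
    exact ⟨χ.tsupport_subset_extChartAt_source h4, hχ h4⟩
  have hαs := fun r hr => And.intro (hstay α hα hαc r hr).1 (hstay α hα hαc r hr).2.1
  have hβs := fun r hr => And.intro (hstay β hβ hβc r hr).1 (hstay β hβ hβc r hr).2.1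
  -- Grönwall's inequality, forward and backward in time
  have hforw : ∀ r ∈ Icc a b, ∀ r' ∈ Icc a b, r' ≤ r →
      dist (extChartAt (𝓡 n) x (α r)) (extChartAt (𝓡 n) x (β r)) ≤ Real.exp (K * τ) *
        dist (extChartAt (𝓡 n) x (α r')) (extChartAt (𝓡 n) x (β r')) := by
    intro r hr r' hr' hle
    have hsub : Icc r' r ⊆ Icc a b := Icc_subset_Icc hr'.1 hr.2
    have hd : ∀ δ : ℝ → M, IsMIntegralCurveOn δ X (Icc a b) →
        (∀ r ∈ Icc a b, δ r ∈ (extChartAt (𝓡 n) x).source ∧ extChartAt (𝓡 n) x (δ r) ∈ S) →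
        ContinuousOn (fun t => extChartAt (𝓡 n) x (δ t)) (Icc r' r) ∧ ∀ t ∈ Ico r' r,
          HasDerivWithinAt (fun t => extChartAt (𝓡 n) x (δ t))
            (chartField X x (extChartAt (𝓡 n) x (δ t))) (Ici t) t := by
      intro δ hδ hδs
      have h1 : ∀ t ∈ Icc r' r, HasDerivWithinAt (fun t => extChartAt (𝓡 n) x (δ t))
          (chartField X x (extChartAt (𝓡 n) x (δ t))) (Icc r' r) t := fun t ht =>
        hasDerivWithinAt_extChartAt_comp (hδ.mono hsub) ht (hδs t (hsub ht)).1
      refine ⟨fun t ht => (h1 t ht).continuousWithinAt, fun t ht => ?_⟩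
      exact (h1 t ⟨ht.1, ht.2.le⟩).mono_of_mem_nhdsWithin (Icc_mem_nhdsGE_of_mem ht)
    have h := dist_le_of_trajectories_ODE_of_mem (v := fun _ => chartField X x) (s := fun _ => S)
      (fun t _ => hK) (hd α hα hαs).1 (hd α hα hαs).2
      (fun t ht => (hαs t (hsub ⟨ht.1, ht.2.le⟩)).2) (hd β hβ hβs).1 (hd β hβ hβs).2
      (fun t ht => (hβs t (hsub ⟨ht.1, ht.2.le⟩)).2) le_rfl r ⟨hle, le_rfl⟩
    rw [mul_comm] at h
    refine h.trans (mul_le_mul_of_nonneg_right (Real.exp_le_exp.2 ?_) dist_nonneg)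
    exact mul_le_mul_of_nonneg_left (by linarith [hr.2, hr'.1]) K.2
  have hback : ∀ r ∈ Icc a b, ∀ r' ∈ Icc a b, r ≤ r' →
      dist (extChartAt (𝓡 n) x (α r)) (extChartAt (𝓡 n) x (β r)) ≤ Real.exp (K * τ) *
        dist (extChartAt (𝓡 n) x (α r')) (extChartAt (𝓡 n) x (β r')) := by
    intro r hr r' hr' hle
    have hsub : Icc r r' ⊆ Icc a b := Icc_subset_Icc hr.1 hr'.2
    have hd : ∀ δ : ℝ → M, IsMIntegralCurveOn δ X (Icc a b) →
        (∀ r ∈ Icc a b, δ r ∈ (extChartAt (𝓡 n) x).source ∧ extChartAt (𝓡 n) x (δ r) ∈ S) →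
        ContinuousOn (fun t => extChartAt (𝓡 n) x (δ (-t))) (Icc (-r') (-r)) ∧
          ∀ t ∈ Ico (-r') (-r), HasDerivWithinAt (fun t => extChartAt (𝓡 n) x (δ (-t)))
            (-chartField X x (extChartAt (𝓡 n) x (δ (-t)))) (Ici t) t := by
      intro δ hδ hδs
      have hmap : MapsTo (fun t : ℝ => -t) (Icc (-r') (-r)) (Icc r r') := fun t ht =>
        ⟨by linarith [ht.2], by linarith [ht.1]⟩
      have h1 : ∀ t ∈ Icc (-r') (-r), HasDerivWithinAt (fun t => extChartAt (𝓡 n) x (δ (-t)))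
          (-chartField X x (extChartAt (𝓡 n) x (δ (-t)))) (Icc (-r') (-r)) t := by
        intro t ht
        have h2 := hasDerivWithinAt_extChartAt_comp (hδ.mono hsub) (hmap ht)
          (hδs _ (hsub (hmap ht))).1
        have h3 := h2.scomp t (hasDerivAt_neg t).hasDerivWithinAt hmap
        rw [neg_one_smul] at h3
        exact h3
      refine ⟨fun t ht => (h1 t ht).continuousWithinAt, fun t ht => ?_⟩
      exact (h1 t ⟨ht.1, ht.2.le⟩).mono_of_mem_nhdsWithin (Icc_mem_nhdsGE_of_mem ht)
    have hmem : ∀ t ∈ Ico (-r') (-r), -t ∈ Icc a b := fun t ht =>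
      hsub ⟨by linarith [ht.2], by linarith [ht.1]⟩
    have h := dist_le_of_trajectories_ODE_of_mem (v := fun _ z => -chartField X x z)
      (s := fun _ => S) (fun t _ => hK.neg) (hd α hα hαs).1 (hd α hα hαs).2
      (fun t ht => (hαs _ (hmem t ht)).2) (hd β hβ hβs).1 (hd β hβ hβs).2
      (fun t ht => (hβs _ (hmem t ht)).2) le_rfl (-r) ⟨by linarith, le_rfl⟩
    simp only [neg_neg] at h
    rw [mul_comm] at h
    refine h.trans (mul_le_mul_of_nonneg_right (Real.exp_le_exp.2 ?_) dist_nonneg)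
    exact mul_le_mul_of_nonneg_left (by linarith [hr.1, hr'.2]) K.2
  intro r hr r' hr'
  refine ⟨⟨(hαs r hr).1, (hstay α hα hαc r hr).2.2⟩, ?_⟩
  rcases le_total r' r with h | h
  · exact hforw r hr r' hr' h
  · exact hback r hr r' hr' h

/-- The map `Γ` into `M` is continuous at `q₀` within `S`, and expands distances up to a factor
when read in the preferred chart at `x`. -/
def AntilipAt {A : Type*} [PseudoMetricSpace A] (n : ℕ) {M : Type*} [TopologicalSpace M]
    [ChartedSpace (EuclideanSpace ℝ (Fin n)) M] (Γ : A → M) (S : Set A) (q₀ : A) (x : M) : Prop :=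
  Γ q₀ ∈ (extChartAt (𝓡 n) x).source ∧ ContinuousWithinAt Γ S q₀ ∧ ∃ C : ℝ, 0 ≤ C ∧
    ∀ᶠ p in 𝓝[S] q₀ ×ˢ 𝓝[S] q₀,
      dist p.1 p.2 ≤ C * dist (extChartAt (𝓡 n) x (Γ p.1)) (extChartAt (𝓡 n) x (Γ p.2))

/-- The notion does not depend on the chart: changes of charts are locally Lipschitz. -/
theorem AntilipAt.change {A : Type*} [PseudoMetricSpace A] {Γ : A → M} {S : Set A} {q₀ : A}
    {x x' : M} (h : AntilipAt n Γ S q₀ x) (hx' : Γ q₀ ∈ (extChartAt (𝓡 n) x').source) :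
    AntilipAt n Γ S q₀ x' := by
  obtain ⟨hx, hc, C, hC0, hC⟩ := h
  refine ⟨hx', hc, ?_⟩
  have hz := (extChartAt (𝓡 n) x').map_source hx'
  have htr : ContDiffAt ℝ ∞ (extChartAt (𝓡 n) x ∘ (extChartAt (𝓡 n) x').symm)
      (extChartAt (𝓡 n) x' (Γ q₀)) := by
    have h1 := (contMDiffOn_extChartAt_symm (n := ∞) (I := 𝓡 n) x').contMDiffAt
      ((isOpen_extChartAt_target x').mem_nhds hz)
    have h2 : ContMDiffAt (𝓡 n) 𝓘(ℝ, EuclideanSpace ℝ (Fin n)) ∞ (extChartAt (𝓡 n) x)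
        ((extChartAt (𝓡 n) x').symm (extChartAt (𝓡 n) x' (Γ q₀))) := by
      rw [(extChartAt (𝓡 n) x').left_inv hx']
      exact contMDiffAt_extChartAt' (by simpa using hx)
    exact contMDiffAt_iff_contDiffAt.1 (h2.comp _ h1)
  obtain ⟨K, t, ht, hK⟩ := (htr.of_le (m := 1) ENat.LEInfty.out).exists_lipschitzOnWith
  have hev : ∀ᶠ q in 𝓝[S] q₀, Γ q ∈ (extChartAt (𝓡 n) x').source ∧
      extChartAt (𝓡 n) x' (Γ q) ∈ t :=
    (hc.eventually (extChartAt_source_mem_nhds' hx')).and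
      (((continuousAt_extChartAt' hx').comp_continuousWithinAt hc).eventually_mem ht)
  refine ⟨C * K, by positivity, ?_⟩
  filter_upwards [hC, tendsto_fst.eventually hev, tendsto_snd.eventually hev] with p hp h1 h2
  have h3 := hK.dist_le_mul _ h1.2 _ h2.2
  simp only [Function.comp_apply] at h3
  rw [(extChartAt (𝓡 n) x').left_inv h1.1, (extChartAt (𝓡 n) x').left_inv h2.1] at h3
  rw [mul_assoc]
  exact hp.trans (mul_le_mul_of_nonneg_left h3 hC0)

/-- Expansion of distances at one time propagates, along a family of integral curves, to all
times. -/
theorem AntilipAt.transport [T2Space M]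
    (hX : ContMDiff (𝓡 n) (𝓡 n).tangent ∞ (fun x => (⟨x, X x⟩ : TangentBundle (𝓡 n) M)))
    {A : Type*} [PseudoMetricSpace A] {Γ : A → ℝ → M} {S : Set A} {q₀ : A} (hq₀ : q₀ ∈ S)
    (hΓ : ∀ q ∈ S, IsMIntegralCurveOn (Γ q) X (Iic 0)) {t t' : ℝ} (ht : t ∈ Iic (0 : ℝ))
    (ht' : t' ∈ Iic (0 : ℝ)) (h : AntilipAt n (fun q => Γ q t) S q₀ (Γ q₀ t)) :
    AntilipAt n (fun q => Γ q t') S q₀ (Γ q₀ t') := by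
  -- the property is transported over short times, and the half-line is connected
  have key := isPreconnected_Iic.induction₂' (s := Iic (0 : ℝ))
    (fun t t' => AntilipAt n (fun q => Γ q t) S q₀ (Γ q₀ t) →
      AntilipAt n (fun q => Γ q t') S q₀ (Γ q₀ t')) ?_ (fun _ _ _ _ _ _ h1 h2 h => h2 (h1 h)) ht ht'
  · exact key h
  intro t₀ ht₀
  obtain ⟨O, hO, τ, hτ, C, hC0, hC⟩ := exists_integralCurve_control hX (Γ q₀ t₀) univ_mem
  have hcont : ContinuousWithinAt (Γ q₀) (Iic 0) t₀ := (hΓ q₀ hq₀).continuousWithinAt ht₀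
  have hnear : ∀ᶠ t in 𝓝[Iic 0] t₀, |t - t₀| ≤ τ := by
    apply nhdsWithin_le_nhds
    filter_upwards [Metric.closedBall_mem_nhds t₀ hτ] with t ht
    rwa [Metric.mem_closedBall, Real.dist_eq] at ht
  have hmain : ∀ t₁ ∈ Iic (0 : ℝ), ∀ t₂ ∈ Iic (0 : ℝ), |t₁ - t₂| ≤ τ → O ∈ 𝓝 (Γ q₀ t₁) →
      AntilipAt n (fun q => Γ q t₁) S q₀ (Γ q₀ t₁) →
      AntilipAt n (fun q => Γ q t₂) S q₀ (Γ q₀ t₂) := by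
    intro t₁ ht₁ t₂ ht₂ hle hOt hal
    have hlen : max t₁ t₂ - min t₁ t₂ ≤ τ := by rwa [max_sub_min_eq_abs']
    have hJ : Icc (min t₁ t₂) (max t₁ t₂) ⊆ Iic (0 : ℝ) := fun r hr => hr.2.trans (max_le ht₁ ht₂)
    have m1 : t₁ ∈ Icc (min t₁ t₂) (max t₁ t₂) := ⟨min_le_left _ _, le_max_left _ _⟩
    have m2 : t₂ ∈ Icc (min t₁ t₂) (max t₁ t₂) := ⟨min_le_right _ _, le_max_right _ _⟩
    have hin : ∀ᶠ q in 𝓝[S] q₀, q ∈ S ∧ Γ q t₁ ∈ O :=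
      eventually_mem_nhdsWithin.and (hal.2.1.eventually_mem hOt)
    have hctl : ∀ q ∈ S, Γ q t₁ ∈ O → ∀ q' ∈ S, Γ q' t₁ ∈ O → ∀ r ∈ Icc (min t₁ t₂) (max t₁ t₂),
        ∀ r' ∈ Icc (min t₁ t₂) (max t₁ t₂), _ := fun q hq hqO q' hq' hqO' =>
      hC _ _ hlen (Γ q) (Γ q') ((hΓ q hq).mono hJ) ((hΓ q' hq').mono hJ) t₁ m1 hqO hqO'
    have hO₀ : Γ q₀ t₁ ∈ O := mem_of_mem_nhds hOt
    have hs1 := (hctl q₀ hq₀ hO₀ q₀ hq₀ hO₀ t₁ m1 t₁ m1).1.1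
    have hs2 := (hctl q₀ hq₀ hO₀ q₀ hq₀ hO₀ t₂ m2 t₂ m2).1.1
    obtain ⟨-, hc1, C', hC'0, hC'⟩ := hal.change hs1
    suffices hal2 : AntilipAt n (fun q => Γ q t₂) S q₀ (Γ q₀ t₀) from
      hal2.change (mem_extChartAt_source _)
    refine ⟨hs2, ?_, C' * C, by positivity, ?_⟩
    · -- continuity in the chart is inherited from the time `t₁`
      have h1 : Tendsto (fun q => extChartAt (𝓡 n) (Γ q₀ t₀) (Γ q t₁)) (𝓝[S] q₀)
          (𝓝 (extChartAt (𝓡 n) (Γ q₀ t₀) (Γ q₀ t₁))) :=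
        (continuousAt_extChartAt' hs1).tendsto.comp hc1
      have h2 : Tendsto (fun q => extChartAt (𝓡 n) (Γ q₀ t₀) (Γ q t₂)) (𝓝[S] q₀)
          (𝓝 (extChartAt (𝓡 n) (Γ q₀ t₀) (Γ q₀ t₂))) := by
        rw [tendsto_iff_dist_tendsto_zero] at h1 ⊢
        refine squeeze_zero' (Eventually.of_forall fun _ => dist_nonneg) ?_
          (by simpa using h1.const_mul C)
        filter_upwards [hin] with q hq
        exact (hctl q hq.1 hq.2 q₀ hq₀ hO₀ t₂ m2 t₁ m1).2
      have h3 := ((continuousOn_extChartAt_symm (I := 𝓡 n) (Γ q₀ t₀)).continuousAt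
        ((isOpen_extChartAt_target _).mem_nhds ((extChartAt (𝓡 n) _).map_source hs2))).tendsto.comp
          h2
      rw [(extChartAt (𝓡 n) _).left_inv hs2] at h3
      refine h3.congr' ?_
      filter_upwards [hin] with q hq
      exact (extChartAt (𝓡 n) _).left_inv (hctl q hq.1 hq.2 q₀ hq₀ hO₀ t₂ m2 t₁ m1).1.1
    · filter_upwards [hC', tendsto_fst.eventually hin, tendsto_snd.eventually hin] with p hp h1 h2
      rw [mul_assoc]
      exact hp.trans (mul_le_mul_of_nonneg_left
        (hctl p.1 h1.1 h1.2 p.2 h2.1 h2.2 t₁ m1 t₂ m2).2 hC'0)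
  filter_upwards [hnear, hcont.eventually (eventually_mem_nhds_iff.2 hO), self_mem_nhdsWithin]
    with t h1 h2 h3
  exact ⟨hmain t₀ ht₀ t h3 (by rwa [abs_sub_comm]) hO, hmain t h3 t₀ ht₀ h1 h2⟩

/-- A backward integral curve through a zero of the field is constant. -/
theorem integralCurve_eq_of_zero [T2Space M]
    (hX : ContMDiff (𝓡 n) (𝓡 n).tangent ∞ (fun x => (⟨x, X x⟩ : TangentBundle (𝓡 n) M)))
    {γ : ℝ → M} (hγ : IsMIntegralCurveOn γ X (Iic 0)) {q : M} (hq : X q = 0) (h0 : γ 0 = q) {t : ℝ}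
    (ht : t ≤ 0) : γ t = q := by
  have hconst : ∀ s, IsMIntegralCurveOn (fun _ => q) X s := fun s r _ => by
    have h := (hasMFDerivAt_const (I := 𝓘(ℝ, ℝ)) (I' := 𝓡 n) q r).hasMFDerivWithinAt (s := s)
    refine h.congr_mfderiv ?_
    rw [hq]
    exact (ContinuousLinearMap.ext fun a : ℝ =>
      smul_zero (A := EuclideanSpace ℝ (Fin n)) a).symm
  refine isPreconnected_Iic.induction₂' (s := Iic (0 : ℝ)) (fun t t' => γ t = q → γ t' = q) ?_
    (fun _ _ _ _ _ _ h1 h2 h => h2 (h1 h)) (mem_Iic.2 le_rfl) ht h0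
  intro t₀ ht₀
  obtain ⟨O, hO, τ, hτ, C, hC0, hC⟩ := exists_integralCurve_control hX (γ t₀) univ_mem
  have hcont : ContinuousWithinAt γ (Iic 0) t₀ := hγ.continuousWithinAt ht₀
  have hnear : ∀ᶠ t in 𝓝[Iic 0] t₀, |t - t₀| ≤ τ := by
    apply nhdsWithin_le_nhds
    filter_upwards [Metric.closedBall_mem_nhds t₀ hτ] with t ht
    rwa [Metric.mem_closedBall, Real.dist_eq] at ht
  have hmain : ∀ t₁ ∈ Iic (0 : ℝ), ∀ t₂ ∈ Iic (0 : ℝ), |t₁ - t₂| ≤ τ → γ t₁ ∈ O →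
      γ t₁ = q → γ t₂ = q := by
    intro t₁ ht₁ t₂ ht₂ hle hOt he
    have hlen : max t₁ t₂ - min t₁ t₂ ≤ τ := by rwa [max_sub_min_eq_abs']
    have hJ : Icc (min t₁ t₂) (max t₁ t₂) ⊆ Iic (0 : ℝ) := fun r hr => hr.2.trans (max_le ht₁ ht₂)
    have m1 : t₁ ∈ Icc (min t₁ t₂) (max t₁ t₂) := ⟨min_le_left _ _, le_max_left _ _⟩
    have m2 : t₂ ∈ Icc (min t₁ t₂) (max t₁ t₂) := ⟨min_le_right _ _, le_max_right _ _⟩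
    have hOq : q ∈ O := he ▸ hOt
    have h1 := hC _ _ hlen γ (fun _ => q) (hγ.mono hJ) (hconst _) t₁ m1 hOt hOq t₂ m2 t₁ m1
    have h2 := hC _ _ hlen (fun _ => q) (fun _ => q) (hconst _) (hconst _) t₁ m1 hOq hOq t₂ m2 t₁ m1
    rw [he, dist_self, mul_zero] at h1
    exact (extChartAt (𝓡 n) _).injOn h1.1.1 h2.1.1 (dist_le_zero.1 h1.2)
  filter_upwards [hnear, hcont.eventually_mem hO, self_mem_nhdsWithin] with t h1 h2 h3
  exact ⟨hmain t₀ ht₀ t h3 (by rwa [abs_sub_comm]) (mem_of_mem_nhds hO), hmain t h3 t₀ ht₀ h1 h2⟩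

end Flow

/-! ### The cone estimate near a zero of the field -/

section Cone

theorem exists_coercive_of_neg {E : Type*} [NormedAddCommGroup E] [NormedSpace ℝ E]
    [FiniteDimensional ℝ E] (B : E →L[ℝ] E →L[ℝ] ℝ) (hB : ∀ v, v ≠ 0 → B v v < 0) :
    ∃ c > 0, ∀ v, B v v ≤ -(c * ‖v‖ ^ 2) := by
  have hcont : Continuous fun v => B v v := by fun_prop
  rcases (Metric.sphere (0 : E) 1).eq_empty_or_nonempty with he | hne
  · refine ⟨1, one_pos, fun v => ?_⟩
    by_cases hv : v = 0
    · simp [hv]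
    · exfalso
      have : (‖v‖⁻¹ • v) ∈ Metric.sphere (0 : E) 1 := by
        simp [norm_smul, norm_ne_zero_iff.2 hv]
      rw [he] at this
      exact this
  · obtain ⟨v₀, hv₀, hmax⟩ := (isCompact_sphere (0 : E) 1).exists_isMaxOn hne hcont.continuousOn
    have h0 : v₀ ≠ 0 := by
      rintro rfl
      simp at hv₀
    refine ⟨-(B v₀ v₀), by linarith [hB v₀ h0], fun v => ?_⟩
    by_cases hv : v = 0
    · simp [hv]
    · have hv' : 0 < ‖v‖ := norm_pos_iff.2 hv
      have hmem : (‖v‖⁻¹ • v) ∈ Metric.sphere (0 : E) 1 := by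
        simp [norm_smul, norm_ne_zero_iff.2 hv]
      have h1 : B (‖v‖⁻¹ • v) (‖v‖⁻¹ • v) ≤ B v₀ v₀ := hmax hmem
      simp only [map_smul, smul_apply, smul_eq_mul] at h1
      have h2 : B v v = ‖v‖ ^ 2 * (‖v‖⁻¹ * (‖v‖⁻¹ * B v v)) := by field_simp
      rw [h2]
      nlinarith [mul_le_mul_of_nonneg_left h1 (sq_nonneg ‖v‖)]

/-- Two backward trajectories emanating from a zero of the field `Y`, and staying close to it,
differ by a vector on which `H` is quantitatively negative, if `H` decreases along the linearized
field: indeed a small perturbation of `H` decreases along their difference, which tends to `0` in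
negative time. -/
theorem exists_cone_estimate {E : Type*} [NormedAddCommGroup E] [InnerProductSpace ℝ E]
    [FiniteDimensional ℝ E] {H : E →L[ℝ] E →L[ℝ] ℝ} (hsymm : ∀ v w, H v w = H w v) {Y : E → E}
    {A : E →L[ℝ] E} {z₀ : E} (hY : HasStrictFDerivAt Y A z₀)
    (hneg : ∀ v, v ≠ 0 → H (A v) v < 0) :
    ∃ S ∈ 𝓝 z₀, ∃ κ > 0, ∀ (α β : ℝ → E) (T : ℝ),
      (∀ t ≤ T, α t ∈ S ∧ HasDerivWithinAt α (Y (α t)) (Iic T) t) →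
      (∀ t ≤ T, β t ∈ S ∧ HasDerivWithinAt β (Y (β t)) (Iic T) t) →
      Tendsto α atBot (𝓝 z₀) → Tendsto β atBot (𝓝 z₀) →
      H (α T - β T) (α T - β T) + κ * ‖α T - β T‖ ^ 2 ≤ 0 := by
  obtain ⟨c, hc, hcoer⟩ := exists_coercive_of_neg (H.comp A) hneg
  -- `θ` bounds the nonlinearity of `Y`, and `κ` the perturbation of `H`; each of them spoils at
  -- most half of the coercivity constant `c`
  set θ : ℝ := c / (2 * (‖H‖ + 1)) with hθ
  have hθ0 : 0 < θ := by positivity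
  have hHθ : ‖H‖ * θ ≤ c / 2 := by
    rw [hθ, mul_div_assoc', div_le_div_iff₀ (by positivity) (by norm_num)]
    nlinarith [norm_nonneg H]
  set κ : ℝ := c / (2 * (‖A‖ + θ + 1)) with hκ
  have hκ0 : 0 < κ := by positivity
  have hκA : κ * (‖A‖ + θ) ≤ c / 2 := by
    rw [hκ, div_mul_eq_mul_div, div_le_div_iff₀ (by positivity) (by norm_num)]
    nlinarith [norm_nonneg A]
  have hev := hY.isLittleO.def hθ0
  rw [nhds_prod_eq, eventually_prod_self_iff'] at hev
  obtain ⟨S, hS, hSY⟩ := hev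
  refine ⟨S, hS, κ, hκ0, fun α β T hα hβ hαlim hβlim => ?_⟩
  let N : ℝ → ℝ := fun t => H (α t - β t) (α t - β t) + κ * ‖α t - β t‖ ^ 2
  have hderiv : ∀ t ≤ T, HasDerivWithinAt N
      (H (Y (α t) - Y (β t)) (α t - β t) + H (α t - β t) (Y (α t) - Y (β t)) +
        κ * (2 * inner ℝ (α t - β t) (Y (α t) - Y (β t)))) (Iic T) t := by
    intro t ht
    have h1 := (hα t ht).2.sub (hβ t ht).2
    have h2 := ((H.hasFDerivAt.comp_hasDerivWithinAt t h1).clm_apply h1)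
    have h3 := h1.norm_sq
    exact h2.add (h3.const_mul κ)
  have hnonpos : ∀ t ≤ T, (H (Y (α t) - Y (β t)) (α t - β t) + H (α t - β t) (Y (α t) - Y (β t)) +
        κ * (2 * inner ℝ (α t - β t) (Y (α t) - Y (β t)))) ≤ 0 := by
    intro t ht
    set δ := α t - β t with hδ
    set e := Y (α t) - Y (β t) - A δ with he
    have he' : ‖e‖ ≤ θ * ‖δ‖ := hSY _ (hα t ht).1 _ (hβ t ht).1
    have hYe : Y (α t) - Y (β t) = A δ + e := by rw [he]; abel
    rw [hYe, hsymm δ, map_add, add_apply]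
    have h1 : H (A δ) δ ≤ -(c * ‖δ‖ ^ 2) := hcoer δ
    have h2 : H e δ ≤ c / 2 * ‖δ‖ ^ 2 := by
      calc H e δ ≤ ‖H‖ * ‖e‖ * ‖δ‖ := (le_abs_self _).trans (H.le_opNorm₂ e δ)
        _ ≤ ‖H‖ * (θ * ‖δ‖) * ‖δ‖ := by gcongr
        _ = ‖H‖ * θ * ‖δ‖ ^ 2 := by ring
        _ ≤ _ := by gcongr
    have h3 : κ * inner ℝ δ (A δ + e) ≤ c / 2 * ‖δ‖ ^ 2 := by
      calc κ * inner ℝ δ (A δ + e) ≤ κ * (‖δ‖ * ‖A δ + e‖) := by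
            gcongr; exact real_inner_le_norm _ _
        _ ≤ κ * (‖δ‖ * (‖A‖ * ‖δ‖ + θ * ‖δ‖)) := by
            gcongr
            exact (norm_add_le _ _).trans (add_le_add (A.le_opNorm δ) he')
        _ = κ * (‖A‖ + θ) * ‖δ‖ ^ 2 := by ring
        _ ≤ _ := by gcongr
    nlinarith
  have hanti : AntitoneOn N (Iic T) := by
    apply antitoneOn_of_hasDerivWithinAt_nonpos (convex_Iic T)
      (fun t ht => (hderiv t ht).continuousWithinAt)
      (fun t ht => (hderiv t (mem_Iic.1 (interior_subset ht))).mono interior_subset)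
    exact fun t ht => hnonpos t (mem_Iic.1 (interior_subset ht))
  have hlim : Tendsto N atBot (𝓝 0) := by
    have h1 := hαlim.sub hβlim
    rw [sub_self] at h1
    have h2 : Continuous fun v : E => H v v + κ * ‖v‖ ^ 2 := by fun_prop
    have h3 := (h2.tendsto 0).comp h1
    simpa [Function.comp_def, N] using h3
  refine ge_of_tendsto hlim ?_
  filter_upwards [eventually_le_atBot T] with t ht
  exact hanti ht (mem_Iic.2 le_rfl) ht

end Cone

/-! ### Hausdorff dimension -/

section Dimension

theorem dimH_le_of_dist_le {A B : Type*} [MetricSpace A] [MetricSpace B]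
    {T : Set A} {g : A → B} {C : ℝ}
    (h : ∀ q ∈ T, ∀ q' ∈ T, dist q q' ≤ C * dist (g q) (g q')) : dimH T ≤ dimH (g '' T) := by
  have h1 : AntilipschitzWith C.toNNReal (T.domRestrict g) := by
    refine AntilipschitzWith.of_le_mul_dist fun q q' => ?_
    refine (h q q.2 q' q'.2).trans ?_
    exact mul_le_mul_of_nonneg_right (Real.le_coe_toNNReal C) dist_nonneg
  have h2 := h1.le_dimH_image univ
  rw [image_univ, Set.range_domRestrict] at h2
  have h3 := (isometry_subtype_coe (s := T)).dimH_image univ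
  rw [image_univ, Subtype.range_coe] at h3
  rwa [h3]

end Dimension

/-! ### The pseudo-gradient at a critical point -/

section Linearization

variable {n : ℕ} {M : Type*} [TopologicalSpace M] [ChartedSpace (EuclideanSpace ℝ (Fin n)) M]
  [IsManifold (𝓡 n) ∞ M] {X : (x : M) → TangentSpace (𝓡 n) x}

theorem IsPseudoGradient.lieDeriv_nonpos {f : M → ℝ} (hX : IsPseudoGradient X f) (x : M) :
    lieDeriv X f x ≤ 0 := by
  by_cases h : IsCritical (n := n) f x
  · rw [lieDeriv, show mfderiv (𝓡 n) 𝓘(ℝ, ℝ) f x = 0 from h]; exact le_rfl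
  · exact (hX.lyapunov x h).le

theorem chartField_self (x : M) : chartField X x (extChartAt (𝓡 n) x x) = X x := by
  rw [chartField, extChartAt_to_inv, mfderiv_extChartAt_self]
  rfl

/-- The pseudo-gradient vanishes at a critical point, and the Hessian of `f` decreases along its
linear part. -/
theorem IsPseudoGradient.linearization {f : M → ℝ} (hf : IsMorse n f) (hX : IsPseudoGradient X f)
    {p : M} (hp : IsCritical (n := n) f p) :
    X p = 0 ∧ (∀ v w, hessian (n := n) f p v w = hessian (n := n) f p w v) ∧
      ∀ v, v ≠ 0 →
        hessian (n := n) f p (fderiv ℝ (chartField X p) (extChartAt (𝓡 n) p p) v) v < 0 := by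
  have hs := mem_extChartAt_source (I := 𝓡 n) p
  have hz := mem_extChartAt_target (I := 𝓡 n) p
  have hu : ContDiffAt ℝ ∞ (chartFun n f p) (extChartAt (𝓡 n) p p) :=
    contDiffAt_chartFun hz (hf.1 _)
  have hev := eventually_chartFun_lieDeriv (X := X) hs (hf.1 p)
  obtain ⟨h0, h2⟩ := field_eq_zero_and_hessian (Y := chartField X p) hu
    (contDiffAt_chartField hX.smooth hz)
    ((isCritical_iff_fderiv_chartFun hs ((hf.1 p).mdifferentiableAt (by simp))).1 hp)
    (hf.2 p hp) (by
      filter_upwards [hev] with z hz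
      rw [← hz]
      exact hX.lieDeriv_nonpos _)
  refine ⟨by rwa [chartField_self] at h0,
    symm_fderiv_fderiv (hu.of_le ENat.LEInfty.out), fun v hv => ?_⟩
  have h3 := hX.nondegenerate p hp v hv
  have h4 : hessian (n := n) (lieDeriv X f) p = fderiv ℝ (fderiv ℝ fun z =>
      fderiv ℝ (chartFun n f p) z (chartField X p z)) (extChartAt (𝓡 n) p p) :=
    hev.fderiv.fderiv_eq
  rw [h4, h2 v] at h3
  have h5 : fderiv ℝ (fderiv ℝ (chartFun n f p)) (extChartAt (𝓡 n) p p)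
    (fderiv ℝ (chartField X p) (extChartAt (𝓡 n) p p) v) v < 0 := by linarith
  exact h5

end Linearization

/-! ### Tangency of the pseudo-gradient to the disc -/

section Tangency

variable {n : ℕ} {M : Type*} [TopologicalSpace M] [ChartedSpace (EuclideanSpace ℝ (Fin n)) M]
  [IsManifold (𝓡 n) ∞ M] {X : (x : M) → TangentSpace (𝓡 n) x} {k : ℕ}
  {φ : EuclideanSpace ℝ (Fin k) → M} {y₁ : EuclideanSpace ℝ (Fin k)}

theorem contDiffAt_extChartAt_comp {x : M} (hφ : ContMDiffAt (𝓡 k) (𝓡 n) ∞ φ y₁)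
    (hx : φ y₁ ∈ (extChartAt (𝓡 n) x).source) :
    ContDiffAt ℝ ∞ (fun y => extChartAt (𝓡 n) x (φ y)) y₁ :=
  contMDiffAt_iff_contDiffAt.1 (((contMDiffAt_extChartAt' (by simpa using hx)).comp y₁ hφ))

theorem fderiv_extChartAt_comp {x : M} (hφ : ContMDiffAt (𝓡 k) (𝓡 n) ∞ φ y₁)
    (hx : φ y₁ ∈ (extChartAt (𝓡 n) x).source) (ξ : EuclideanSpace ℝ (Fin k)) :
    fderiv ℝ (fun y => extChartAt (𝓡 n) x (φ y)) y₁ ξ =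
      mfderiv (𝓡 n) 𝓘(ℝ, EuclideanSpace ℝ (Fin n)) (extChartAt (𝓡 n) x) (φ y₁)
        (mfderiv (𝓡 k) (𝓡 n) φ y₁ ξ) := by
  have h := mfderiv_comp y₁ (mdifferentiableAt_extChartAt_of_mem hx)
    (hφ.mdifferentiableAt (by simp))
  rw [mfderiv_eq_fderiv] at h
  exact DFunLike.congr_fun h ξ

theorem fderiv_extChartAt_comp_self (hφ : ContMDiffAt (𝓡 k) (𝓡 n) ∞ φ y₁)
    (ξ : EuclideanSpace ℝ (Fin k)) :
    fderiv ℝ (fun y => extChartAt (𝓡 n) (φ y₁) (φ y)) y₁ ξ = mfderiv (𝓡 k) (𝓡 n) φ y₁ ξ := by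
  rw [fderiv_extChartAt_comp hφ (mem_extChartAt_source _), mfderiv_extChartAt_self]
  rfl

/-- If the field is transverse to an immersed disc, then sliding the disc along the integral
curves during a short time expands distances: one more dimension is swept out. -/
theorem exists_antilipAt_of_transverse [T2Space M]
    (hX : ContMDiff (𝓡 n) (𝓡 n).tangent ∞ (fun x => (⟨x, X x⟩ : TangentBundle (𝓡 n) M)))
    (hφ : ContMDiffAt (𝓡 k) (𝓡 n) ∞ φ y₁)
    (hinj : Function.Injective (mfderiv (𝓡 k) (𝓡 n) φ y₁))
    (htr : ∀ ξ, X (φ y₁) ≠ mfderiv (𝓡 k) (𝓡 n) φ y₁ ξ)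
    {γ : EuclideanSpace ℝ (Fin k) → ℝ → M}
    (hγ : ∀ᶠ y in 𝓝 y₁, γ y 0 = φ y ∧ IsMIntegralCurveOn (γ y) X (Iic 0)) :
    ∃ τ > 0, ∃ r > 0, (∀ y ∈ Metric.ball y₁ r, IsMIntegralCurveOn (γ y) X (Iic 0)) ∧
      ∀ q₀ ∈ Icc (-τ) 0 ×ˢ Metric.ball y₁ r, AntilipAt n
        (fun q : ℝ × EuclideanSpace ℝ (Fin k) => γ q.2 q.1) (Icc (-τ) 0 ×ˢ Metric.ball y₁ r) q₀
        (φ y₁) := by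
  set ψ := extChartAt (𝓡 n) (φ y₁) with hψ
  have hx := mem_extChartAt_source (I := 𝓡 n) (φ y₁)
  have hz := mem_extChartAt_target (I := 𝓡 n) (φ y₁)
  set D := fderiv ℝ (fun y => ψ (φ y)) y₁ with hD
  have hDeq : ∀ ξ, D ξ = mfderiv (𝓡 k) (𝓡 n) φ y₁ ξ := fderiv_extChartAt_comp_self hφ
  set v : EuclideanSpace ℝ (Fin n) := X (φ y₁) with hv
  -- the linear model of the sweeping map
  let Λ : (ℝ × EuclideanSpace ℝ (Fin k)) →ₗ[ℝ] EuclideanSpace ℝ (Fin n) :=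
    (LinearMap.toSpanSingleton ℝ _ v).coprod D.toLinearMap
  have hΛ : ∀ q, Λ q = q.1 • v + D q.2 := fun q => by simp [Λ]
  have hker : LinearMap.ker Λ = ⊥ := by
    rw [LinearMap.ker_eq_bot']
    rintro ⟨σ, w⟩ h0
    rw [hΛ] at h0
    simp only at h0
    have hσ : σ = 0 := by
      by_contra hσ
      apply htr (-(σ⁻¹ • w))
      have h1 : v = D (-(σ⁻¹ • w)) := by
        rw [map_neg, map_smul, eq_neg_iff_add_eq_zero]
        have := congrArg (fun e => σ⁻¹ • e) h0
        simpa [smul_smul, inv_mul_cancel₀ hσ] using this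
      rw [hDeq] at h1
      exact h1
    subst hσ
    rw [zero_smul, zero_add] at h0
    have : w = 0 := by
      apply hinj
      have h1 := hDeq w
      rw [h0] at h1
      have h2 := hDeq 0
      rw [map_zero] at h2
      exact h1.symm.trans h2
    rw [this]; rfl
  obtain ⟨K, hK0, hK⟩ := Λ.exists_antilipschitzWith hker
  have hK0' : (0 : ℝ) < K := hK0
  have hKΛ : ∀ q, ‖q‖ ≤ K * ‖Λ q‖ := by
    intro q
    have := hK.le_mul_dist q 0
    simpa using this
  set θ : ℝ := 1 / (4 * K) with hθ
  have hθ0 : 0 < θ := by positivity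
  have hKθ : K * θ = 1 / 4 := by rw [hθ]; field_simp
  -- neighborhoods controlling the speed and the length of the curves
  have hWn : {x | x ∈ ψ.source ∧ ‖chartField X (φ y₁) (ψ x) - v‖ < θ} ∈ 𝓝 (φ y₁) := by
    refine Filter.inter_mem (extChartAt_source_mem_nhds (φ y₁)) ?_
    have h1 : ContinuousAt (fun x => ‖chartField X (φ y₁) (ψ x) - v‖) (φ y₁) := by
      have h2 : ContinuousAt (fun x => chartField X (φ y₁) (ψ x)) (φ y₁) :=
        ContinuousAt.comp (g := chartField X (φ y₁)) (contDiffAt_chartField hX hz).continuousAt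
          (continuousAt_extChartAt (φ y₁))
      exact (h2.sub continuousAt_const).norm
    apply h1.eventually_lt continuousAt_const
    have h3 : chartField X (φ y₁) (ψ (φ y₁)) = v := chartField_self _
    rw [h3, sub_self, norm_zero]
    exact hθ0
  obtain ⟨O₁, hO₁, τ₁, hτ₁, C₁, hC₁0, hC₁⟩ :=
    exists_integralCurve_control hX (φ y₁) (Filter.univ_mem)
  obtain ⟨O₂, hO₂, τ₂, hτ₂, C₂, -, hC₂⟩ :=
    exists_integralCurve_control hX (φ y₁) (Filter.inter_mem hWn hO₁)
  have hcd := contDiffAt_extChartAt_comp hφ hx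
  have hstrict : HasStrictFDerivAt (fun y => ψ (φ y)) D y₁ := hcd.hasStrictFDerivAt (by simp)
  have hev := hstrict.isLittleO.def hθ0
  rw [nhds_prod_eq, eventually_prod_self_iff'] at hev
  obtain ⟨S, hS, hSφ⟩ := hev
  obtain ⟨r, hr, hball⟩ := Metric.eventually_nhds_iff_ball.1
    ((eventually_mem_set.2 hS).and (hγ.and (hφ.continuousAt.eventually_mem hO₂)))
  set τ := min τ₁ τ₂ with hτ
  have hτ0 : 0 < τ := lt_min hτ₁ hτ₂
  refine ⟨τ, hτ0, r, hr, fun y hy => (hball y hy).2.1.2, ?_⟩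
  have hstay : ∀ y ∈ Metric.ball y₁ r, ∀ s ∈ Icc (-τ) 0, γ y s ∈ ψ.source ∧
      ‖chartField X (φ y₁) (ψ (γ y s)) - v‖ < θ ∧ γ y s ∈ O₁ := by
    intro y hy s hs
    obtain ⟨-, ⟨h0, hint⟩, hO⟩ := hball y hy
    have hm : (0 : ℝ) ∈ Icc (-τ) 0 := ⟨by linarith, le_rfl⟩
    have hi : IsMIntegralCurveOn (γ y) X (Icc (-τ) 0) := hint.mono Icc_subset_Iic_self
    have hO' : γ y 0 ∈ O₂ := by rw [h0]; exact hO
    have h := (hC₂ (-τ) 0 (by simp [hτ]) (γ y) (γ y) hi hi 0 hm hO' hO' s hs s hs).1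
    exact ⟨h.1, h.2.1.2, h.2.2⟩
  have hspeed : ∀ y ∈ Metric.ball y₁ r, ∀ s ∈ Icc (-τ) 0, ∀ s' ∈ Icc (-τ) 0,
      ‖ψ (γ y s) - ψ (γ y s') - (s - s') • v‖ ≤ θ * ‖s - s'‖ := by
    intro y hy s hs s' hs'
    have hi : IsMIntegralCurveOn (γ y) X (Icc (-τ) 0) :=
      (hball y hy).2.1.2.mono Icc_subset_Iic_self
    have h := (convex_Icc (-τ) 0).norm_image_sub_le_of_norm_hasDerivWithin_le
      (f := fun t => ψ (γ y t) - t • v) (f' := fun t => chartField X (φ y₁) (ψ (γ y t)) - v)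
      (fun t ht => (hasDerivWithinAt_extChartAt_comp hi ht (hstay y hy t ht).1).sub
        (by simpa using (hasDerivWithinAt_id t _).smul_const v))
      (fun t ht => (hstay y hy t ht).2.1.le) hs' hs
    have e : ψ (γ y s) - ψ (γ y s') - (s - s') • v =
        (ψ (γ y s) - s • v) - (ψ (γ y s') - s' • v) := by rw [sub_smul]; abel
    rw [e]
    exact h
  -- following both curves for the time `-s'` reduces to the case where the second time is `0`
  have hmain' : ∀ y ∈ Metric.ball y₁ r, ∀ y' ∈ Metric.ball y₁ r, ∀ s ∈ Icc (-τ) 0,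
      ∀ s' ∈ Icc (-τ) 0, s ≤ s' → ‖((s - s', y - y') : ℝ × EuclideanSpace ℝ (Fin k))‖ ≤
        2 * K * C₁ * dist (ψ (γ y s)) (ψ (γ y' s')) := by
    intro y hy y' hy' s hs s' hs' hle
    have hσ : s - s' ∈ Icc (-τ) 0 := ⟨by linarith [hs.1, hs'.2], by linarith⟩
    have hα : IsMIntegralCurveOn (γ y ∘ (· + (s - s'))) X (Icc s' 0) :=
      ((hball y hy).2.1.2.comp_add (s - s')).mono fun t ht => by
        simp only [mem_ofPred_eq, mem_Iic]; linarith [ht.2]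
    have hβ : IsMIntegralCurveOn (γ y') X (Icc s' 0) :=
      (hball y' hy').2.1.2.mono Icc_subset_Iic_self
    have hlen : 0 - s' ≤ τ₁ := by
      have := min_le_left τ₁ τ₂
      linarith [hs'.1]
    have m0 : (0 : ℝ) ∈ Icc s' 0 := ⟨hs'.2, le_rfl⟩
    have m1 : s' ∈ Icc s' (0 : ℝ) := ⟨le_rfl, hs'.2⟩
    have hαO : (γ y ∘ (· + (s - s'))) 0 ∈ O₁ := by
      simp only [Function.comp_apply, zero_add]
      exact (hstay y hy _ hσ).2.2
    have hβO : γ y' 0 ∈ O₁ := (hstay y' hy' 0 ⟨by linarith, le_rfl⟩).2.2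
    have h1 := (hC₁ s' 0 hlen _ _ hα hβ 0 m0 hαO hβO 0 m0 s' m1).2
    simp only [Function.comp_apply, zero_add, add_sub_cancel] at h1
    rw [(hball y' hy').2.1.1, dist_eq_norm] at h1
    have h2 := hspeed y hy (s - s') hσ 0 ⟨by linarith, le_rfl⟩
    rw [(hball y hy).2.1.1, sub_zero] at h2
    have h3 : ‖ψ (φ y) - ψ (φ y') - D (y - y')‖ ≤ θ * ‖y - y'‖ :=
      hSφ y (hball y hy).1 y' (hball y' hy').1
    set q : ℝ × EuclideanSpace ℝ (Fin k) := (s - s', y - y') with hq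
    have hq1 : ‖s - s'‖ ≤ ‖q‖ := norm_fst_le q
    have hq2 : ‖y - y'‖ ≤ ‖q‖ := norm_snd_le q
    have h4 : ‖Λ q‖ ≤ ‖ψ (γ y (s - s')) - ψ (φ y')‖ + 2 * θ * ‖q‖ := by
      have e : Λ q = (ψ (γ y (s - s')) - ψ (φ y')) - (ψ (γ y (s - s')) - ψ (φ y) - (s - s') • v)
          - (ψ (φ y) - ψ (φ y') - D (y - y')) := by
        rw [hΛ]; simp only [hq]; abel
      rw [e]
      refine (norm_sub_le _ _).trans ?_
      have := norm_sub_le (ψ (γ y (s - s')) - ψ (φ y')) (ψ (γ y (s - s')) - ψ (φ y) - (s - s') • v)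
      nlinarith
    have h5 := hKΛ q
    have h6 := mul_le_mul_of_nonneg_left (h4.trans (add_le_add_left h1 _)) hK0'.le
    have h7 : K * (2 * θ * ‖q‖) = 1 / 2 * ‖q‖ := by
      calc K * (2 * θ * ‖q‖) = 2 * (K * θ) * ‖q‖ := by ring
        _ = _ := by rw [hKθ]; ring
    rw [mul_add, h7] at h6
    nlinarith
  have hmain : ∀ q ∈ Icc (-τ) 0 ×ˢ Metric.ball y₁ r, ∀ q' ∈ Icc (-τ) 0 ×ˢ Metric.ball y₁ r,
      dist q q' ≤ 2 * K * C₁ * dist (ψ (γ q.2 q.1)) (ψ (γ q'.2 q'.1)) := by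
    intro q hq q' hq'
    rcases le_total q.1 q'.1 with h | h
    · rw [dist_eq_norm]
      exact hmain' q.2 hq.2 q'.2 hq'.2 q.1 hq.1 q'.1 hq'.1 h
    · rw [dist_comm, dist_eq_norm, dist_comm (ψ _)]
      exact hmain' q'.2 hq'.2 q.2 hq.2 q'.1 hq'.1 q.1 hq.1 h
  intro q₀ hq₀
  refine ⟨(hstay _ hq₀.2 _ hq₀.1).1, ?_, 2 * K * C₁, by positivity, ?_⟩
  · have hself : ∀ᶠ q in 𝓝[Icc (-τ) 0 ×ˢ Metric.ball y₁ r] q₀,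
        q ∈ Icc (-τ) 0 ×ˢ Metric.ball y₁ r := self_mem_nhdsWithin
    have h1 : Tendsto (fun q : ℝ × EuclideanSpace ℝ (Fin k) => ψ (γ q.2 q.1))
        (𝓝[Icc (-τ) 0 ×ˢ Metric.ball y₁ r] q₀) (𝓝 (ψ (γ q₀.2 q₀.1))) := by
      rw [tendsto_iff_dist_tendsto_zero]
      have hlim : Tendsto (fun q : ℝ × EuclideanSpace ℝ (Fin k) =>
          (θ * ‖q.1 - q₀.1‖ + ‖q.1 - q₀.1‖ * ‖v‖) + C₁ * dist (ψ (φ q.2)) (ψ (φ q₀.2)))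
          (𝓝[Icc (-τ) 0 ×ˢ Metric.ball y₁ r] q₀) (𝓝 0) := by
        have hSc : ContinuousAt (fun y => ψ (φ y)) q₀.2 := by
          have hlip : ∀ y ∈ Metric.ball y₁ r, ∀ y' ∈ Metric.ball y₁ r,
              dist (ψ (φ y)) (ψ (φ y')) ≤ (‖D‖ + θ).toNNReal * dist y y' := by
            intro y hy y' hy'
            have h3 : ‖ψ (φ y) - ψ (φ y') - D (y - y')‖ ≤ θ * ‖y - y'‖ :=
              hSφ y (hball y hy).1 y' (hball y' hy').1
            rw [dist_eq_norm, dist_eq_norm, Real.coe_toNNReal _ (by positivity)]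
            have h4 := norm_le_norm_add_norm_sub' (ψ (φ y) - ψ (φ y')) (D (y - y'))
            have h5 := D.le_opNorm (y - y')
            nlinarith
          exact ((LipschitzOnWith.of_dist_le_mul hlip).continuousOn).continuousAt
            (Metric.isOpen_ball.mem_nhds hq₀.2)
        have hc : ContinuousAt (fun q : ℝ × EuclideanSpace ℝ (Fin k) =>
            (θ * ‖q.1 - q₀.1‖ + ‖q.1 - q₀.1‖ * ‖v‖) + C₁ * dist (ψ (φ q.2)) (ψ (φ q₀.2))) q₀ := by
          have h2 : ContinuousAt (fun q : ℝ × EuclideanSpace ℝ (Fin k) => ψ (φ q.2)) q₀ :=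
            ContinuousAt.comp (g := fun y => ψ (φ y)) hSc continuousAt_snd
          have h3 : ContinuousAt (fun q : ℝ × EuclideanSpace ℝ (Fin k) => ‖q.1 - q₀.1‖) q₀ := by
            fun_prop
          exact ((continuousAt_const.mul h3).add (h3.mul continuousAt_const)).add
            (continuousAt_const.mul (h2.dist continuousAt_const))
        have := hc.tendsto.mono_left (nhdsWithin_le_nhds (s := Icc (-τ) 0 ×ˢ Metric.ball y₁ r))
        simpa using this
      refine squeeze_zero' (Eventually.of_forall fun _ => dist_nonneg) ?_ hlim
      filter_upwards [hself] with q hq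
      refine (dist_triangle _ (ψ (γ q.2 q₀.1)) _).trans (add_le_add ?_ ?_)
      · have h2 := hspeed q.2 hq.2 q.1 hq.1 q₀.1 hq₀.1
        have h3 := norm_le_norm_add_norm_sub' (ψ (γ q.2 q.1) - ψ (γ q.2 q₀.1))
          ((q.1 - q₀.1) • v)
        rw [norm_smul] at h3
        rw [dist_eq_norm]
        linarith
      · have m0 : (0 : ℝ) ∈ Icc (-τ) 0 := ⟨by linarith, le_rfl⟩
        have h2 := (hC₁ (-τ) 0 (by simp [hτ]) (γ q.2) (γ q₀.2)
          ((hball q.2 hq.2).2.1.2.mono Icc_subset_Iic_self)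
          ((hball q₀.2 hq₀.2).2.1.2.mono Icc_subset_Iic_self) 0 m0
          (hstay q.2 hq.2 0 m0).2.2 (hstay q₀.2 hq₀.2 0 m0).2.2 q₀.1 hq₀.1 0 m0).2
        rwa [(hball q.2 hq.2).2.1.1, (hball q₀.2 hq₀.2).2.1.1] at h2
    have hs₀ := (hstay _ hq₀.2 _ hq₀.1).1
    have h3 := ((continuousOn_extChartAt_symm (I := 𝓡 n) (φ y₁)).continuousAt
      ((isOpen_extChartAt_target _).mem_nhds (ψ.map_source hs₀))).tendsto.comp h1
    rw [← hψ, ψ.left_inv hs₀] at h3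
    refine h3.congr' ?_
    filter_upwards [hself] with q hq
    exact ψ.left_inv (hstay _ hq.2 _ hq.1).1
  · have hself : ∀ᶠ q in 𝓝[Icc (-τ) 0 ×ˢ Metric.ball y₁ r] q₀,
        q ∈ Icc (-τ) 0 ×ˢ Metric.ball y₁ r := self_mem_nhdsWithin
    filter_upwards [tendsto_fst.eventually hself, tendsto_snd.eventually hself] with p h1 h2
    exact hmain p.1 h1 p.2 h2

/-- A pseudo-gradient is tangent to any disc contained in the unstable manifold of `p` whose
dimension is the index of `p`. Otherwise, sliding the disc along the integral curves would sweep
out a set of larger dimension, still contained in the unstable manifold; carried near `p` by the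
backward flow, it would lie on a Lipschitz graph over a space of dimension the index. -/
theorem exists_tangent_of_subset_unstableManifold [T2Space M] {f : M → ℝ} (hf : IsMorse n f)
    (hX : IsPseudoGradient X f) {p : M} (hp : IsCritical (n := n) f p)
    (hk : k = morseIndex n f p) (hφ : ContMDiffAt (𝓡 k) (𝓡 n) ∞ φ y₁)
    (hinj : Function.Injective (mfderiv (𝓡 k) (𝓡 n) φ y₁))
    (hW : ∀ᶠ y in 𝓝 y₁, φ y ∈ unstableManifold X p) :
    ∃ ξ, X (φ y₁) = mfderiv (𝓡 k) (𝓡 n) φ y₁ ξ := by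
  by_contra! htr
  have hch : ∀ y, ∃ γ : ℝ → M, φ y ∈ unstableManifold X p → γ 0 = φ y ∧
      IsMIntegralCurveOn γ X (Iic 0) ∧ Tendsto γ atBot (𝓝 p) := by
    intro y
    by_cases hy : φ y ∈ unstableManifold X p
    · obtain ⟨γ, h⟩ := hy
      exact ⟨γ, fun _ => h⟩
    · exact ⟨fun _ => p, fun h => absurd h hy⟩
  choose γ hγ using hch
  obtain ⟨r₀, hr₀, hball₀⟩ := Metric.eventually_nhds_iff_ball.1 hW
  obtain ⟨τ, hτ, r₁, hr₁, hint, hal⟩ := exists_antilipAt_of_transverse hX.smooth hφ hinj htr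
    (γ := γ) (hW.mono fun y hy => ⟨(hγ y hy).1, (hγ y hy).2.1⟩)
  set r := min r₀ r₁ with hr
  have hr0 : 0 < r := lt_min hr₀ hr₁
  set Q : Set (ℝ × EuclideanSpace ℝ (Fin k)) := Icc (-τ) 0 ×ˢ Metric.ball y₁ r with hQ
  have hQsub : Q ⊆ Icc (-τ) 0 ×ˢ Metric.ball y₁ r₁ :=
    prod_mono le_rfl (Metric.ball_subset_ball (min_le_right _ _))
  have hQW : ∀ q ∈ Q, Tendsto (γ q.2) atBot (𝓝 p) := fun q hq =>
    (hγ q.2 (hball₀ q.2 (Metric.ball_subset_ball (min_le_left _ _) hq.2))).2.2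
  -- the swept set, followed backward in time
  let Γ : ℝ × EuclideanSpace ℝ (Fin k) → ℝ → M := fun q t => γ q.2 (t + q.1)
  have hΓint : ∀ q ∈ Q, IsMIntegralCurveOn (Γ q) X (Iic 0) := fun q hq =>
    ((hint q.2 (hQsub hq).2).comp_add q.1).mono fun t ht => by
      simp only [mem_ofPred_eq, mem_Iic] at ht ⊢; linarith [hq.1.2]
  have hΓlim : ∀ q ∈ Q, Tendsto (Γ q) atBot (𝓝 p) := fun q hq =>
    (hQW q hq).comp (tendsto_atBot_add_const_right _ _ tendsto_id)
  -- the cone estimate near `p`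
  have hps := mem_extChartAt_source (I := 𝓡 n) p
  have hpz := mem_extChartAt_target (I := 𝓡 n) p
  obtain ⟨hXp, hsymm, hneg⟩ := hX.linearization hf hp
  obtain ⟨S, hS, κ, hκ, hcone⟩ := exists_cone_estimate hsymm
    ((contDiffAt_chartField hX.smooth hpz).hasStrictFDerivAt (by simp)) hneg
  obtain ⟨π, C, hC0, hπ⟩ := exists_projection_index (hessian (n := n) f p)
  -- the points whose orbit stays near `p` before the time `-m`
  let R : ℕ → Set (ℝ × EuclideanSpace ℝ (Fin k)) := fun m => {q ∈ Q | ∀ t ≤ -(m : ℝ),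
    Γ q t ∈ (extChartAt (𝓡 n) p).source ∧ extChartAt (𝓡 n) p (Γ q t) ∈ S}
  have hQR : Q = ⋃ m, R m := by
    apply Subset.antisymm
    · intro q hq
      have h1 : ∀ᶠ t in atBot, Γ q t ∈ (extChartAt (𝓡 n) p).source ∧
          extChartAt (𝓡 n) p (Γ q t) ∈ S :=
        (hΓlim q hq).eventually ((eventually_mem_set.2 (extChartAt_source_mem_nhds p)).and
          ((continuousAt_extChartAt p).eventually_mem hS))
      obtain ⟨T, hT⟩ := eventually_atBot.1 h1
      obtain ⟨m, hm⟩ := exists_nat_ge (-T)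
      exact mem_iUnion.2 ⟨m, hq, fun t ht => hT t (by linarith)⟩
    · exact iUnion_subset fun m q hq => hq.1
  -- at the time `-m`, the projection `π` is injective on these points, with Lipschitz inverse
  have hdimR : ∀ m, dimH (R m) ≤ k := by
    intro m
    by_contra hlt
    rw [not_le] at hlt
    obtain ⟨q₀, hq₀, hq₀t⟩ := exists_mem_nhdsWithin_lt_dimH_of_lt_dimH hlt
    have hm0 : -(m : ℝ) ∈ Iic (0 : ℝ) := by simp
    have hbase : AntilipAt n (fun q => Γ q 0) (R m) q₀ (Γ q₀ 0) := by
      have h1 := (hal q₀ (hQsub hq₀.1)).change (x' := Γ q₀ 0) (by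
        simp only [Γ, zero_add]
        exact mem_extChartAt_source _)
      obtain ⟨ha, hb, c, hc0, hc⟩ := h1
      have hle : 𝓝[R m] q₀ ≤ 𝓝[Icc (-τ) 0 ×ˢ Metric.ball y₁ r₁] q₀ :=
        nhdsWithin_mono _ fun q hq => hQsub hq.1
      simp only [Γ, zero_add] at *
      exact ⟨ha, hb.mono_left hle, c, hc0, hc.filter_mono (Filter.prod_mono hle hle)⟩
    have hend := (hbase.transport hX.smooth hq₀ (fun q hq => hΓint q hq.1) (mem_Iic.2 le_rfl)
      hm0).change (x' := p) (hq₀.2 _ le_rfl).1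
    obtain ⟨-, -, c, hc0, hc⟩ := hend
    rw [eventually_prod_self_iff'] at hc
    obtain ⟨t, ht, htc⟩ := hc
    have htR : t ∩ R m ∈ 𝓝[R m] q₀ := Filter.inter_mem ht self_mem_nhdsWithin
    have hbig := hq₀t _ htR
    have hdist : ∀ q ∈ t ∩ R m, ∀ q' ∈ t ∩ R m, dist q q' ≤ c * Real.sqrt (C / κ) *
        dist (π (extChartAt (𝓡 n) p (Γ q (-m)))) (π (extChartAt (𝓡 n) p (Γ q' (-m)))) := by
      intro q hq q' hq'
      have hcurve : ∀ q ∈ R m, (∀ t ≤ -(m : ℝ), extChartAt (𝓡 n) p (Γ q t) ∈ S ∧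
          HasDerivWithinAt (fun t => extChartAt (𝓡 n) p (Γ q t))
            (chartField X p (extChartAt (𝓡 n) p (Γ q t))) (Iic (-(m : ℝ))) t) ∧
          Tendsto (fun t => extChartAt (𝓡 n) p (Γ q t)) atBot (𝓝 (extChartAt (𝓡 n) p p)) := by
        refine fun q hq => ⟨fun t ht => ⟨(hq.2 t ht).2, ?_⟩, ?_⟩
        · exact hasDerivWithinAt_extChartAt_comp ((hΓint q hq.1).mono (Iic_subset_Iic.2 hm0)) ht
            (hq.2 t ht).1
        · exact (continuousAt_extChartAt p).tendsto.comp (hΓlim q hq.1)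
      obtain ⟨hd1, hl1⟩ := hcurve q hq.2
      obtain ⟨hd2, hl2⟩ := hcurve q' hq'.2
      have h1 := hcone _ _ (-(m : ℝ)) hd1 hd2 hl1 hl2
      set δ := extChartAt (𝓡 n) p (Γ q (-m)) - extChartAt (𝓡 n) p (Γ q' (-m)) with hδ
      have h2 := hπ δ
      have h3 : ‖δ‖ ≤ Real.sqrt (C / κ) * ‖π δ‖ := by
        apply le_of_sq_le_sq _ (by positivity)
        rw [mul_pow, Real.sq_sqrt (by positivity), div_mul_eq_mul_div, le_div_iff₀ hκ]
        linarith
      rw [dist_eq_norm (π _), ← map_sub, mul_assoc]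
      refine (htc q hq.1 q' hq'.1).trans (mul_le_mul_of_nonneg_left ?_ hc0)
      rw [dist_eq_norm]
      exact h3
    have hle := (dimH_le_of_dist_le (g := fun q => π (extChartAt (𝓡 n) p (Γ q (-m)))) hdist).trans
      (dimH_mono (subset_univ _))
    rw [Real.dimH_univ_pi_fin] at hle
    have hkk : (k : ENNReal) < k :=
      hbig.trans_le (hle.trans_eq (congrArg Nat.cast (show sigNeg _ = k from hk.symm)))
    exact absurd hkk (lt_irrefl _)
  -- but the parameters of the swept set fill a box of dimension `k + 1`
  have hdimQ : dimH Q = (k + 1 : ℕ) := by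
    have h1 : (interior Q).Nonempty := by
      rw [hQ, interior_prod_eq, interior_Icc, Metric.isOpen_ball.interior_eq]
      exact (nonempty_Ioo.2 (by linarith)).prod ⟨y₁, Metric.mem_ball_self hr0⟩
    rw [Real.dimH_of_nonempty_interior h1, Module.finrank_prod]
    simp [add_comm]
  have : dimH Q ≤ k := by
    rw [hQR, dimH_iUnion]
    exact iSup_le hdimR
  rw [hdimQ] at this
  have h2 : k + 1 ≤ k := by exact_mod_cast this
  omega

end Tangency

/-! ### Coordinates adapted to a submanifold -/

section Coordinates

variable {E F : Type*} [NormedAddCommGroup E] [NormedSpace ℝ E]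
  [NormedAddCommGroup F] [NormedSpace ℝ F]

/-- Coordinates `(ξ, w) ↦ σ ξ + w` adapted to a parametrized submanifold `σ`, where `w` runs over
a space `V'` of normal directions. The submanifold is `w = 0`. -/
structure NormalCoordinates (σ : F → E) (V' : Submodule ℝ E) where
  /-- The coordinates, as a local homeomorphism. -/
  chart : OpenPartialHomeomorph (F × V') E
  coe_chart : ∀ q, chart q = σ q.1 + q.2
  smooth : ∀ q ∈ chart.source, ContDiffAt ℝ ∞ chart q
  smooth_symm : ∀ z ∈ chart.target, ContDiffAt ℝ ∞ chart.symm z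

namespace NormalCoordinates

/-- The normal coordinate of `z`; it is meaningful for `z` in the target of the chart. -/
def normal {σ : F → E} {V' : Submodule ℝ E} (Θ : NormalCoordinates σ V') (z : E) : V' :=
  (Θ.chart.symm z).2

theorem exists_of_isCompl [FiniteDimensional ℝ E] [FiniteDimensional ℝ F] {σ : F → E} {y₀ : F}
    (hσ : ∀ᶠ y in 𝓝 y₀, ContDiffAt ℝ ∞ σ y)
    {V' : Submodule ℝ E} (hinj : Function.Injective (fderiv ℝ σ y₀))
    (hV' : IsCompl (LinearMap.range (fderiv ℝ σ y₀).toLinearMap) V') {G : Set F} (hG : G ∈ 𝓝 y₀) :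
    ∃ Θ : NormalCoordinates σ V', (y₀, 0) ∈ Θ.chart.source ∧ ∀ q ∈ Θ.chart.source, q.1 ∈ G := by
  let g : F × V' → E := fun q => σ q.1 + q.2
  have hg : ∀ q : F × V', ContDiffAt ℝ ∞ σ q.1 → ContDiffAt ℝ ∞ g q := fun q hq =>
    (ContDiffAt.comp q hq contDiffAt_fst).add
      (V'.subtypeL.contDiff.contDiffAt.comp q contDiffAt_snd)
  let L₀ : (F × V') →L[ℝ] E := (fderiv ℝ σ y₀).coprod V'.subtypeL
  have hderiv : HasFDerivAt g L₀ (y₀, 0) := by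
    have h1 : HasFDerivAt σ (fderiv ℝ σ y₀) y₀ :=
      (hσ.self_of_nhds.differentiableAt (by simp)).hasFDerivAt
    have h2 : HasFDerivAt (fun q : F × V' => σ q.1)
        ((fderiv ℝ σ y₀).comp (ContinuousLinearMap.fst ℝ F V')) (y₀, 0) :=
      HasFDerivAt.comp (g := σ) (y₀, (0 : V')) h1 hasFDerivAt_fst
    have h3 : HasFDerivAt (fun q : F × V' => (q.2 : E))
        (V'.subtypeL.comp (ContinuousLinearMap.snd ℝ F V')) (y₀, 0) :=
      V'.subtypeL.hasFDerivAt.comp (y₀, (0 : V')) hasFDerivAt_snd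
    refine (h2.add h3).congr_fderiv ?_
    ext q <;> simp [L₀]
  have hbij : Function.Bijective L₀ := by
    constructor
    · rw [injective_iff_map_eq_zero]
      rintro ⟨ξ, w⟩ h
      have h1 : fderiv ℝ σ y₀ ξ + (w : E) = 0 := by simpa [L₀] using h
      have h2 : (w : E) = 0 := by
        have h3 : (w : E) ∈ LinearMap.range (fderiv ℝ σ y₀).toLinearMap :=
          ⟨-ξ, by simp; exact neg_eq_of_add_eq_zero_right h1⟩
        exact Submodule.disjoint_def.1 hV'.disjoint _ h3 w.2
      rw [h2, add_zero] at h1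
      have h4 : ξ = 0 := hinj (by rw [h1, map_zero])
      have h5 : w = 0 := Subtype.ext h2
      rw [h4, h5]
      rfl
    · intro z
      have hz : z ∈ LinearMap.range (fderiv ℝ σ y₀).toLinearMap ⊔ V' := by
        rw [hV'.sup_eq_top]; trivial
      obtain ⟨a, ⟨ξ, rfl⟩, w, hw, rfl⟩ := Submodule.mem_sup.1 hz
      exact ⟨(ξ, ⟨w, hw⟩), by simp [L₀]⟩
  let L : (F × V') ≃L[ℝ] E := (LinearEquiv.ofBijective L₀.toLinearMap hbij).toContinuousLinearEquiv
  have hL : (L : (F × V') →L[ℝ] E) = L₀ := by ext q <;> rfl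
  have hσ2 : ∀ᶠ q in 𝓝 ((y₀, 0) : F × V'), ContDiffAt ℝ ∞ σ q.1 ∧ q.1 ∈ G :=
    (show Tendsto (Prod.fst : F × V' → F) (𝓝 (y₀, 0)) (𝓝 y₀) from continuousAt_fst).eventually
      (hσ.and hG)
  have hinv : ∀ᶠ q in 𝓝 ((y₀, 0) : F × V'), ∃ L' : (F × V') ≃L[ℝ] E, HasFDerivAt g
      (L' : (F × V') →L[ℝ] E) q := by
    have hc : ContinuousAt (fderiv ℝ g) (y₀, 0) :=
      ((hg _ hσ2.self_of_nhds.1).fderiv_right (m := ∞) (by simp)).continuousAt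
    have hmem : range ((↑) : ((F × V') ≃L[ℝ] E) → (F × V') →L[ℝ] E) ∈ 𝓝 (fderiv ℝ g (y₀, 0)) := by
      rw [hderiv.fderiv, ← hL]
      exact ContinuousLinearEquiv.nhds L
    filter_upwards [hc.eventually_mem hmem, hσ2] with q hq hq2
    obtain ⟨L', hL'⟩ := hq
    refine ⟨L', ?_⟩
    rw [hL']
    exact ((hg q hq2.1).differentiableAt (by simp)).hasFDerivAt
  let Θ₀ := (hg (y₀, 0) hσ2.self_of_nhds.1).toOpenPartialHomeomorph (f' := L) g
    (by rw [hL]; exact hderiv) (by simp)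
  have hΘ₀ : ∀ q, Θ₀ q = g q := fun q => rfl
  obtain ⟨T, hT, hTo, hTm⟩ := eventually_nhds_iff.1 (hσ2.and hinv)
  let Θ := Θ₀.restrOpen T hTo
  have hsrc : ∀ q ∈ Θ.source, q ∈ T := fun q hq => by
    have : q ∈ Θ₀.source ∩ T := by simpa [Θ] using hq
    exact this.2
  refine ⟨⟨Θ, fun q => rfl, fun q hq => hg q (hT q (hsrc q hq)).1.1, fun z hz => ?_⟩, ?_,
    fun q hq => (hT q (hsrc q hq)).1.2⟩
  · have hq := hsrc _ (Θ.map_target hz)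
    obtain ⟨L', hL'⟩ := (hT _ hq).2
    exact Θ.contDiffAt_symm hz hL' (hg _ (hT _ hq).1.1)
  · have h1 : ((y₀, 0) : F × V') ∈ Θ₀.source :=
      ContDiffAt.mem_toOpenPartialHomeomorph_source _ _ _
    have : ((y₀, 0) : F × V') ∈ Θ₀.source ∩ T := ⟨h1, hTm⟩
    simpa [Θ] using this

variable {σ : F → E} {V' : Submodule ℝ E} (Θ : NormalCoordinates σ V')

theorem chart_zero (y : F) : Θ.chart (y, 0) = σ y := by simp [Θ.coe_chart]

theorem mem_target {y : F} (hy : (y, 0) ∈ Θ.chart.source) : σ y ∈ Θ.chart.target := by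
  rw [← Θ.chart_zero]; exact Θ.chart.map_source hy

theorem symm_apply {y : F} (hy : (y, 0) ∈ Θ.chart.source) : Θ.chart.symm (σ y) = (y, 0) := by
  rw [← Θ.chart_zero, Θ.chart.left_inv hy]

theorem normal_apply {y : F} (hy : (y, 0) ∈ Θ.chart.source) : Θ.normal (σ y) = 0 := by
  rw [normal, Θ.symm_apply hy]

theorem eventually_mem_source {y : F} (hy : (y, 0) ∈ Θ.chart.source) :
    ∀ᶠ y' in 𝓝 y, (y', (0 : V')) ∈ Θ.chart.source := by
  have hc : ContinuousAt (fun y' : F => (y', (0 : V'))) y := by fun_prop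
  exact hc.eventually_mem (Θ.chart.open_source.mem_nhds hy)

theorem contDiffAt_normal {z : E} (hz : z ∈ Θ.chart.target) : ContDiffAt ℝ ∞ Θ.normal z :=
  contDiffAt_snd.comp z (Θ.smooth_symm z hz)

theorem differentiableAt_param {y : F} (hy : (y, 0) ∈ Θ.chart.source) :
    DifferentiableAt ℝ σ y := by
  have h1 : DifferentiableAt ℝ (fun y' : F => Θ.chart (y', 0)) y :=
    DifferentiableAt.comp (g := Θ.chart) y ((Θ.smooth _ hy).differentiableAt (by simp))
      (by fun_prop)
  simpa only [Θ.chart_zero] using h1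

theorem fderiv_normal_tangent {y : F} (hy : (y, 0) ∈ Θ.chart.source) (ξ : F) :
    fderiv ℝ Θ.normal (σ y) (fderiv ℝ σ y ξ) = 0 := by
  have h1 := ((Θ.contDiffAt_normal (Θ.mem_target hy)).differentiableAt
    (by simp)).hasFDerivAt.comp y (Θ.differentiableAt_param hy).hasFDerivAt
  have h2 : Θ.normal ∘ σ =ᶠ[𝓝 y] fun _ => 0 := by
    filter_upwards [Θ.eventually_mem_source hy] with y' hy'
    exact Θ.normal_apply hy'
  have h3 := h1.fderiv
  rw [h2.fderiv_eq] at h3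
  have h4 := DFunLike.congr_fun h3 ξ
  simpa using h4.symm

theorem fderiv_chart {y : F} (hy : (y, 0) ∈ Θ.chart.source) (w : V') :
    fderiv ℝ Θ.chart (y, 0) (0, w) = w := by
  have h1 := ((Θ.smooth _ hy).differentiableAt (by simp)).hasFDerivAt
  have h2 : HasFDerivAt (fun w : V' => ((y, w) : F × V')) (ContinuousLinearMap.inr ℝ F V') 0 :=
    hasFDerivAt_prodMk_right y 0
  have h3 := HasFDerivAt.comp (g := Θ.chart) (0 : V') h1 h2
  have h4 : HasFDerivAt (fun w : V' => σ y + (w : E)) V'.subtypeL 0 :=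
    (V'.subtypeL.hasFDerivAt).const_add (σ y)
  have h5 : (Θ.chart ∘ fun w : V' => ((y, w) : F × V')) = fun w : V' => σ y + (w : E) := by
    ext w; simp [Θ.coe_chart]
  rw [h5] at h3
  have h6 := DFunLike.congr_fun (h3.unique h4) w
  simpa using h6

theorem fderiv_normal_normal {y : F} (hy : (y, 0) ∈ Θ.chart.source) (w : V') :
    fderiv ℝ Θ.normal (σ y) w = w := by
  have h1 := ((Θ.contDiffAt_normal (Θ.mem_target hy)).differentiableAt (by simp)).hasFDerivAt
  rw [← Θ.chart_zero] at h1
  have h2 := (h1.comp (y, 0) ((Θ.smooth _ hy).differentiableAt (by simp)).hasFDerivAt).fderiv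
  have h3 : Θ.normal ∘ Θ.chart =ᶠ[𝓝 (y, 0)] Prod.snd := by
    filter_upwards [Θ.chart.open_source.mem_nhds hy] with q hq
    simp [normal, Θ.chart.left_inv hq]
  rw [h3.fderiv_eq, fderiv_snd] at h2
  have h4 := DFunLike.congr_fun h2 (0, w)
  simp only [ContinuousLinearMap.comp_apply, Θ.fderiv_chart hy, Θ.chart_zero] at h4
  exact h4.symm

/-- A function vanishing together with its derivative along the submanifold is bounded by the
square of the normal coordinate. -/
theorem eventually_abs_le_normal_sq {y₀ : F} (hy₀ : (y₀, 0) ∈ Θ.chart.source) {w : E → ℝ}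
    (hw : ContDiffAt ℝ ∞ w (σ y₀))
    (h : ∀ᶠ y in 𝓝 y₀, w (σ y) = 0 ∧ fderiv ℝ w (σ y) = 0) :
    ∃ C : ℝ, ∀ᶠ z in 𝓝 (σ y₀), |w z| ≤ C * ‖Θ.normal z‖ ^ 2 := by
  have hw0 : ContDiffAt ℝ ∞ w (Θ.chart (y₀, 0)) := by rwa [Θ.chart_zero]
  have h1 : ContDiffAt ℝ ∞ (w ∘ Θ.chart) (y₀, 0) := hw0.comp _ (Θ.smooth _ hy₀)
  have hwd : ∀ᶠ z in 𝓝 (σ y₀), DifferentiableAt ℝ w z :=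
    ((hw.of_le (m := 1) ENat.LEInfty.out).eventually (by simp)).mono fun z hz =>
      hz.differentiableAt (by simp)
  have hσc := (Θ.differentiableAt_param hy₀).continuousAt
  obtain ⟨C, hC⟩ := eventually_abs_le_sq_of_fderiv_eq_zero (h1.of_le ENat.LEInfty.out)
    (by filter_upwards [h] with y hy; simp [Θ.chart_zero, hy.1])
    (by
      filter_upwards [h, Θ.eventually_mem_source hy₀, hσc.eventually hwd] with y hy hys hyd
      rw [← Θ.chart_zero] at hyd
      rw [fderiv_comp _ hyd ((Θ.smooth _ hys).differentiableAt (by simp)), Θ.chart_zero, hy.2,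
        ContinuousLinearMap.zero_comp])
  refine ⟨C, ?_⟩
  have hcs : Tendsto Θ.chart.symm (𝓝 (σ y₀)) (𝓝 (y₀, 0)) := by
    have := (Θ.smooth_symm _ (Θ.mem_target hy₀)).continuousAt.tendsto
    rwa [Θ.symm_apply hy₀] at this
  filter_upwards [hcs.eventually hC, Θ.chart.open_target.mem_nhds (Θ.mem_target hy₀)] with z hz hzt
  simp only [Function.comp_apply, Θ.chart.right_inv hzt] at hz
  exact hz

theorem normal_field_apply {y : F} (hy : (y, 0) ∈ Θ.chart.source) {Y : E → E}
    (hY : ∃ ξ, Y (σ y) = fderiv ℝ σ y ξ) : fderiv ℝ Θ.normal (σ y) (Y (σ y)) = 0 := by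
  obtain ⟨ξ, hξ⟩ := hY
  rw [hξ, Θ.fderiv_normal_tangent hy]

theorem contDiffAt_normal_field {y : F} (hy : (y, 0) ∈ Θ.chart.source) {Y : E → E}
    (hYs : ContDiffAt ℝ ∞ Y (σ y)) :
    ContDiffAt ℝ ∞ (fun z => fderiv ℝ Θ.normal z (Y z)) (σ y) :=
  ((Θ.contDiffAt_normal (Θ.mem_target hy)).fderiv_right (m := ∞) (by simp)).clm_apply hYs

theorem fderiv_normal_field {y : F} (hy : (y, 0) ∈ Θ.chart.source) {Y : E → E}
    (hYs : ContDiffAt ℝ ∞ Y (σ y)) (h0 : Y (σ y) = 0) :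
    fderiv ℝ (fun z => fderiv ℝ Θ.normal z (Y z)) (σ y) =
      (fderiv ℝ Θ.normal (σ y)).comp (fderiv ℝ Y (σ y)) := by
  have h1 := (((Θ.contDiffAt_normal (Θ.mem_target hy)).fderiv_right (m := ∞)
    (by simp)).differentiableAt (by simp)).hasFDerivAt.clm_apply
      (hYs.differentiableAt (by simp)).hasFDerivAt
  rw [h1.fderiv, h0]
  simp

theorem mem_range_of_fderiv_normal {y : F} (hy : (y, 0) ∈ Θ.chart.source)
    (hV' : IsCompl (LinearMap.range (fderiv ℝ σ y).toLinearMap) V') (z : E) :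
    z - fderiv ℝ Θ.normal (σ y) z ∈ LinearMap.range (fderiv ℝ σ y).toLinearMap := by
  have hz : z ∈ LinearMap.range (fderiv ℝ σ y).toLinearMap ⊔ V' := by
    rw [hV'.sup_eq_top]; trivial
  obtain ⟨a, ⟨ξ, rfl⟩, w, hw, rfl⟩ := Submodule.mem_sup.1 hz
  have h1 := Θ.fderiv_normal_tangent hy ξ
  have h2 := Θ.fderiv_normal_normal hy ⟨w, hw⟩
  simp only [ContinuousLinearMap.coe_coe] at *
  rw [map_add, h1, h2]
  simp

/-- The linear part, at a zero, of a field tangent to the submanifold preserves the tangent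
space. -/
theorem fderiv_field_mem_range {y : F} (hy : (y, 0) ∈ Θ.chart.source)
    (hV' : IsCompl (LinearMap.range (fderiv ℝ σ y).toLinearMap) V') {Y : E → E}
    (hYs : ContDiffAt ℝ ∞ Y (σ y)) (h0 : Y (σ y) = 0)
    (hY : ∀ᶠ y' in 𝓝 y, ∃ ξ, Y (σ y') = fderiv ℝ σ y' ξ) (ξ : F) :
    fderiv ℝ Y (σ y) (fderiv ℝ σ y ξ) ∈ LinearMap.range (fderiv ℝ σ y).toLinearMap := by
  have h1 := ((Θ.contDiffAt_normal_field hy hYs).differentiableAt (by simp)).hasFDerivAt.comp y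
    (Θ.differentiableAt_param hy).hasFDerivAt
  have h2 : (fun z => fderiv ℝ Θ.normal z (Y z)) ∘ σ =ᶠ[𝓝 y] fun _ => 0 := by
    filter_upwards [Θ.eventually_mem_source hy, hY] with y' hy' hyY
    exact Θ.normal_field_apply hy' hyY
  have h3 := h1.fderiv
  rw [h2.fderiv_eq, Θ.fderiv_normal_field hy hYs h0] at h3
  have h4 := DFunLike.congr_fun h3 ξ
  simp only [fderiv_fun_const, Pi.zero_apply, ContinuousLinearMap.comp_apply] at h4
  have h5 := Θ.mem_range_of_fderiv_normal hy hV' (fderiv ℝ Y (σ y) (fderiv ℝ σ y ξ))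
  rw [← h4] at h5
  simpa using h5

/-- Near a zero of a field `Y` tangent to the submanifold, the value of `H` on the normal
coordinate decreases along `Y`, provided that `H` decreases along the linear part of `Y` and the
normal directions are `H`-orthogonal to the submanifold. -/
theorem eventually_fderiv_sq_normal_nonpos [FiniteDimensional ℝ E] {y : F}
    (hy : (y, 0) ∈ Θ.chart.source)
    (hV' : IsCompl (LinearMap.range (fderiv ℝ σ y).toLinearMap) V') {Y : E → E}
    (hYs : ContDiffAt ℝ ∞ Y (σ y)) (h0 : Y (σ y) = 0)
    (hY : ∀ᶠ y' in 𝓝 y, ∃ ξ, Y (σ y') = fderiv ℝ σ y' ξ) {H : E →L[ℝ] E →L[ℝ] ℝ}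
    (hsymm : ∀ v w, H v w = H w v) (hneg : ∀ v, v ≠ 0 → H (fderiv ℝ Y (σ y) v) v < 0)
    (horth : ∀ v ∈ LinearMap.range (fderiv ℝ σ y).toLinearMap, ∀ w ∈ V', H v w = 0) :
    ∀ᶠ z in 𝓝 (σ y), fderiv ℝ (fun z => H (Θ.normal z) (Θ.normal z)) z (Y z) ≤ 0 := by
  obtain ⟨c, hc, hcoer⟩ := exists_coercive_of_neg (H.comp (fderiv ℝ Y (σ y))) hneg
  set B := (fderiv ℝ Θ.normal (σ y)).comp (fderiv ℝ Y (σ y)) with hB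
  -- `θ` is the relative size of the nonlinear terms which the coercivity constant `c` absorbs
  set θ : ℝ := c / (‖H‖ + 1) with hθ
  have hθ0 : 0 < θ := by positivity
  have hHθ : ‖H‖ * θ ≤ c := by
    rw [hθ, mul_div_assoc', div_le_iff₀ (by positivity)]
    nlinarith [norm_nonneg H]
  -- the normal component of the field is close to its linear part
  have hlin : ∀ᶠ z in 𝓝 (σ y),
      ‖fderiv ℝ Θ.normal z (Y z) - B (Θ.normal z)‖ ≤ θ * ‖Θ.normal z‖ := by
    have h1 : ContDiffAt ℝ ∞ (fun q => fderiv ℝ Θ.normal (Θ.chart q) (Y (Θ.chart q))) (y, 0) := by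
      have h := Θ.contDiffAt_normal_field hy hYs
      rw [← Θ.chart_zero] at h
      exact ContDiffAt.comp (g := fun z => fderiv ℝ Θ.normal z (Y z)) (y, (0 : V')) h
        (Θ.smooth _ hy)
    have h2 : ∀ w : V', fderiv ℝ (fun q => fderiv ℝ Θ.normal (Θ.chart q) (Y (Θ.chart q))) (y, 0)
        (0, w) = B w := by
      intro w
      have h := ((Θ.contDiffAt_normal_field hy hYs).differentiableAt (by simp)).hasFDerivAt
      rw [Θ.fderiv_normal_field hy hYs h0] at h
      have e : HasFDerivAt (fun z => fderiv ℝ Θ.normal z (Y z)) B (Θ.chart (y, 0)) := by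
        rw [Θ.chart_zero]; exact h
      have h3 := HasFDerivAt.comp (g := fun z => fderiv ℝ Θ.normal z (Y z)) (y, (0 : V')) e
        ((Θ.smooth _ hy).differentiableAt (by simp)).hasFDerivAt
      have h4 := DFunLike.congr_fun h3.fderiv (0, w)
      rw [ContinuousLinearMap.comp_apply, Θ.fderiv_chart hy] at h4
      exact h4
    have hev := (h1.hasStrictFDerivAt (by simp)).isLittleO.def hθ0
    have hpair : Tendsto (fun q : F × V' => (q, (q.1, (0 : V')))) (𝓝 (y, 0))
        (𝓝 ((y, 0), (y, 0))) := by
      have : ContinuousAt (fun q : F × V' => (q, (q.1, (0 : V')))) (y, 0) := by fun_prop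
      exact this
    have hcs : Tendsto Θ.chart.symm (𝓝 (σ y)) (𝓝 (y, 0)) := by
      have := (Θ.smooth_symm _ (Θ.mem_target hy)).continuousAt.tendsto
      rwa [Θ.symm_apply hy] at this
    have hfst : Tendsto (fun q : F × V' => q.1) (𝓝 (y, 0)) (𝓝 y) := continuousAt_fst
    filter_upwards [hcs.eventually (hpair.eventually hev),
      hcs.eventually (hfst.eventually (hY.and (Θ.eventually_mem_source hy))),
      Θ.chart.open_target.mem_nhds (Θ.mem_target hy)] with z hz1 hz2 hz3
    simp only [Θ.chart.right_inv hz3, Θ.chart_zero] at hz1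
    rw [Θ.normal_field_apply hz2.2 hz2.1, sub_zero] at hz1
    have e1 : Θ.chart.symm z - ((Θ.chart.symm z).1, 0) = (0, Θ.normal z) := by
      ext <;> simp [normal]
    rw [e1, h2] at hz1
    simpa [Prod.norm_mk] using hz1
  filter_upwards [hlin, Θ.chart.open_target.mem_nhds (Θ.mem_target hy)] with z hz hzt
  have hd := (((Θ.contDiffAt_normal hzt).differentiableAt (by simp)).hasFDerivAt)
  have hd2 : HasFDerivAt (fun z => (Θ.normal z : E)) (V'.subtypeL.comp (fderiv ℝ Θ.normal z)) z :=
    V'.subtypeL.hasFDerivAt.comp z hd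
  have hd3 := (H.hasFDerivAt.comp z hd2).clm_apply hd2
  have hd4 := DFunLike.congr_fun hd3.fderiv (Y z)
  set η : V' := Θ.normal z with hη
  set e : V' := fderiv ℝ Θ.normal z (Y z) - B η with he
  have hYe : fderiv ℝ Θ.normal z (Y z) = B η + e := by rw [he]; abel
  have hval : fderiv ℝ (fun z => H (Θ.normal z) (Θ.normal z)) z (Y z) =
      2 * H ((B η + e : V') : E) (η : E) := by
    have h6 : fderiv ℝ (fun z => H (Θ.normal z) (Θ.normal z)) z (Y z) =
      H (η : E) ((fderiv ℝ Θ.normal z (Y z) : V') : E) +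
        H ((fderiv ℝ Θ.normal z (Y z) : V') : E) (η : E) := by
      refine hd4.trans ?_
      simp [hη]
    rw [h6, hYe, hsymm (η : E)]; ring
  rw [hval]
  have h7 : H ((B η : V') : E) (η : E) ≤ -(c * ‖η‖ ^ 2) := by
    have h8 := horth _ (Θ.mem_range_of_fderiv_normal hy hV' (fderiv ℝ Y (σ y) η)) η η.2
    rw [map_sub, sub_apply, sub_eq_zero] at h8
    have h9 := hcoer (η : E)
    simp only [ContinuousLinearMap.comp_apply] at h9
    rw [h8] at h9
    exact h9
  have h10 : H (e : E) (η : E) ≤ c * ‖η‖ ^ 2 := by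
    calc H (e : E) (η : E) ≤ ‖H‖ * ‖(e : E)‖ * ‖(η : E)‖ :=
          (le_abs_self _).trans (H.le_opNorm₂ _ _)
      _ ≤ ‖H‖ * (θ * ‖η‖) * ‖η‖ := by
          have : ‖(e : E)‖ ≤ θ * ‖η‖ := hz
          gcongr
          exact le_rfl
      _ = ‖H‖ * θ * ‖η‖ ^ 2 := by ring
      _ ≤ _ := by gcongr
  rw [Submodule.coe_add, map_add, add_apply]
  linarith

end NormalCoordinates

/-- The second derivative of `u` is nonpositive on the directions tangent to a submanifold on which
`u` has a local maximum at a critical point. -/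
theorem hessian_nonpos_of_isLocalMax {u : E → ℝ} {σ : F → E} {y₀ : F}
    (hu : ContDiffAt ℝ ∞ u (σ y₀)) (hσ : ContDiffAt ℝ ∞ σ y₀) (hcrit : fderiv ℝ u (σ y₀) = 0)
    (hmax : ∀ᶠ y in 𝓝 y₀, u (σ y) ≤ u (σ y₀)) (ξ : F) :
    fderiv ℝ (fderiv ℝ u) (σ y₀) (fderiv ℝ σ y₀ ξ) (fderiv ℝ σ y₀ ξ) ≤ 0 := by
  by_contra hpos
  rw [not_le] at hpos
  let l : ℝ → F := fun t => y₀ + t • ξ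
  have hl : ∀ t, HasDerivAt l ξ t := fun t => by
    have h : HasDerivAt (fun t : ℝ => t • ξ) ξ t := by simpa using (hasDerivAt_id t).smul_const ξ
    exact h.const_add y₀
  have hl0 : l 0 = y₀ := by simp [l]
  have hlc : Tendsto l (𝓝 0) (𝓝 y₀) := by
    have := (hl 0).continuousAt.tendsto
    rwa [hl0] at this
  let h : ℝ → ℝ := fun t => u (σ (l t))
  have hd : ∀ᶠ t in 𝓝 0, HasDerivAt h (fderiv ℝ u (σ (l t)) (fderiv ℝ σ (l t) ξ)) t := by
    have h1 : ∀ᶠ y in 𝓝 y₀, DifferentiableAt ℝ σ y :=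
      ((hσ.of_le (m := 1) ENat.LEInfty.out).eventually (by simp)).mono fun z hz =>
        hz.differentiableAt (by simp)
    have h2 : ∀ᶠ y in 𝓝 y₀, DifferentiableAt ℝ u (σ y) :=
      hσ.continuousAt.eventually
        (((hu.of_le (m := 1) ENat.LEInfty.out).eventually (by simp)).mono fun z hz =>
          hz.differentiableAt (by simp))
    filter_upwards [hlc.eventually (h1.and h2)] with t ht
    exact HasFDerivAt.comp_hasDerivAt (l := u) t ht.2.hasFDerivAt
      (HasFDerivAt.comp_hasDerivAt (l := σ) t ht.1.hasFDerivAt (hl t))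
  have hd0 : deriv h =ᶠ[𝓝 0] fun t => fderiv ℝ u (σ (l t)) (fderiv ℝ σ (l t) ξ) :=
    hd.mono fun t ht => ht.deriv
  have hdd : HasDerivAt (fun t => fderiv ℝ u (σ (l t)) (fderiv ℝ σ (l t) ξ))
      (fderiv ℝ (fderiv ℝ u) (σ y₀) (fderiv ℝ σ y₀ ξ) (fderiv ℝ σ y₀ ξ)) 0 := by
    have a1 : HasFDerivAt (fderiv ℝ u) (fderiv ℝ (fderiv ℝ u) (σ (l 0))) (σ (l 0)) := by
      rw [hl0]
      exact ((hu.fderiv_right (m := ∞) (by simp)).differentiableAt (by simp)).hasFDerivAt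
    have a2 : HasFDerivAt σ (fderiv ℝ σ (l 0)) (l 0) := by
      rw [hl0]
      exact (hσ.differentiableAt (by simp)).hasFDerivAt
    have a3 : HasFDerivAt (fderiv ℝ σ) (fderiv ℝ (fderiv ℝ σ) (l 0)) (l 0) := by
      rw [hl0]
      exact ((hσ.fderiv_right (m := ∞) (by simp)).differentiableAt (by simp)).hasFDerivAt
    have b1 := a1.comp_hasDerivAt (0 : ℝ) (a2.comp_hasDerivAt (0 : ℝ) (hl 0))
    have b2 := (a3.comp_hasDerivAt (0 : ℝ) (hl 0)).clm_apply (hasDerivAt_const (0 : ℝ) ξ)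
    have b3 := b1.clm_apply b2
    refine b3.congr_deriv ?_
    simp [hl0, hcrit]
  have hmin : IsLocalMin h 0 := by
    apply isLocalMin_of_deriv_deriv_pos
    · rw [hd0.deriv_eq, hdd.deriv]; exact hpos
    · rw [hd0.self_of_nhds]; simp only [hl0, hcrit]; rfl
    · exact hd.self_of_nhds.continuousAt
  -- a minimum which is also a maximum: `h` is constant, contrary to its second derivative
  have hconst : h =ᶠ[𝓝 0] fun _ => h 0 := by
    filter_upwards [hmin, hlc.eventually hmax] with t h1 h2
    refine le_antisymm ?_ h1
    simpa [h, hl0] using h2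
  have hz : deriv (deriv h) 0 = 0 := by
    have h1 : deriv h =ᶠ[𝓝 0] deriv fun _ => h 0 := hconst.deriv
    rw [h1.deriv_eq]; simp
  rw [hd0.deriv_eq, hdd.deriv] at hz
  exact hpos.ne' hz

end Coordinates

/-! ### Local equations of the disc -/

section LocalDefiningFunction

variable {n : ℕ} {M : Type*} [TopologicalSpace M] [ChartedSpace (EuclideanSpace ℝ (Fin n)) M]
  {X : (x : M) → TangentSpace (𝓡 n) x} {k : ℕ}
  {φ : EuclideanSpace ℝ (Fin k) → M} {y₁ : EuclideanSpace ℝ (Fin k)}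

theorem IsDiscParam.contMDiffAt (hφ : IsDiscParam n k φ) (hy : y₁ ∈ Metric.ball 0 1) :
    ContMDiffAt (𝓡 k) (𝓡 n) ∞ φ y₁ :=
  hφ.smooth.contMDiffAt (mem_of_superset (Metric.isOpen_ball.mem_nhds hy)
    Metric.ball_subset_closedBall)

theorem IsDiscParam.injective_mfderiv (hφ : IsDiscParam n k φ) (hy : y₁ ∈ Metric.ball 0 1) :
    Function.Injective (mfderiv (𝓡 k) (𝓡 n) φ y₁) := by
  have h := hφ.immersive y₁ (Metric.ball_subset_closedBall hy)
  rwa [mfderivWithin_of_mem_nhds (mem_of_superset (Metric.isOpen_ball.mem_nhds hy)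
    Metric.ball_subset_closedBall)] at h

/-- On the open set `O`, the function `e` is a nonnegative smooth equation of `D`; it dominates
near `D` the derivative along `X` of every nonnegative function vanishing on `D`. -/
structure IsDefiningOn (X : (x : M) → TangentSpace (𝓡 n) x) (D O : Set M) (e : M → ℝ) : Prop where
  isOpen : IsOpen O
  smooth : ContMDiffOn (𝓡 n) 𝓘(ℝ, ℝ) ∞ e O
  nonneg : ∀ x ∈ O, 0 ≤ e x
  eq_zero_iff : ∀ x ∈ O, e x = 0 ↔ x ∈ D
  dominates : ∀ x₀ ∈ O ∩ D, ∀ u : M → ℝ, ContMDiff (𝓡 n) 𝓘(ℝ, ℝ) ∞ u → (∀ x, 0 ≤ u x) →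
    (∀ x ∈ D, u x = 0) → ∃ C : ℝ, ∀ᶠ x in 𝓝 x₀, |lieDeriv X u x| ≤ C * e x

variable [IsManifold (𝓡 n) ∞ M]

theorem exists_chartField_eq_fderiv {x : M} (hφ : ContMDiffAt (𝓡 k) (𝓡 n) ∞ φ y₁)
    (hx : φ y₁ ∈ (extChartAt (𝓡 n) x).source)
    (htan : ∃ ξ, X (φ y₁) = mfderiv (𝓡 k) (𝓡 n) φ y₁ ξ) :
    ∃ ξ, chartField X x (extChartAt (𝓡 n) x (φ y₁)) =
      fderiv ℝ (fun y => extChartAt (𝓡 n) x (φ y)) y₁ ξ := by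
  obtain ⟨ξ, hξ⟩ := htan
  refine ⟨ξ, Eq.trans ?_ (fderiv_extChartAt_comp hφ hx ξ).symm⟩
  rw [chartField, (extChartAt (𝓡 n) x).left_inv hx]
  exact congrArg _ hξ

theorem exists_coercive_of_pos {E : Type*} [NormedAddCommGroup E] [NormedSpace ℝ E]
    [FiniteDimensional ℝ E] {H : E →L[ℝ] E →L[ℝ] ℝ} {V' : Submodule ℝ E}
    (hH : ∀ w ∈ V', w ≠ 0 → 0 < H w w) : ∃ c > 0, ∀ w : V', c * ‖w‖ ^ 2 ≤ H w w := by
  obtain ⟨c, hc, hcoer⟩ := exists_coercive_of_neg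
    (-((ContinuousLinearMap.compL ℝ V' E ℝ).flip V'.subtypeL ∘L (H ∘L V'.subtypeL)))
    (fun w hw => by
      have := hH w w.2 (by simpa using hw)
      simpa using this)
  refine ⟨c, hc, fun w => ?_⟩
  have h1 : -(H (w : E) w) ≤ -(c * ‖w‖ ^ 2) := hcoer w
  linarith

/-- The value of a form `H`, positive definite on the normal directions, on the normal coordinate is
a local equation of the disc. It dominates `X · u` because, `X` being tangent to the disc, the
function `X · u` vanishes to second order along the disc. -/
theorem exists_normalCoordinates_isDefiningOn [T2Space M] (hφ : IsDiscParam n k φ)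
    (hX : ContMDiff (𝓡 n) (𝓡 n).tangent ∞ (fun x => (⟨x, X x⟩ : TangentBundle (𝓡 n) M)))
    (htan : ∀ y ∈ Metric.ball (0 : EuclideanSpace ℝ (Fin k)) 1,
      ∃ ξ, X (φ y) = mfderiv (𝓡 k) (𝓡 n) φ y ξ) (hy₁ : y₁ ∈ Metric.ball 0 1)
    {V' : Submodule ℝ (EuclideanSpace ℝ (Fin n))}
    (hV' : IsCompl (LinearMap.range
      (fderiv ℝ (fun y => extChartAt (𝓡 n) (φ y₁) (φ y)) y₁).toLinearMap) V')
    {H : EuclideanSpace ℝ (Fin n) →L[ℝ] EuclideanSpace ℝ (Fin n) →L[ℝ] ℝ}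
    (hH : ∀ w ∈ V', w ≠ 0 → 0 < H w w) :
    ∃ Θ : NormalCoordinates (fun y => extChartAt (𝓡 n) (φ y₁) (φ y)) V',
      (y₁, 0) ∈ Θ.chart.source ∧ ∃ O, φ y₁ ∈ O ∧
        IsDefiningOn X (φ '' Metric.closedBall 0 1) O (fun x =>
          H (Θ.normal (extChartAt (𝓡 n) (φ y₁) x)) (Θ.normal (extChartAt (𝓡 n) (φ y₁) x))) := by
  set ψ := extChartAt (𝓡 n) (φ y₁) with hψ
  set G : Set (EuclideanSpace ℝ (Fin k)) := {y | y ∈ Metric.ball 0 1 ∧ φ y ∈ ψ.source} with hG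
  have hGn : G ∈ 𝓝 y₁ := by
    have h1 := (hφ.contMDiffAt hy₁).continuousAt.eventually_mem
      (extChartAt_source_mem_nhds (I := 𝓡 n) (φ y₁))
    filter_upwards [Metric.isOpen_ball.mem_nhds hy₁, h1] with y h h'
    exact ⟨h, h'⟩
  have hσ : ∀ y ∈ G, ContDiffAt ℝ ∞ (fun y => ψ (φ y)) y := fun y hy =>
    contDiffAt_extChartAt_comp (hφ.contMDiffAt hy.1) hy.2
  have hinj : Function.Injective (fderiv ℝ (fun y => ψ (φ y)) y₁) := by
    intro a b hab
    rw [fderiv_extChartAt_comp_self (hφ.contMDiffAt hy₁),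
      fderiv_extChartAt_comp_self (hφ.contMDiffAt hy₁)] at hab
    exact hφ.injective_mfderiv hy₁ hab
  obtain ⟨Θ, hΘ, hΘG⟩ := NormalCoordinates.exists_of_isCompl (mem_of_superset hGn hσ) hinj hV' hGn
  refine ⟨Θ, hΘ, ?_⟩
  -- the parameters outside the domain of the coordinates give a compact set avoiding `φ y₁`
  set S : Set (EuclideanSpace ℝ (Fin k)) :=
    Metric.closedBall 0 1 \ (fun y => (y, (0 : V'))) ⁻¹' Θ.chart.source with hS
  have hSc : IsCompact S := (isCompact_closedBall 0 1).diff
    (Θ.chart.open_source.preimage (by fun_prop))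
  have hSK : IsCompact (φ '' S) := hSc.image_of_continuousOn
    (hφ.smooth.continuousOn.mono sdiff_subset)
  have hmem : φ y₁ ∉ φ '' S := by
    rintro ⟨y, hy, hyy⟩
    have : y = y₁ := hφ.injOn hy.1 (Metric.ball_subset_closedBall hy₁) hyy
    rw [this] at hy
    exact hy.2 hΘ
  set O : Set M := (ψ.source ∩ ψ ⁻¹' Θ.chart.target) ∩ (φ '' S)ᶜ with hO
  have hψO : ∀ x ∈ O, x ∈ ψ.source ∧ ψ x ∈ Θ.chart.target := fun x hx => hx.1
  have hpar : ∀ x ∈ O, x ∈ φ '' Metric.closedBall 0 1 →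
      ∃ y, (y, (0 : V')) ∈ Θ.chart.source ∧ y ∈ G ∧ φ y = x := by
    rintro x hx ⟨y, hy, rfl⟩
    have h1 : (y, (0 : V')) ∈ Θ.chart.source := by
      by_contra h
      exact hx.2 ⟨y, ⟨hy, h⟩, rfl⟩
    have h2 := hΘG _ h1
    exact ⟨y, h1, h2, rfl⟩
  obtain ⟨c, hc, hcoer⟩ := exists_coercive_of_pos hH
  have hzero : ∀ w : V', H w w = 0 ↔ w = 0 := fun w => by
    refine ⟨fun h => ?_, fun h => by simp [h]⟩
    by_contra hw
    exact (hH w w.2 (by simpa using hw)).ne' h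
  refine ⟨O, ⟨⟨mem_extChartAt_source _, ?_⟩, hmem⟩, ?_, ?_, ?_, ?_, ?_⟩
  · exact Θ.mem_target hΘ
  · exact ((continuousOn_extChartAt (I := 𝓡 n) (φ y₁)).isOpen_inter_preimage
      (isOpen_extChartAt_source _) Θ.chart.open_target).inter hSK.isClosed.isOpen_compl
  · intro x hx
    have h1 : ContDiffAt ℝ ∞ (fun z => H (Θ.normal z) (Θ.normal z)) (ψ x) := by
      have h2 : ContDiffAt ℝ ∞ (fun z => (Θ.normal z : EuclideanSpace ℝ (Fin n))) (ψ x) :=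
        V'.subtypeL.contDiff.contDiffAt.comp _ (Θ.contDiffAt_normal (hψO x hx).2)
      exact (H.contDiff.contDiffAt.comp _ h2).clm_apply h2
    exact ((contMDiffAt_iff_contDiffAt.2 h1).comp x (contMDiffAt_extChartAt' (n := ∞)
      (by simpa [hψ] using (hψO x hx).1))).contMDiffWithinAt
  · intro x hx
    exact (by positivity : 0 ≤ c * ‖Θ.normal (ψ x)‖ ^ 2).trans (hcoer _)
  · intro x hx
    rw [hzero]
    constructor
    · intro h
      have h1 : Θ.chart ((Θ.chart.symm (ψ x)).1, 0) = ψ x := by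
        rw [← h]; exact Θ.chart.right_inv (hψO x hx).2
      have h2 : ((Θ.chart.symm (ψ x)).1, (0 : V')) ∈ Θ.chart.source := by
        rw [← h]; exact Θ.chart.map_target (hψO x hx).2
      have h3 := hΘG _ h2
      rw [Θ.chart_zero] at h1
      exact ⟨_, Metric.ball_subset_closedBall h3.1, ψ.injOn h3.2 (hψO x hx).1 h1⟩
    · intro h
      obtain ⟨y, hy, -, rfl⟩ := hpar x hx h
      exact Θ.normal_apply hy
  · rintro x₀ ⟨hx₀, hx₀D⟩ u hu hu0 huD
    obtain ⟨y₀, hy₀, hy₀G, rfl⟩ := hpar x₀ hx₀ hx₀D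
    have hz : ψ (φ y₀) ∈ ψ.target := ψ.map_source hy₀G.2
    set w : EuclideanSpace ℝ (Fin n) → ℝ := fun z =>
      fderiv ℝ (chartFun n u (φ y₁)) z (chartField X (φ y₁) z) with hw
    have hws : ContDiffAt ℝ ∞ w (ψ (φ y₀)) :=
      contDiffAt_fderiv_apply (contDiffAt_chartFun hz (hu _)) (contDiffAt_chartField hX hz)
    have hev := Θ.eventually_abs_le_normal_sq hy₀ hws (by
      filter_upwards [Θ.eventually_mem_source hy₀,
        (Θ.eventually_mem_source hy₀).eventually_nhds] with y hy hyn
      have hyG := hΘG _ hy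
      have hzy : ψ (φ y) ∈ ψ.target := ψ.map_source hyG.2
      obtain ⟨ξ, hξ⟩ := exists_chartField_eq_fderiv (hφ.contMDiffAt hyG.1) hyG.2 (htan y hyG.1)
      refine fderiv_tangential_eq_zero (σ := fun y => ψ (φ y))
        ((contDiffAt_chartFun hzy (hu _)).of_le ENat.LEInfty.out)
        ((contDiffAt_chartField hX hzy).differentiableAt (by simp))
        ((hσ y hyG).differentiableAt (by simp)) (Eventually.of_forall fun z => hu0 _) ?_ hξ
      filter_upwards [hyn] with y' hy'
      have hy'G := hΘG _ hy'
      rw [chartFun, ψ.left_inv hy'G.2]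
      exact huD _ ⟨y', Metric.ball_subset_closedBall hy'G.1, rfl⟩)
    obtain ⟨C, hC⟩ := hev
    refine ⟨|C| / c, ?_⟩
    have hψc : Tendsto ψ (𝓝 (φ y₀)) (𝓝 (ψ (φ y₀))) := continuousAt_extChartAt' (by
      simpa [hψ] using hy₀G.2)
    filter_upwards [hψc.eventually hC,
      eventually_lieDeriv_eq_chart (X := X) hy₀G.2 (hu (φ y₀))] with x h1 h2
    rw [h2]
    refine h1.trans ?_
    rw [div_mul_eq_mul_div, le_div_iff₀ hc]
    calc C * ‖Θ.normal (ψ x)‖ ^ 2 * c ≤ |C| * ‖Θ.normal (ψ x)‖ ^ 2 * c := by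
          gcongr; exact le_abs_self C
      _ = |C| * (c * ‖Θ.normal (ψ x)‖ ^ 2) := by ring
      _ ≤ _ := by gcongr; exact hcoer _

end LocalDefiningFunction

section DefiningFunctions

variable {n : ℕ} {M : Type*} [TopologicalSpace M] [ChartedSpace (EuclideanSpace ℝ (Fin n)) M]
  [IsManifold (𝓡 n) ∞ M] {X : (x : M) → TangentSpace (𝓡 n) x} {k : ℕ}
  {φ : EuclideanSpace ℝ (Fin k) → M} {y₁ : EuclideanSpace ℝ (Fin k)}

theorem exists_normalCoordinates_isDefiningOn_inner [T2Space M] (hφ : IsDiscParam n k φ)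
    (hX : ContMDiff (𝓡 n) (𝓡 n).tangent ∞ (fun x => (⟨x, X x⟩ : TangentBundle (𝓡 n) M)))
    (htan : ∀ y ∈ Metric.ball (0 : EuclideanSpace ℝ (Fin k)) 1,
      ∃ ξ, X (φ y) = mfderiv (𝓡 k) (𝓡 n) φ y ξ) (hy₁ : y₁ ∈ Metric.ball 0 1) :
    ∃ V' : Submodule ℝ (EuclideanSpace ℝ (Fin n)), IsCompl (LinearMap.range
      (fderiv ℝ (fun y => extChartAt (𝓡 n) (φ y₁) (φ y)) y₁).toLinearMap) V' ∧
      ∃ Θ : NormalCoordinates (fun y => extChartAt (𝓡 n) (φ y₁) (φ y)) V',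
        (y₁, 0) ∈ Θ.chart.source ∧ ∃ O e, φ y₁ ∈ O ∧
          IsDefiningOn X (φ '' Metric.closedBall 0 1) O e := by
  obtain ⟨V', hV'⟩ := Submodule.exists_isCompl (LinearMap.range
    (fderiv ℝ (fun y => extChartAt (𝓡 n) (φ y₁) (φ y)) y₁).toLinearMap)
  obtain ⟨Θ, hΘ, O, hO, he⟩ := exists_normalCoordinates_isDefiningOn hφ hX htan hy₁ hV'
    (H := innerSL ℝ) (fun w _ hw => real_inner_self_pos.2 hw)
  exact ⟨V', hV', Θ, hΘ, O, _, hO, he⟩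

/-- Let `V` be a subspace stable under `A` on which `H` is negative semidefinite. If `H` decreases
along `A`, then `H` is negative definite on `V`: a null vector `v` of `H` on `V` would be
`H`-orthogonal to `A v`. -/
theorem neg_of_nonpos_of_mem {E : Type*} [NormedAddCommGroup E] [NormedSpace ℝ E]
    {H : E →L[ℝ] E →L[ℝ] ℝ} (hsymm : ∀ v w, H v w = H w v) {A : E →L[ℝ] E}
    (hneg : ∀ v, v ≠ 0 → H (A v) v < 0) {V : Submodule ℝ E} (hA : ∀ v ∈ V, A v ∈ V)
    (hV : ∀ v ∈ V, H v v ≤ 0) {v : E} (hv : v ∈ V) (hv0 : v ≠ 0) : H v v < 0 := by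
  refine (hV v hv).lt_of_ne fun h => ?_
  have hb := hneg v hv0
  have h1 := hV (A v + ((1 - H (A v) (A v)) / (2 * H (A v) v)) • v)
    (V.add_mem (hA v hv) (V.smul_mem _ hv))
  simp only [map_add, map_smul, add_apply, smul_apply, smul_eq_mul, h, hsymm v (A v)] at h1
  have h2 : (1 - H (A v) (A v)) / (2 * H (A v) v) * H (A v) v = (1 - H (A v) (A v)) / 2 := by
    have := hb.ne
    field_simp
  linarith

/-- At the critical point, the local equation of the disc may be chosen nonincreasing along `X`: as
the tangent space of the disc is a negative definite subspace of maximal dimension for the Hessian,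
its orthogonal is positive definite, and the value of the Hessian on the normal coordinate decreases
along `X`. -/
theorem exists_isDefiningOn_of_isCritical [T2Space M] {f : M → ℝ} (hf : IsMorse n f)
    (hX : IsPseudoGradient X f) (hφ : IsDiscParam n k φ)
    (htan : ∀ y ∈ Metric.ball (0 : EuclideanSpace ℝ (Fin k)) 1,
      ∃ ξ, X (φ y) = mfderiv (𝓡 k) (𝓡 n) φ y ξ) (hy₁ : y₁ ∈ Metric.ball 0 1)
    (hp : IsCritical (n := n) f (φ y₁)) (hk : k = morseIndex n f (φ y₁))
    (hmax : ∀ y ∈ Metric.ball (0 : EuclideanSpace ℝ (Fin k)) 1, f (φ y) ≤ f (φ y₁)) :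
    ∃ O e, φ y₁ ∈ O ∧ IsDefiningOn X (φ '' Metric.closedBall 0 1) O e ∧
      ∀ᶠ x in 𝓝 (φ y₁), lieDeriv X e x ≤ 0 := by
  obtain ⟨hX0, hsymm, hneg⟩ := hX.linearization hf hp
  set ψ := extChartAt (𝓡 n) (φ y₁) with hψ
  have hs := mem_extChartAt_source (I := 𝓡 n) (φ y₁)
  have hz := mem_extChartAt_target (I := 𝓡 n) (φ y₁)
  have hφ₁ := hφ.contMDiffAt hy₁
  set V : Submodule ℝ (EuclideanSpace ℝ (Fin n)) :=
    LinearMap.range (fderiv ℝ (fun y => ψ (φ y)) y₁).toLinearMap with hV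
  have hnear : ∀ᶠ y in 𝓝 y₁, y ∈ Metric.ball (0 : EuclideanSpace ℝ (Fin k)) 1 ∧
      φ y ∈ ψ.source := by
    filter_upwards [Metric.isOpen_ball.mem_nhds hy₁,
      hφ₁.continuousAt.eventually_mem (extChartAt_source_mem_nhds (I := 𝓡 n) (φ y₁))] with y h h'
    exact ⟨h, h'⟩
  have hYtan : ∀ᶠ y in 𝓝 y₁, ∃ ξ, chartField X (φ y₁) (ψ (φ y)) =
      fderiv ℝ (fun y => ψ (φ y)) y ξ := by
    filter_upwards [hnear] with y hy
    exact exists_chartField_eq_fderiv (hφ.contMDiffAt hy.1) hy.2 (htan y hy.1)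
  have hYs : ContDiffAt ℝ ∞ (chartField X (φ y₁)) (ψ (φ y₁)) := contDiffAt_chartField hX.smooth hz
  have hY0 : chartField X (φ y₁) (ψ (φ y₁)) = 0 := (chartField_self (φ y₁)).trans hX0
  -- `f` is maximal at the critical point along the disc, so that its Hessian is nonpositive there
  have hnonpos : ∀ v ∈ V, hessian (n := n) f (φ y₁) v v ≤ 0 := by
    rintro v ⟨ξ, rfl⟩
    refine hessian_nonpos_of_isLocalMax (u := chartFun n f (φ y₁)) (σ := fun y => ψ (φ y))
      (contDiffAt_chartFun hz (hf.1 _)) (contDiffAt_extChartAt_comp hφ₁ hs)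
      ((isCritical_iff_fderiv_chartFun hs ((hf.1 _).mdifferentiableAt (by simp))).1 hp) ?_ ξ
    filter_upwards [hnear] with y hy
    rw [chartFun, chartFun, ψ.left_inv hy.2, ψ.left_inv hs]
    exact hmax y hy.1
  have hAV : ∀ v ∈ V, fderiv ℝ (chartField X (φ y₁)) (ψ (φ y₁)) v ∈ V := by
    obtain ⟨V₀, hV₀, Θ, hΘ, -⟩ :=
      exists_normalCoordinates_isDefiningOn_inner hφ hX.smooth htan hy₁
    rintro v ⟨ξ, rfl⟩
    exact Θ.fderiv_field_mem_range hΘ hV₀ hYs hY0 hYtan ξ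
  have hnegV : ∀ v ∈ V, v ≠ 0 → hessian (n := n) f (φ y₁) v v < 0 := fun v hv hv0 =>
    neg_of_nonpos_of_mem hsymm hneg hAV hnonpos hv hv0
  have hinj : Function.Injective (fderiv ℝ (fun y => ψ (φ y)) y₁) := by
    intro a b hab
    rw [fderiv_extChartAt_comp_self hφ₁, fderiv_extChartAt_comp_self hφ₁] at hab
    exact hφ.injective_mfderiv hy₁ hab
  have hfin : Module.finrank ℝ V = k := by
    rw [hV, LinearMap.finrank_range_of_inj hinj, finrank_euclideanSpace_fin]
  obtain ⟨V', hV', horth, hpos⟩ := exists_isCompl_posDef hsymm (hf.2 _ hp) (hfin.trans hk) hnegV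
  obtain ⟨Θ, hΘ, O, hO, he⟩ := exists_normalCoordinates_isDefiningOn hφ hX.smooth htan hy₁ hV' hpos
  refine ⟨O, _, hO, he, ?_⟩
  have hev := Θ.eventually_fderiv_sq_normal_nonpos hΘ hV' hYs hY0 hYtan hsymm hneg horth
  have hc : Tendsto ψ (𝓝 (φ y₁)) (𝓝 (ψ (φ y₁))) := continuousAt_extChartAt (φ y₁)
  filter_upwards [hc.eventually hev, extChartAt_source_mem_nhds (I := 𝓡 n) (φ y₁),
    eventually_lieDeriv_eq_chart (X := X) hs
      (he.smooth.contMDiffAt (he.isOpen.mem_nhds hO))] with x h1 h2 h3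
  rw [h3]
  refine le_of_eq_of_le ?_ h1
  congr 1
  refine Filter.EventuallyEq.fderiv_eq ?_
  filter_upwards [(isOpen_extChartAt_target (I := 𝓡 n) (φ y₁)).mem_nhds (ψ.map_source h2)] with z hz
  simp only [chartFun]
  rw [ψ.right_inv hz]

end DefiningFunctions

/-! ### Critical points on the disc -/

section Disc

variable {n : ℕ} {M : Type*} [TopologicalSpace M] [ChartedSpace (EuclideanSpace ℝ (Fin n)) M]
  [IsManifold (𝓡 n) ∞ M] {X : (x : M) → TangentSpace (𝓡 n) x} {k : ℕ}
  {φ : EuclideanSpace ℝ (Fin k) → M} {f : M → ℝ} {p : M}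

theorem le_of_mem_unstableManifold (hf : IsMorse n f) (hX : IsPseudoGradient X f) {x : M}
    (hx : x ∈ unstableManifold X p) : f x ≤ f p := by
  obtain ⟨γ, rfl, hγ, hlim⟩ := hx
  have hd : ∀ t ∈ Iic (0 : ℝ), HasDerivWithinAt (fun r => f (γ r)) (lieDeriv X f (γ t)) (Iic 0) t :=
    fun t ht => hasDerivWithinAt_comp_integralCurve hγ ht ((hf.1 _).mdifferentiableAt (by simp))
  have hanti : AntitoneOn (fun r => f (γ r)) (Iic 0) := by
    refine antitoneOn_of_hasDerivWithinAt_nonpos (f' := fun t => lieDeriv X f (γ t)) (convex_Iic 0)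
      (fun t ht => (hd t ht).continuousWithinAt) (fun t ht => ?_) (fun t _ => hX.lieDeriv_nonpos _)
    rw [interior_Iic] at ht ⊢
    exact (hd t (mem_Iic.2 (le_of_lt ht))).mono Iio_subset_Iic_self
  have hl : Tendsto (fun r => f (γ r)) atBot (𝓝 (f p)) :=
    ((hf.1.continuous.tendsto p).comp hlim)
  refine ge_of_tendsto hl ?_
  filter_upwards [eventually_le_atBot 0] with t ht
  exact hanti ht (mem_Iic.2 le_rfl) ht

theorem eq_of_isCritical_of_mem_unstableManifold [T2Space M] (hf : IsMorse n f)
    (hX : IsPseudoGradient X f) {x : M} (hx : x ∈ unstableManifold X p)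
    (hc : IsCritical (n := n) f x) : x = p := by
  obtain ⟨γ, h0, hγ, hlim⟩ := hx
  have h1 := fun t (ht : t ≤ 0) =>
    integralCurve_eq_of_zero hX.smooth hγ (hX.linearization hf hc).1 h0 ht
  have h2 : Tendsto γ atBot (𝓝 x) := by
    refine tendsto_const_nhds.congr' ?_
    filter_upwards [eventually_le_atBot 0] with t ht
    exact (h1 t ht).symm
  exact tendsto_nhds_unique h2 hlim

theorem isCritical_of_isLocalExtr_comp (hf : IsMorse n f) (hX : IsPseudoGradient X f)
    {y : EuclideanSpace ℝ (Fin k)} (hφ : MDifferentiableAt (𝓡 k) (𝓡 n) φ y)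
    (htan : ∃ ξ, X (φ y) = mfderiv (𝓡 k) (𝓡 n) φ y ξ)
    (hext : IsLocalExtr (fun y => f (φ y)) y) : IsCritical (n := n) f (φ y) := by
  by_contra hc
  obtain ⟨ξ, hξ⟩ := htan
  have h1 := mfderiv_comp y (((hf.1 (φ y)).mdifferentiableAt (by simp))) hφ
  have h2 : mfderiv (𝓡 k) 𝓘(ℝ, ℝ) (f ∘ φ) y = 0 := by
    rw [mfderiv_eq_fderiv]
    exact hext.fderiv_eq_zero
  rw [h2] at h1
  have h3 := hX.lyapunov _ hc
  rw [lieDeriv, hξ] at h3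
  have h4 := DFunLike.congr_fun h1 ξ
  exact h3.ne h4.symm

/-- A disc of dimension the index contained in the unstable manifold of `p`, with boundary in a
level set below `p`, contains `p` in its interior: `f` has an extremum on the interior of the disc,
which is a critical point of `f`, and `p` is the only one in its unstable manifold. -/
theorem exists_param_eq [T2Space M] (hf : IsMorse n f) (hX : IsPseudoGradient X f)
    (hφ : IsDiscParam n k φ)
    (htan : ∀ y ∈ Metric.ball (0 : EuclideanSpace ℝ (Fin k)) 1,
      ∃ ξ, X (φ y) = mfderiv (𝓡 k) (𝓡 n) φ y ξ)
    (hDW : φ '' Metric.closedBall 0 1 ⊆ unstableManifold X p) {a : ℝ}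
    (hDa : φ '' Metric.sphere 0 1 ⊆ f ⁻¹' {a}) :
    ∃ y ∈ Metric.ball (0 : EuclideanSpace ℝ (Fin k)) 1, φ y = p := by
  have hcont : ContinuousOn (fun y => f (φ y)) (Metric.closedBall 0 1) :=
    hf.1.continuous.comp_continuousOn hφ.smooth.continuousOn
  have hc := isCompact_closedBall (0 : EuclideanSpace ℝ (Fin k)) 1
  have h0 : (0 : EuclideanSpace ℝ (Fin k)) ∈ Metric.ball 0 1 := Metric.mem_ball_self one_pos
  have hne : (Metric.closedBall (0 : EuclideanSpace ℝ (Fin k)) 1).Nonempty :=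
    ⟨0, Metric.ball_subset_closedBall h0⟩
  obtain ⟨y, hy, hext⟩ : ∃ y ∈ Metric.ball (0 : EuclideanSpace ℝ (Fin k)) 1,
      IsExtrOn (fun y => f (φ y)) (Metric.closedBall 0 1) y := by
    obtain ⟨y₁, hy₁, hmax⟩ := hc.exists_isMaxOn hne hcont
    obtain ⟨y₂, hy₂, hmin⟩ := hc.exists_isMinOn hne hcont
    by_cases h₁ : y₁ ∈ Metric.ball (0 : EuclideanSpace ℝ (Fin k)) 1
    · exact ⟨y₁, h₁, hmax.isExtr⟩
    by_cases h₂ : y₂ ∈ Metric.ball (0 : EuclideanSpace ℝ (Fin k)) 1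
    · exact ⟨y₂, h₂, hmin.isExtr⟩
    -- both extrema are reached on the sphere only, so that `f ∘ φ` is constant
    have hs : ∀ y ∈ Metric.closedBall (0 : EuclideanSpace ℝ (Fin k)) 1,
        y ∉ Metric.ball (0 : EuclideanSpace ℝ (Fin k)) 1 → f (φ y) = a := fun y hy hyb =>
      hDa ⟨y, le_antisymm hy (not_lt.1 hyb), rfl⟩
    refine ⟨0, h0, Or.inl fun y hy => ?_⟩
    have e1 : f (φ y) ≤ f (φ y₁) := hmax hy
    have e2 : f (φ y₂) ≤ f (φ 0) := hmin (Metric.ball_subset_closedBall h0)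
    rw [hs y₁ hy₁ h₁] at e1
    rw [hs y₂ hy₂ h₂] at e2
    have e3 : f (φ 0) ≤ f (φ y₁) := hmax (Metric.ball_subset_closedBall h0)
    have e4 : f (φ y₂) ≤ f (φ y) := hmin hy
    rw [hs y₁ hy₁ h₁] at e3
    rw [hs y₂ hy₂ h₂] at e4
    change f (φ 0) ≤ f (φ y)
    linarith
  refine ⟨y, hy, eq_of_isCritical_of_mem_unstableManifold hf hX
    (hDW ⟨y, Metric.ball_subset_closedBall hy, rfl⟩) ?_⟩
  exact isCritical_of_isLocalExtr_comp hf hX ((hφ.contMDiffAt hy).mdifferentiableAt (by simp))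
    (htan y hy) (hext.isLocalExtr (mem_of_superset (Metric.isOpen_ball.mem_nhds hy)
      Metric.ball_subset_closedBall))

end Disc

/-! ### Derivatives along a field -/

section LieDerivRules

variable {n : ℕ} {M : Type*} [TopologicalSpace M] [ChartedSpace (EuclideanSpace ℝ (Fin n)) M]
  {X : (x : M) → TangentSpace (𝓡 n) x} {u v : M → ℝ} {x : M}

theorem lieDeriv_congr (h : u =ᶠ[𝓝 x] v) : lieDeriv X u x = lieDeriv X v x := by
  rw [lieDeriv, lieDeriv, h.mfderiv_eq]
  rfl

theorem lieDeriv_comp {h : ℝ → ℝ} {h' : ℝ} (hh : HasDerivAt h h' (u x))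
    (hu : MDifferentiableAt (𝓡 n) 𝓘(ℝ, ℝ) u x) :
    lieDeriv X (fun y => h (u y)) x = h' * lieDeriv X u x := by
  have h1 := HasMFDerivAt.comp x hh.hasFDerivAt.hasMFDerivAt hu.hasMFDerivAt
  refine (DFunLike.congr_fun h1.mfderiv (X x)).trans ?_
  exact mul_comm (lieDeriv X u x) h'

theorem lieDeriv_mul (hu : MDifferentiableAt (𝓡 n) 𝓘(ℝ, ℝ) u x)
    (hv : MDifferentiableAt (𝓡 n) 𝓘(ℝ, ℝ) v x) :
    lieDeriv X (fun y => u y * v y) x = u x * lieDeriv X v x + v x * lieDeriv X u x :=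
  DFunLike.congr_fun (hu.hasMFDerivAt.mul hv.hasMFDerivAt).mfderiv (X x)

theorem lieDeriv_sub_const_mul (hu : MDifferentiableAt (𝓡 n) 𝓘(ℝ, ℝ) u x)
    (hv : MDifferentiableAt (𝓡 n) 𝓘(ℝ, ℝ) v x) (t : ℝ) :
    lieDeriv X (fun y => u y - t * v y) x = lieDeriv X u x - t * lieDeriv X v x :=
  DFunLike.congr_fun (hu.hasMFDerivAt.sub (hv.hasMFDerivAt.const_smul t)).mfderiv (X x)

end LieDerivRules

/-! ### A global equation, nonincreasing along the pseudo-gradient -/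

section Globalization

variable {n : ℕ} {M : Type*} [TopologicalSpace M] [ChartedSpace (EuclideanSpace ℝ (Fin n)) M]
  {X : (x : M) → TangentSpace (𝓡 n) x} {D O : Set M} {e : M → ℝ}

theorem IsDefiningOn.mono {O' : Set M} (h : IsDefiningOn X D O e) (hO' : IsOpen O') (hs : O' ⊆ O) :
    IsDefiningOn X D O' e :=
  ⟨hO', h.smooth.mono hs, fun x hx => h.nonneg x (hs hx), fun x hx => h.eq_zero_iff x (hs hx),
    fun x hx => h.dominates x ⟨hs hx.1, hx.2⟩⟩

variable [IsManifold (𝓡 n) ∞ M]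

/-- Gluing of local equations of `D` along a closed part `K` of `D`, keeping a given one near
`p`. -/
theorem exists_global_equation [T2Space M] [SecondCountableTopology M] {K : Set M}
    (hK : IsClosed K) (hKD : K ⊆ D) {p : M} (hp : p ∈ K)
    (hloc : ∀ x ∈ K, ∃ O e, x ∈ O ∧ IsDefiningOn X D O e)
    (hpO : p ∈ O) (hO : IsDefiningOn X D O e) (hep : ∀ᶠ x in 𝓝 p, lieDeriv X e x ≤ 0) :
    ∃ g : M → ℝ, ContMDiff (𝓡 n) 𝓘(ℝ, ℝ) ∞ g ∧ (∀ x, 0 ≤ g x) ∧ (∀ x ∈ D, g x = 0) ∧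
      (∀ x₀ ∈ K, ∀ᶠ x in 𝓝 x₀, g x = 0 → x ∈ D) ∧
      (∀ x₀ ∈ K, ∃ C : ℝ, ∀ᶠ x in 𝓝 x₀, |lieDeriv X g x| ≤ C * g x) ∧
      ∀ᶠ x in 𝓝 p, lieDeriv X g x ≤ 0 := by
  have : LocallyCompactSpace M := Manifold.locallyCompact_of_finiteDimensional (𝓡 n)
  -- away from `p`, the local equations are restricted to open sets avoiding `p`
  have hloc' : ∀ x : K, ∃ O' e', (x : M) ∈ O' ∧ IsDefiningOn X D O' e' ∧
      ((x : M) = p → e' = e ∧ O' = O) ∧ ((x : M) ≠ p → p ∉ O') := by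
    intro x
    by_cases hx : (x : M) = p
    · exact ⟨O, e, hx ▸ hpO, hO, fun _ => ⟨rfl, rfl⟩, fun h => absurd hx h⟩
    · obtain ⟨O', e', hxO, h⟩ := hloc x x.2
      exact ⟨O' ∩ {p}ᶜ, e', ⟨hxO, hx⟩, h.mono (h.isOpen.inter isOpen_compl_singleton)
        inter_subset_left, fun h => absurd h hx, fun _ h => h.2 rfl⟩
  choose O' e' hxO hdef heq hne using hloc'
  obtain ⟨Q, hQp, hQc, hQO⟩ := exists_mem_nhds_isClosed_subset (hO.isOpen.mem_nhds hpO)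
  obtain ⟨χ, hχ⟩ := SmoothPartitionOfUnity.exists_isSubordinate (𝓡 n) (hK.union hQc) O'
    (fun x => (hdef x).isOpen) (by
      rintro x (hx | hx)
      · exact mem_iUnion.2 ⟨⟨x, hx⟩, hxO ⟨x, hx⟩⟩
      · refine mem_iUnion.2 ⟨⟨p, hp⟩, ?_⟩
        rw [(heq ⟨p, hp⟩ rfl).2]
        exact hQO hx)
  have hO'mem : ∀ i x, χ i x ≠ 0 → x ∈ O' i := fun i x h =>
    hχ i (subset_tsupport _ h)
  have hnn : ∀ i x, 0 ≤ χ i x * e' i x := by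
    intro i x
    by_cases h : χ i x = 0
    · simp [h]
    · exact mul_nonneg (χ.nonneg i x) ((hdef i).nonneg x (hO'mem i x h))
  have hfin : ∀ x, (Function.support fun i => χ i x * e' i x).Finite := fun x =>
    (χ.locallyFinite.point_finite x).subset fun i hi h => hi (by
      change χ i x * e' i x = 0
      rw [h, zero_mul])
  set g : M → ℝ := fun x => ∑ᶠ i, χ i x * e' i x with hg
  have hle : ∀ i x, χ i x * e' i x ≤ g x := fun i x =>
    single_le_finsum i (hfin x) fun j => hnn j x
  have hgs : ContMDiff (𝓡 n) 𝓘(ℝ, ℝ) ∞ g := χ.contMDiff_finsum_smul (n := ⊤) fun i x hx =>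
    (hdef i).smooth.contMDiffAt ((hdef i).isOpen.mem_nhds (hχ i hx))
  have hg0 : ∀ x, 0 ≤ g x := fun x => finsum_nonneg fun i => hnn i x
  have hgD : ∀ x ∈ D, g x = 0 := by
    intro x hx
    rw [hg]
    refine finsum_eq_zero_of_forall_eq_zero fun i => ?_
    by_cases h : χ i x = 0
    · rw [h, zero_mul]
    · rw [((hdef i).eq_zero_iff x (hO'mem i x h)).2 hx, mul_zero]
  have hpos : ∀ x₀ ∈ K, ∃ i, 0 < χ i x₀ ∧ ∀ᶠ x in 𝓝 x₀, χ i x₀ / 2 < χ i x := by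
    intro x₀ hx₀
    obtain ⟨i, hi⟩ := χ.exists_pos_of_mem (Or.inl hx₀)
    exact ⟨i, hi, (χ i).contMDiff.continuous.continuousAt.eventually_const_lt (half_lt_self hi)⟩
  refine ⟨g, hgs, hg0, hgD, ?_, ?_, ?_⟩
  · intro x₀ hx₀
    obtain ⟨i, hi, hev⟩ := hpos x₀ hx₀
    filter_upwards [hev] with x hx h
    have hχx : 0 < χ i x := (half_pos hi).trans hx
    have h1 := hO'mem i x hχx.ne'
    have h2 := hle i x
    rw [h] at h2
    exact ((hdef i).eq_zero_iff x h1).1 (le_antisymm (nonpos_of_mul_nonpos_right h2 hχx)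
      ((hdef i).nonneg x h1))
  · intro x₀ hx₀
    obtain ⟨i, hi, hev⟩ := hpos x₀ hx₀
    obtain ⟨C, hC⟩ := (hdef i).dominates x₀ ⟨hO'mem i x₀ hi.ne', hKD hx₀⟩ g hgs hg0 hgD
    refine ⟨|C| / (χ i x₀ / 2), ?_⟩
    filter_upwards [hev, hC] with x hx h
    have h1 := (hdef i).nonneg x (hO'mem i x ((half_pos hi).trans hx).ne')
    calc |lieDeriv X g x| ≤ |C| * e' i x := h.trans (by gcongr; exact le_abs_self C)
      _ = |C| / (χ i x₀ / 2) * (χ i x₀ / 2 * e' i x) := by field_simp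
      _ ≤ |C| / (χ i x₀ / 2) * g x := by
        gcongr
        exact (mul_le_mul_of_nonneg_right hx.le h1).trans (hle i x)
  · have hone : ∀ᶠ x in 𝓝 p, g x = e x := by
      filter_upwards [χ.eventually_finsupport_subset p, hQp] with x hx hxQ
      have hz : ∀ i : K, (i : M) ≠ p → χ i x = 0 := by
        intro i hi
        by_contra h
        exact hne i hi (hχ i ((χ.mem_fintsupport_iff p i).1 (hx ((χ.mem_finsupport x).2 h))))
      have hz' : ∀ i : K, i ≠ ⟨p, hp⟩ → χ i x = 0 := fun i hi =>
        hz i fun h => hi (Subtype.ext h)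
      have h1 := χ.sum_eq_one (x := x) (Or.inr hxQ)
      rw [finsum_eq_single _ _ hz'] at h1
      have h2 : g x = χ ⟨p, hp⟩ x * e' ⟨p, hp⟩ x :=
        finsum_eq_single _ _ fun i hi => by rw [hz' i hi, zero_mul]
      rw [h2, h1, one_mul, (heq ⟨p, hp⟩ rfl).1]
    filter_upwards [hone.eventually_nhds, hep] with x h1 h2
    rwa [lieDeriv_congr h1]

/-- The equation `g` is made nonincreasing along the pseudo-gradient `X` by multiplying it by
`exp (l * f)` with `l` large. -/
theorem exists_nonincreasing_equation {f g : M → ℝ} (hf : IsMorse n f) (hX : IsPseudoGradient X f)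
    {K : Set M} (hK : IsCompact K) {p : M} (hcrit : ∀ x ∈ K, IsCritical (n := n) f x → x = p)
    (hgs : ContMDiff (𝓡 n) 𝓘(ℝ, ℝ) ∞ g) (hg0 : ∀ x, 0 ≤ g x)
    (hdom : ∀ x₀ ∈ K, ∃ C : ℝ, ∀ᶠ x in 𝓝 x₀, |lieDeriv X g x| ≤ C * g x)
    (hgp : ∀ᶠ x in 𝓝 p, lieDeriv X g x ≤ 0) :
    ∃ v : M → ℝ, ContMDiff (𝓡 n) 𝓘(ℝ, ℝ) ∞ v ∧ (∀ x, 0 ≤ v x) ∧ (∀ x, v x = 0 ↔ g x = 0) ∧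
      ∃ W, IsOpen W ∧ K ⊆ W ∧ ∀ x ∈ W, lieDeriv X v x ≤ 0 := by
  -- where `X · f < 0`, the term `l * g * (X · f)` dominates `X · g`
  have hmain : ∃ l₀ : ℝ, ∃ W, IsOpen W ∧ K ⊆ W ∧ ∀ l ≥ l₀, ∀ x ∈ W,
      lieDeriv X g x + l * (g x * lieDeriv X f x) ≤ 0 := by
    refine hK.induction_on (p := fun K => ∃ l₀ : ℝ, ∃ W, IsOpen W ∧ K ⊆ W ∧ ∀ l ≥ l₀, ∀ x ∈ W,
      lieDeriv X g x + l * (g x * lieDeriv X f x) ≤ 0)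
      ⟨0, ∅, isOpen_empty, subset_rfl, fun _ _ x hx => absurd hx (notMem_empty x)⟩ ?_ ?_ ?_
    · rintro s t hst ⟨l, W, hW, htW, h⟩
      exact ⟨l, W, hW, hst.trans htW, h⟩
    · rintro s t ⟨l, W, hW, hsW, h⟩ ⟨l', W', hW', htW', h'⟩
      refine ⟨max l l', W ∪ W', hW.union hW', union_subset_union hsW htW', fun m hm x hx => ?_⟩
      rcases hx with hx | hx
      · exact h m ((le_max_left _ _).trans hm) x hx
      · exact h' m ((le_max_right _ _).trans hm) x hx
    · intro x₀ hx₀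
      suffices h : ∃ l₀ : ℝ, ∀ᶠ x in 𝓝 x₀, ∀ l ≥ l₀,
          lieDeriv X g x + l * (g x * lieDeriv X f x) ≤ 0 by
        obtain ⟨l₀, h⟩ := h
        obtain ⟨W, hWs, hW, hxW⟩ := mem_nhds_iff.1 h
        exact ⟨W, mem_nhdsWithin_of_mem_nhds (hW.mem_nhds hxW), l₀, W, hW, subset_rfl,
          fun l hl x hx => hWs hx l hl⟩
      by_cases hx : x₀ = p
      · refine ⟨0, ?_⟩
        rw [hx]
        filter_upwards [hgp] with x h l hl
        have := mul_nonneg_of_nonpos_of_nonpos (neg_nonpos.2 hl)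
          (mul_nonpos_of_nonneg_of_nonpos (hg0 x) (hX.lieDeriv_nonpos x))
        linarith
      · have hneg := hX.lyapunov x₀ fun h => hx (hcrit x₀ hx₀ h)
        set m := -(lieDeriv X f x₀) / 2 with hm
        have hm0 : 0 < m := by rw [hm]; linarith
        obtain ⟨C, hC⟩ := hdom x₀ hx₀
        have hev : ∀ᶠ x in 𝓝 x₀, lieDeriv X f x < -m :=
          (contMDiffAt_lieDeriv hX.smooth (hf.1 x₀)).continuousAt.eventually_lt_const (by
            rw [hm]; linarith)
        refine ⟨|C| / m, ?_⟩
        filter_upwards [hC, hev] with x h1 h2 l hl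
        have hl' : |C| ≤ l * m := (div_le_iff₀ hm0).1 hl
        have h3 : |lieDeriv X g x| ≤ l * m * g x :=
          h1.trans (mul_le_mul_of_nonneg_right ((le_abs_self C).trans hl') (hg0 x))
        have hl0 : 0 ≤ l := (by positivity : 0 ≤ |C| / m).trans hl
        have h4 : l * (g x * lieDeriv X f x) ≤ l * (g x * -m) := by
          have := hg0 x
          gcongr
        have h5 := (le_abs_self _).trans h3
        linarith
  obtain ⟨l, W, hW, hKW, h⟩ := hmain
  refine ⟨fun x => Real.exp (l * f x) * g x, ?_, fun x => mul_nonneg (Real.exp_pos _).le (hg0 x),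
    fun x => ?_, W, hW, hKW, fun x hx => ?_⟩
  · have h1 : ContDiff ℝ ∞ fun s : ℝ => Real.exp (l * s) := by fun_prop
    exact (h1.contMDiff.comp hf.1).mul hgs
  · simp [Real.exp_ne_zero]
  · have hfd : MDifferentiableAt (𝓡 n) 𝓘(ℝ, ℝ) f x := (hf.1 x).mdifferentiableAt (by simp)
    have hd : HasDerivAt (fun s : ℝ => Real.exp (l * s)) (Real.exp (l * f x) * l) (f x) := by
      have := (((hasDerivAt_id (f x)).const_mul l)).exp
      simpa using this
    have h1 : MDifferentiableAt (𝓡 n) 𝓘(ℝ, ℝ) (fun y => Real.exp (l * f y)) x :=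
      MDifferentiableAt.comp (g := fun s : ℝ => Real.exp (l * s)) x
        hd.differentiableAt.mdifferentiableAt hfd
    rw [lieDeriv_mul h1 ((hgs x).mdifferentiableAt (by simp)), lieDeriv_comp hd hfd]
    have h2 := mul_nonpos_of_nonneg_of_nonpos (Real.exp_pos (l * f x)).le (h l le_rfl x hx)
    linarith

end Globalization

/-! ### Step and cutoff functions -/

section Profiles

/-- A smooth step from `0` to `c` over an interval of length more than `c`, with slope
less than `1`. -/
theorem exists_smooth_step_slope_lt_one {α β c : ℝ} (hc : 0 ≤ c) (hαβ : c < β - α) :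
    ∃ P P' : ℝ → ℝ, ContDiff ℝ ∞ P ∧ (∀ s, HasDerivAt P (P' s) s) ∧ (∀ s, 0 ≤ P' s) ∧
      (∀ s, P' s < 1) ∧ (∀ s, 0 ≤ P s) ∧ (∀ s ≤ α, P s = 0) ∧ ∀ s ≥ β, P s = c := by
  -- the step is the integral of a multiple of `χ`; the inner radius makes the integral of `χ`
  -- larger than `c`, so that this multiple is less than `1`
  let χ : ContDiffBump ((α + β) / 2) := ⟨(c + (β - α)) / 4, (β - α) / 2, by linarith, by linarith⟩
  set J : ℝ := ∫ x, χ x with hJ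
  have hcJ : c < J := by
    have h := χ.measure_closedBall_le_integral MeasureTheory.volume
    rw [MeasureTheory.measureReal_def, Real.volume_closedBall, ENNReal.toReal_ofReal (by
      have := χ.rIn_pos; linarith)] at h
    have h2 : 2 * χ.rIn = (c + (β - α)) / 2 := by simp only [χ]; ring
    linarith
  have hJ0 : 0 < J := hc.trans_lt hcJ
  set P : ℝ → ℝ := fun s => c / J * ∫ x in α..s, χ x with hP
  have hd : ∀ s, HasDerivAt P (c / J * χ s) s := fun s =>
    (χ.continuous.integral_hasStrictDerivAt α s).hasDerivAt.const_mul _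
  have h0 : ∀ s, 0 ≤ c / J * χ s := fun s => mul_nonneg (by positivity) χ.nonneg
  have hsupp : Function.support χ ⊆ Ioo α β := by
    rw [χ.support_eq, Real.ball_eq_Ioo]
    apply Ioo_subset_Ioo <;> simp only [χ] <;> linarith
  have hleft : ∀ s ≤ α, P s = 0 := by
    intro s hs
    have : ∫ x in α..s, χ x = ∫ x in α..s, (0 : ℝ) := by
      refine intervalIntegral.integral_congr fun x hx => ?_
      rw [uIcc_of_ge hs] at hx
      by_contra h
      exact absurd (hsupp h).1 (not_lt.2 hx.2)
    simp [hP, this]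
  refine ⟨P, fun s => c / J * χ s, ?_, hd, h0, fun s => ?_, fun s => ?_, hleft, fun s hs => ?_⟩
  · rw [contDiff_infty_iff_deriv]
    refine ⟨fun s => (hd s).differentiableAt, ?_⟩
    rw [show deriv P = fun s => c / J * χ s from funext fun s => (hd s).deriv]
    exact contDiff_const.mul χ.contDiff
  · calc c / J * χ s ≤ c / J * 1 := by gcongr; exact χ.le_one
      _ < 1 := by rwa [mul_one, div_lt_one hJ0]
  · have hmono : Monotone P := monotone_of_hasDerivAt_nonneg hd h0
    rw [← hleft (min s α) (min_le_right _ _)]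
    exact hmono (min_le_left _ _)
  · have h1 : ∫ x in α..s, χ x = J :=
      intervalIntegral.integral_eq_integral_of_support_subset
        (hsupp.trans fun x hx => ⟨hx.1, hx.2.le.trans hs⟩)
    simp only [hP, h1]
    field_simp

/-- A smooth nonincreasing cutoff function. -/
theorem exists_smooth_cutoff {δ : ℝ} (hδ : 0 < δ) :
    ∃ κ κ' : ℝ → ℝ, ContDiff ℝ ∞ κ ∧ (∀ s, HasDerivAt κ (κ' s) s) ∧ (∀ s, κ' s ≤ 0) ∧
      (∀ s, 0 ≤ κ s) ∧ (∀ s, κ s ≤ 1) ∧ (∀ s < δ, κ s = 1) ∧ ∀ s ≥ 2 * δ, κ s = 0 := by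
  set κ : ℝ → ℝ := fun s => 1 - Real.smoothTransition (s / δ - 1) with hκ
  have hsm : ContDiff ℝ ∞ κ := by
    have h : ContDiff ℝ ∞ fun s : ℝ => s / δ - 1 := by fun_prop
    exact contDiff_const.sub ((Real.smoothTransition.contDiff (n := ⊤)).comp h)
  have hanti : Antitone κ := by
    intro s t hst
    have : Real.smoothTransition (s / δ - 1) ≤ Real.smoothTransition (t / δ - 1) :=
      Real.smoothTransition.monotone (by gcongr)
    simp only [hκ]
    linarith
  refine ⟨κ, deriv κ, hsm, fun s => (hsm.differentiable (by simp) s).hasDerivAt,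
    fun s => hanti.deriv_nonpos, fun s => ?_, fun s => ?_, fun s hs => ?_, fun s hs => ?_⟩
  · have := Real.smoothTransition.le_one (s / δ - 1)
    simp only [hκ]; linarith
  · have := Real.smoothTransition.nonneg (s / δ - 1)
    simp only [hκ]; linarith
  · simp only [hκ]
    rw [Real.smoothTransition.zero_of_nonpos, sub_zero]
    rw [sub_nonpos, div_le_one hδ]; exact hs.le
  · simp only [hκ]
    rw [Real.smoothTransition.one_of_one_le, sub_self]
    rw [le_sub_iff_add_le, le_div_iff₀ hδ]; linarith

end Profiles

/-! ### Perturbations of a Morse function -/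

section Deformation

variable {n : ℕ} {M : Type*} [TopologicalSpace M] [ChartedSpace (EuclideanSpace ℝ (Fin n)) M]
  {X : (x : M) → TangentSpace (𝓡 n) x} {f : M → ℝ} {p : M}

theorem hessian_congr {u v : M → ℝ} (h : u =ᶠ[𝓝 p] v) :
    hessian (n := n) u p = hessian (n := n) v p := by
  have hc : Tendsto (extChartAt (𝓡 n) p).symm (𝓝 (extChartAt (𝓡 n) p p)) (𝓝 p) := by
    have := continuousAt_extChartAt_symm (I := 𝓡 n) p
    rwa [ContinuousAt, extChartAt_to_inv] at this
  have h2 : u ∘ (extChartAt (𝓡 n) p).symm =ᶠ[𝓝 (extChartAt (𝓡 n) p p)]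
      v ∘ (extChartAt (𝓡 n) p).symm := hc.eventually h
  exact h2.fderiv.fderiv_eq

theorem hessian_sub_const (u : M → ℝ) (r : ℝ) :
    hessian (n := n) (fun x => u x - r) p = hessian (n := n) u p := by
  have h : fderiv ℝ ((fun x => u x - r) ∘ (extChartAt (𝓡 n) p).symm) =
      fderiv ℝ (u ∘ (extChartAt (𝓡 n) p).symm) := by
    ext1 z
    exact fderiv_sub_const r
  rw [hessian, hessian, h]

theorem mfderiv_sub_const {u : M → ℝ} (hu : MDifferentiableAt (𝓡 n) 𝓘(ℝ, ℝ) u p) (r : ℝ) :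
    (mfderiv (𝓡 n) 𝓘(ℝ, ℝ) (fun x => u x - r) p : EuclideanSpace ℝ (Fin n) →L[ℝ] ℝ) =
      mfderiv (𝓡 n) 𝓘(ℝ, ℝ) u p := by
  have h := (hu.hasMFDerivAt.sub (hasMFDerivAt_const r p)).mfderiv
  exact h.trans (sub_zero _)

variable [IsManifold (𝓡 n) ∞ M]

/-- Subtracting from `f` a multiple of a function which is constant near every critical point of
`f`, and whose derivative along `X` exceeds that of `f` elsewhere, changes neither the critical
points nor their Hessians. -/
theorem isMorse_and_isPseudoGradient_sub (hf : IsMorse n f) (hX : IsPseudoGradient X f) {ρ : M → ℝ}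
    (hρ : ContMDiff (𝓡 n) 𝓘(ℝ, ℝ) ∞ ρ)
    (hconst : ∀ x, IsCritical (n := n) f x → ∃ r, ρ =ᶠ[𝓝 x] fun _ => r)
    (hlie : ∀ x, ¬ IsCritical (n := n) f x → lieDeriv X f x < lieDeriv X ρ x)
    {t : ℝ} (ht : t ∈ Icc (0 : ℝ) 1) :
    IsMorse n (fun x => f x - t * ρ x) ∧ IsPseudoGradient X (fun x => f x - t * ρ x) := by
  have hfd : ∀ x, MDifferentiableAt (𝓡 n) 𝓘(ℝ, ℝ) f x := fun x =>
    (hf.1 x).mdifferentiableAt (by simp)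
  have hneg : ∀ x, ¬ IsCritical (n := n) f x → lieDeriv X (fun x => f x - t * ρ x) x < 0 := by
    intro x hx
    rw [lieDeriv_sub_const_mul (hfd x) ((hρ x).mdifferentiableAt (by simp))]
    have h1 := hX.lyapunov x hx
    have h2 := hlie x hx
    rcases le_total 0 (lieDeriv X ρ x) with h3 | h3
    · have := mul_nonneg ht.1 h3
      linarith
    · have := mul_le_mul_of_nonpos_right ht.2 h3
      linarith
  have hloc : ∀ x, IsCritical (n := n) f x → ∃ r, (fun y => f y - t * ρ y) =ᶠ[𝓝 x]
      fun y => f y - r := by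
    intro x hx
    obtain ⟨r, hr⟩ := hconst x hx
    exact ⟨t * r, hr.mono fun y hy => by simp only [hy]⟩
  have hcrit : ∀ x, IsCritical (n := n) (fun y => f y - t * ρ y) x → IsCritical (n := n) f x := by
    intro x hx
    by_contra h
    have h1 := hneg x h
    rw [lieDeriv, show mfderiv (𝓡 n) 𝓘(ℝ, ℝ) (fun y => f y - t * ρ y) x = 0 from hx] at h1
    exact lt_irrefl (0 : ℝ) h1
  refine ⟨⟨hf.1.sub (contMDiff_const.mul hρ), fun x hx => ?_⟩, ⟨hX.smooth, fun x hx => ?_,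
    fun x hx => ?_⟩⟩
  · obtain ⟨r, hr⟩ := hloc x (hcrit x hx)
    rw [hessian_congr hr, hessian_sub_const]
    exact hf.2 x (hcrit x hx)
  · refine hneg x fun h => hx ?_
    obtain ⟨r, hr⟩ := hloc x h
    exact (hr.mfderiv_eq.trans (mfderiv_sub_const (hfd x) r)).trans h
  · obtain ⟨r, hr⟩ := hloc x (hcrit x hx)
    have h1 : lieDeriv X (fun y => f y - t * ρ y) =ᶠ[𝓝 x] lieDeriv X f := by
      filter_upwards [hr.eventually_nhds] with y hy
      rw [lieDeriv_congr hy]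
      exact DFunLike.congr_fun (mfderiv_sub_const (hfd y) r) (X y)
    rw [hessian_congr h1]
    exact hX.nondegenerate x (hcrit x hx)

/-- The critical points of a Morse function are isolated. -/
theorem IsMorse.eventually_eq_of_isCritical (hf : IsMorse n f) (hp : IsCritical (n := n) f p) :
    ∀ᶠ x in 𝓝 p, IsCritical (n := n) f x → x = p := by
  set ψ := extChartAt (𝓡 n) p with hψ
  have hs := mem_extChartAt_source (I := 𝓡 n) p
  have hz := mem_extChartAt_target (I := 𝓡 n) p
  have hu : ContDiffAt ℝ ∞ (chartFun n f p) (ψ p) := contDiffAt_chartFun hz (hf.1 _)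
  have hd : HasFDerivAt (fderiv ℝ (chartFun n f p)) (hessian (n := n) f p) (ψ p) :=
    ((hu.fderiv_right (m := ∞) (by simp)).differentiableAt (by simp)).hasFDerivAt
  have hker : LinearMap.ker (hessian (n := n) f p).toLinearMap = ⊥ := by
    rw [LinearMap.ker_eq_bot']
    intro v hv
    refine hf.2 p hp v fun w => ?_
    have : hessian (n := n) f p v = 0 := hv
    rw [this]; rfl
  obtain ⟨C, -, hC⟩ := LinearMap.exists_antilipschitzWith _ hker
  have hne := hd.eventually_ne (c := 0) ⟨C, hC⟩
  rw [eventually_nhdsWithin_iff] at hne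
  have hc : Tendsto ψ (𝓝 p) (𝓝 (ψ p)) := continuousAt_extChartAt p
  filter_upwards [hc.eventually hne, extChartAt_source_mem_nhds (I := 𝓡 n) p] with x h1 h2 h3
  by_contra hxp
  exact h1 (fun h => hxp (ψ.injOn h2 hs h))
    ((isCritical_iff_fderiv_chartFun h2 ((hf.1 x).mdifferentiableAt (by simp))).1 h3)

end Deformation

/-! ### The deformation -/

section DeformationFunction

variable {n : ℕ} {M : Type*} [TopologicalSpace M] [ChartedSpace (EuclideanSpace ℝ (Fin n)) M]
  [IsManifold (𝓡 n) ∞ M] {X : (x : M) → TangentSpace (𝓡 n) x} {f : M → ℝ} {p : M}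

/-- The function subtracted from `f`. It is a product `P (f x) * κ (v x)` cut off outside a compact
neighborhood `N` of the part of `D` above the level `b`; on the frontier of `N`, either `f` is small
and the first factor vanishes, or `v` is large and the second factor vanishes. -/
theorem exists_deformation_function [T2Space M] [SecondCountableTopology M] (hf : IsMorse n f)
    (hX : IsPseudoGradient X f) (hp : IsCritical (n := n) f p) {D : Set M} (hD : IsCompact D)
    (hpD : p ∈ D) (hcrit : ∀ x ∈ D, IsCritical (n := n) f x → x = p) {b c : ℝ} (hc : 0 ≤ c)
    (hcb : c < f p - b) {v : M → ℝ} (hvs : ContMDiff (𝓡 n) 𝓘(ℝ, ℝ) ∞ v)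
    (hv0 : ∀ x, 0 ≤ v x) (hvD : ∀ x ∈ D, v x = 0) {W : Set M} (hW : IsOpen W)
    (hKW : D ∩ {x | b ≤ f x} ⊆ W) (hWD : ∀ x ∈ W, v x = 0 → x ∈ D)
    (hWX : ∀ x ∈ W, lieDeriv X v x ≤ 0) {U : Set M} (hU : IsOpen U) (hDU : D ⊆ U) :
    ∃ ρ : M → ℝ, ContMDiff (𝓡 n) 𝓘(ℝ, ℝ) ∞ ρ ∧ ρ p = c ∧ tsupport ρ ⊆ U ∧
      (∀ x, IsCritical (n := n) f x → ∃ r, ρ =ᶠ[𝓝 x] fun _ => r) ∧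
      ∀ x, ¬ IsCritical (n := n) f x → lieDeriv X f x < lieDeriv X ρ x := by
  have : LocallyCompactSpace M := Manifold.locallyCompact_of_finiteDimensional (𝓡 n)
  have hfc : Continuous f := hf.1.continuous
  have hvc : Continuous v := hvs.continuous
  have hfd : ∀ x, MDifferentiableAt (𝓡 n) 𝓘(ℝ, ℝ) f x := fun x =>
    (hf.1 x).mdifferentiableAt (by simp)
  have hvd : ∀ x, MDifferentiableAt (𝓡 n) 𝓘(ℝ, ℝ) v x := fun x =>
    (hvs x).mdifferentiableAt (by simp)
  set K : Set M := D ∩ {x | b ≤ f x} with hK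
  have hKc : IsCompact K := hD.inter_right (isClosed_le continuous_const hfc)
  have hbp : b < f p := by linarith
  have hpK : p ∈ K := ⟨hpD, hbp.le⟩
  -- a neighborhood of `K` where `p` is the only critical point
  set T : Set M := interior {x | IsCritical (n := n) f x → x = p} with hT
  have hKT : K ⊆ T := by
    intro x hx
    rw [hT, mem_interior_iff_mem_nhds]
    by_cases hxp : x = p
    · rw [hxp]
      exact hf.eventually_eq_of_isCritical hp
    · have h1 := hX.lyapunov x fun h => hxp (hcrit x hx.1 h)
      filter_upwards [(contMDiffAt_lieDeriv hX.smooth (hf.1 x)).continuousAt.eventually_lt_const h1]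
        with y hy hyc
      rw [lieDeriv, show mfderiv (𝓡 n) 𝓘(ℝ, ℝ) f y = 0 from hyc] at hy
      exact absurd hy (lt_irrefl (0 : ℝ))
  obtain ⟨N, hN, hKN, hNW⟩ := exists_compact_between hKc ((hW.inter hU).inter isOpen_interior)
    (fun x hx => ⟨⟨hKW hx, hDU hx.1⟩, hKT hx⟩)
  obtain ⟨δ, hδ, hvδ⟩ : ∃ δ, 0 < δ ∧ ∀ x ∈ frontier N ∩ {x | b ≤ f x}, δ ≤ v x := by
    refine ((hN.of_isClosed_subset isClosed_frontier hN.isClosed.frontier_subset).inter_right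
      (isClosed_le continuous_const hfc)).exists_forall_le' hvc.continuousOn fun x hx => ?_
    refine (hv0 x).lt_of_ne' fun h => ?_
    have hxN := hN.isClosed.frontier_subset hx.1
    exact hx.1.2 (hKN ⟨hWD x (hNW hxN).1.1 h, hx.2⟩)
  -- the levels leave a margin at both ends, where the step function is constant
  set μ : ℝ := (f p - b - c) / 3 with hμ
  have hμ0 : 0 < μ := by rw [hμ]; linarith
  obtain ⟨P, P', hPs, hPd, hP'0, hP'1, hP0, hPl, hPr⟩ :=
    exists_smooth_step_slope_lt_one (α := b + μ) (β := f p - μ) hc (by rw [hμ]; linarith)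
  obtain ⟨κ, κ', hκs, hκd, hκ'0, hκ0, hκ1, hκl, hκr⟩ := exists_smooth_cutoff (δ := δ / 3)
    (by positivity)
  set g : M → ℝ := fun x => P (f x) * κ (v x) with hg
  have hgs : ContMDiff (𝓡 n) 𝓘(ℝ, ℝ) ∞ g :=
    (hPs.contMDiff.comp hf.1).mul (hκs.contMDiff.comp hvs)
  set ρ : M → ℝ := N.indicator g with hρ
  have hin : ∀ x ∈ interior N, ρ =ᶠ[𝓝 x] g := by
    intro x hx
    filter_upwards [isOpen_interior.mem_nhds hx] with y hy
    exact indicator_of_mem (interior_subset hy) g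
  have hout : ∀ x, x ∉ interior N → ρ =ᶠ[𝓝 x] fun _ => 0 := by
    intro x hx
    by_cases hxN : x ∈ N
    · have hgx : ∀ᶠ y in 𝓝 x, g y = 0 := by
        rcases lt_or_ge (f x) b with h | h
        · filter_upwards [hfc.continuousAt.eventually_lt_const
            (h.trans (lt_add_of_pos_right b hμ0))] with y hy
          simp only [hg, hPl _ hy.le, zero_mul]
        · have h1 := hvδ x ⟨⟨subset_closure hxN, hx⟩, h⟩
          filter_upwards [hvc.continuousAt.eventually_const_lt
            (show 2 * (δ / 3) < v x by linarith)] with y hy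
          simp only [hg, hκr _ hy.le, mul_zero]
      filter_upwards [hgx] with y hy
      by_cases hyN : y ∈ N
      · rw [hρ, indicator_of_mem hyN, hy]
      · exact indicator_of_notMem hyN g
    · filter_upwards [hN.isClosed.isOpen_compl.mem_nhds hxN] with y hy
      exact indicator_of_notMem hy g
  have hpc : ρ =ᶠ[𝓝 p] fun _ => c := by
    filter_upwards [hin p (hKN hpK), hfc.continuousAt.eventually_const_lt (sub_lt_self (f p) hμ0),
      hvc.continuousAt.eventually_lt_const (show v p < δ / 3 by rw [hvD p hpD]; positivity)]
      with y h1 h2 h3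
    rw [h1]
    simp only [hg, hPr _ h2.le, hκl _ h3, mul_one]
  refine ⟨ρ, fun x => ?_, hpc.self_of_nhds, ?_, fun x hx => ?_, fun x hx => ?_⟩
  · by_cases hx : x ∈ interior N
    · exact (hgs x).congr_of_eventuallyEq (hin x hx)
    · exact contMDiffAt_const.congr_of_eventuallyEq (hout x hx)
  · exact (closure_minimal support_indicator_subset hN.isClosed).trans fun x hx => (hNW hx).1.2
  · by_cases hxN : x ∈ interior N
    · have h1 : x = p := interior_subset (hNW (interior_subset hxN)).2 hx
      rw [h1]
      exact ⟨c, hpc⟩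
    · exact ⟨0, hout x hxN⟩
  · have hneg := hX.lyapunov x hx
    by_cases hxN : x ∈ interior N
    · rw [lieDeriv_congr (hin x hxN)]
      have hd1 : MDifferentiableAt (𝓡 n) 𝓘(ℝ, ℝ) (fun y => P (f y)) x :=
        MDifferentiableAt.comp (g := P) x (hPd (f x)).differentiableAt.mdifferentiableAt (hfd x)
      have hd2 : MDifferentiableAt (𝓡 n) 𝓘(ℝ, ℝ) (fun y => κ (v y)) x :=
        MDifferentiableAt.comp (g := κ) x (hκd (v x)).differentiableAt.mdifferentiableAt (hvd x)
      rw [hg, lieDeriv_mul hd1 hd2, lieDeriv_comp (hPd _) (hfd x), lieDeriv_comp (hκd _) (hvd x)]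
      have h1 : 0 ≤ P (f x) * (κ' (v x) * lieDeriv X v x) :=
        mul_nonneg (hP0 _) (mul_nonneg_of_nonpos_of_nonpos (hκ'0 _)
          (hWX x (hNW (interior_subset hxN)).1.1))
      have h2 : κ (v x) * P' (f x) < 1 :=
        (mul_le_of_le_one_left (hP'0 _) (hκ1 _)).trans_lt (hP'1 _)
      have h3 := mul_lt_mul_of_neg_right h2 hneg
      linarith
    · rw [lieDeriv_congr (hout x hxN)]
      refine hneg.trans_eq ?_
      rw [lieDeriv, mfderiv_const]
      rfl

end DeformationFunction

end MorseReorder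

end

theorem mainTheorem4 {n : ℕ} {M : Type*} [TopologicalSpace M] [T2Space M]
    [SecondCountableTopology M] [ChartedSpace (EuclideanSpace ℝ (Fin n)) M]
    [IsManifold (𝓡 n) ∞ M]
    (f : M → ℝ) (hf : MorseReorder.IsMorse n f)
    (X : (x : M) → TangentSpace (𝓡 n) x) (hX : MorseReorder.IsPseudoGradient X f)
    (p : M) (hp : MorseReorder.IsCritical (n := n) f p)
    (k : ℕ) (hk : k = MorseReorder.morseIndex n f p)
    (a : ℝ) (ha : a < f p)
    (D : Set M) (φ : EuclideanSpace ℝ (Fin k) → M) (hφ : MorseReorder.IsDiscParam n k φ)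
    (hD : D = φ '' Metric.closedBall 0 1)
    (hDW : D ⊆ MorseReorder.unstableManifold X p)
    (hDa : φ '' Metric.sphere 0 1 ⊆ f ⁻¹' {a})
    (ε : ℝ) (hε : 0 < ε) (hεp : a + ε ≤ f p)
    (U : Set M) (hU : IsOpen U) (hDU : D ⊆ U) :
    ∃ F : ℝ → M → ℝ,
      ContMDiffOn (𝓘(ℝ, ℝ).prod (𝓡 n)) 𝓘(ℝ, ℝ) ∞ (fun q : ℝ × M => F q.1 q.2)
        (Icc (0 : ℝ) 1 ×ˢ univ) ∧
      (∀ t ∈ Icc (0 : ℝ) 1, MorseReorder.IsMorse n (F t)) ∧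
      F 0 = f ∧
      F 1 p = a + ε ∧
      (∀ t ∈ Icc (0 : ℝ) 1, MorseReorder.IsPseudoGradient X (F t)) ∧
      closure {x : M | ∃ t ∈ Icc (0 : ℝ) 1, F t x ≠ f x} ⊆ U := by
  have htan : ∀ y ∈ Metric.ball (0 : EuclideanSpace ℝ (Fin k)) 1,
      ∃ ξ, X (φ y) = mfderiv (𝓡 k) (𝓡 n) φ y ξ := fun y hy =>
    MorseReorder.exists_tangent_of_subset_unstableManifold hf hX hp hk (hφ.contMDiffAt hy)
      (hφ.injective_mfderiv hy) (by
        filter_upwards [Metric.isOpen_ball.mem_nhds hy] with z hz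
        exact hDW (hD ▸ ⟨z, Metric.ball_subset_closedBall hz, rfl⟩))
  obtain ⟨y₁, hy₁, hy₁p⟩ := MorseReorder.exists_param_eq hf hX hφ htan (hD ▸ hDW) hDa
  have hle : ∀ x ∈ D, f x ≤ f p := fun x hx =>
    MorseReorder.le_of_mem_unstableManifold hf hX (hDW hx)
  have hcrit : ∀ x ∈ D, MorseReorder.IsCritical (n := n) f x → x = p := fun x hx =>
    MorseReorder.eq_of_isCritical_of_mem_unstableManifold hf hX (hDW hx)
  have hDc : IsCompact D := by
    rw [hD]
    exact (isCompact_closedBall 0 1).image_of_continuousOn hφ.smooth.continuousOn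
  have hpD : p ∈ D := by
    rw [hD, ← hy₁p]
    exact ⟨y₁, Metric.ball_subset_closedBall hy₁, rfl⟩
  -- only the part of the disc above a level slightly larger than `a` matters
  set b : ℝ := a + ε / 2 with hb
  set K : Set M := D ∩ {x | b ≤ f x} with hK
  have hKc : IsCompact K := hDc.inter_right (isClosed_le continuous_const hf.1.continuous)
  have hpK : p ∈ K := ⟨hpD, by rw [mem_ofPred_eq, hb]; linarith⟩
  have hKint : ∀ x ∈ K, ∃ y ∈ Metric.ball (0 : EuclideanSpace ℝ (Fin k)) 1, φ y = x := by
    rintro x ⟨hxD, hxb⟩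
    rw [hD] at hxD
    obtain ⟨y, hy, rfl⟩ := hxD
    refine ⟨y, ?_, rfl⟩
    by_contra h
    have h1 : f (φ y) = a := hDa ⟨y, le_antisymm hy (not_lt.1 h), rfl⟩
    rw [mem_ofPred_eq, h1, hb] at hxb
    linarith
  have hloc : ∀ x ∈ K, ∃ O e, x ∈ O ∧ MorseReorder.IsDefiningOn X D O e := by
    intro x hx
    obtain ⟨y, hy, rfl⟩ := hKint x hx
    obtain ⟨-, -, -, -, O, e, hO, he⟩ :=
      MorseReorder.exists_normalCoordinates_isDefiningOn_inner hφ hX.smooth htan hy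
    exact ⟨O, e, hO, hD ▸ he⟩
  obtain ⟨O, e, hpO, hOe, hep⟩ : ∃ O e, p ∈ O ∧ MorseReorder.IsDefiningOn X D O e ∧
      ∀ᶠ x in 𝓝 p, MorseReorder.lieDeriv X e x ≤ 0 := by
    rw [hD, ← hy₁p]
    refine MorseReorder.exists_isDefiningOn_of_isCritical hf hX hφ htan hy₁ (hy₁p ▸ hp)
      (hy₁p ▸ hk) fun y hy => ?_
    rw [hy₁p]
    exact hle _ (hD ▸ ⟨y, Metric.ball_subset_closedBall hy, rfl⟩)
  obtain ⟨g, hgs, hg0, hgD, hgz, hgdom, hgp⟩ := MorseReorder.exists_global_equation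
    hKc.isClosed inter_subset_left hpK hloc hpO hOe hep
  obtain ⟨v, hvs, hv0, hvg, W, hW, hKW, hWv⟩ := MorseReorder.exists_nonincreasing_equation hf hX hKc
    (fun x hx => hcrit x hx.1) hgs hg0 hgdom hgp
  obtain ⟨ρ, hρs, hρp, hρU, hρc, hρX⟩ := MorseReorder.exists_deformation_function hf hX hp hDc hpD
    hcrit (b := b) (c := f p - a - ε) (by linarith) (by rw [hb]; linarith) hvs hv0
    (fun x hx => (hvg x).2 (hgD x hx)) (hW.inter (isOpen_interior (s := {x | g x = 0 → x ∈ D})))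
    (fun x hx => ⟨hKW hx, mem_interior_iff_mem_nhds.2 (hgz x hx)⟩)
    (fun x hx h => interior_subset hx.2 ((hvg x).1 h)) (fun x hx => hWv x hx.1) hU hDU
  have hF := fun t (ht : t ∈ Icc (0 : ℝ) 1) =>
    MorseReorder.isMorse_and_isPseudoGradient_sub hf hX hρs hρc hρX ht
  refine ⟨fun t x => f x - t * ρ x, ?_, fun t ht => (hF t ht).1, by simp, ?_,
    fun t ht => (hF t ht).2, ?_⟩
  · have h : ContMDiff (𝓘(ℝ, ℝ).prod (𝓡 n)) 𝓘(ℝ, ℝ) ∞ (fun q : ℝ × M => f q.2 - q.1 * ρ q.2) :=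
      (hf.1.comp contMDiff_snd).sub (contMDiff_fst.mul (hρs.comp contMDiff_snd))
    exact h.contMDiffOn
  · simp only [hρp]
    ring
  · refine (closure_mono fun x hx => ?_).trans hρU
    obtain ⟨t, -, ht⟩ := hx
    intro h
    exact ht (by simp [h])
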